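/- Notation. For $x\in\mathbb{C}$ and $i\in\mathbb{N}_0$ let $\binom{x}{i}=\frac{x(x-1)\cdots(x-i+1)}{i!}$. Let $x!=\Gamma(x+1)$ for $x\in\mathbb{C}$ not a negative integer, and $\binom{x}{y}=\frac{x!}{y!\,(x-y)!}$ for complex $y$. Let $$M(a;b;z)=\sum_{i=0}^\infty \frac{\binom{a+i-1}{i}}{\binom{b+i-1}{i}}\frac{z^i}{i!}\quad (b\notin\{0,-1,-2,\dots\}),$$ $$U(a;b;z)=\frac{\Gamma(1-b)}{\Gamma(1-b+a)}M(a;b;z)+\frac{\Gamma(b-1)}{\Gamma(a)}z^{1-b}M(a-b+1;2-b;z)\quad (b\notin\mathbb{Z}),$$ where $1/\Gamma$ is $0$ at the poles of $\Gamma$; for $b\in\mathbb{Z}$, $U(a;b;z)$ is the limit of $U(a;b';z)$ as $b'\to b$. Let $$\Gamma(s,z)=\int_z^\infty t^{s-1}e^{-t}\,dt\quad(z>0),\qquad L_i^{(\alpha)}(z)=\sum_{j=0}^i(-1)^j\binom{i+\alpha}{i-j}\frac{z^j}{j!}\quad(\alpha\in\mathbb{C}).$$ Theorem. All parameters $a,b,s,\alpha,\beta$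 are complex, and all the series below converge absolutely. (1) If $\Re(b-a)>0$ and none of $b$, $b-\beta$, $b-\beta-a$ is in $\{0,-1,-2,\dots\}$, then for all $z\in\mathbb{C}$ $$M(a;b;z)=\frac{\binom{b-1}{a}}{\binom{b-\beta-1}{a}}\sum_{i=0}^\infty(-1)^iL_i^{(\beta-i)}(z)\,\frac{\binom{-a}{i}}{\binom{\beta-b}{i}},$$ where, if $a$ is a negative integer, the quotient in front of the sum is read with the common factor $1/a!$ cancelled, as $\frac{\Gamma(b)\,\Gamma(b-\beta-a)}{\Gamma(b-a)\,\Gamma(b-\beta)}$. (2) If $\Re(\alpha-2b)>-\frac52$ and neither $2+\alpha-b$ nor $2+\alpha-b+a$ is in $\{0,-1,-2,\dots\}$, then for all real $z>0$ $$U(a;b;z)=\frac{(1+\alpha-b)!}{(1+\alpha-b+a)!}\sum_{i=0}^\infty L_i^{(\alpha)}(z)\,\frac{\binom{-a}{i}}{\binom{b-a-\alpha-2}{i}}.$$ (3) If $\Re\left(s-\frac\alpha2\right)<\frac14$ and $s-\alpha\notin\{1,2,3,\dots\}$, then for all real $z>0$ $$\Gamma(s,z)=z^se^{-z}\sum_{k=0}^\infty\frac{L_k^{(\alpha)}(z)}{(k+1)\binom{k+1+\alpha-s}{k+1}}.$$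 -/

import Mathlib

open Filter Topology

noncomputable section

/-- Kummer's confluent hypergeometric function of the first kind,
`M(a;b;z) = ∑ i, binom(a+i-1, i) / binom(b+i-1, i) * z^i / i!`
(meaningful when `b` is not a non-positive integer; the series then converges for all `z`). -/
def kummerM (a b z : ℂ) : ℂ :=
  ∑' i : ℕ, Ring.choose (a + i - 1) i / Ring.choose (b + i - 1) i * (z ^ i / (Nat.factorial i : ℂ))

/-- The combination of two functions of the first kind that gives Kummer's function of the second
kind when `b` is not an integer. Here `Complex.Gamma` vanishes at its poles, and division by zero
gives zero, so that `1 / Γ` has its true value `0` at the non-positive integers. -/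
def kummerUGeneric (a b z : ℂ) : ℂ :=
  Complex.Gamma (1 - b) / Complex.Gamma (1 - b + a) * kummerM a b z
    + Complex.Gamma (b - 1) / Complex.Gamma a * z ^ (1 - b) * kummerM (a - b + 1) (2 - b) z

open Classical in
/-- Kummer's (Tricomi's) confluent hypergeometric function of the second kind `U(a;b;z)`, with the
principal branch of `z ^ (1 - b)`; for an integer `b` it is the limit of the generic formula. -/
def kummerU (a b z : ℂ) : ℂ :=
  if ∃ n : ℤ, b = n then limUnder (𝓝[≠] b) (fun b' => kummerUGeneric a b' z)
  else kummerUGeneric a b z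

/-- The upper incomplete Gamma function `Γ(s, x) = ∫_x^∞ t^(s-1) e^(-t) dt`, for `x > 0`. -/
def upperGamma (s : ℂ) (x : ℝ) : ℂ :=
  ∫ t in Set.Ioi x, (t : ℂ) ^ (s - 1) * Complex.exp (-(t : ℂ))

/-- The (generalized) Laguerre polynomial
`L_i^(α)(z) = ∑ j ≤ i, (-1)^j binom(i+α, i-j) z^j / j!` with a complex parameter `α`. -/
def laguerreL (i : ℕ) (α z : ℂ) : ℂ :=
  ∑ j ∈ Finset.range (i + 1),
    (-1) ^ j * Ring.choose ((i : ℂ) + α) (i - j) * (z ^ j / (Nat.factorial j : ℂ))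

/-- The factorial `x! = Γ(x + 1)` of a complex number that is not a negative integer. -/
def complexFactorial (x : ℂ) : ℂ := Complex.Gamma (x + 1)

/-- The binomial coefficient `binom(x, y) = x! / (y! (x-y)!)` with a complex lower entry. -/
def complexBinom (x y : ℂ) : ℂ :=
  complexFactorial x / (complexFactorial y * complexFactorial (x - y))

end

/-! Write (a)_n for rising factorials; every binomial coefficient here is one of them up to a sign
and a factorial.

For `M`: with parameter β - i, the polynomial (-1)^i L_i^(β-i)(z) is the i-th Cauchy product of
z^j/j! with (-β)_k/k!. The resulting double series converges absolutely. For fixed j the sum over k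
is ₂F₁(a+j, -β; b-β+j; 1), and Gauss's theorem (`tsum_gaussTerm`) turns it into a constant times
(a)_j/(b)_j, the coefficient of `M`.

For `U`: put c = 2 + α - b and integrate the generating function ∑ L_i^(α)(z) t^i = (1-t)^(-α-1)
exp(-zt/(1-t)) against t^(a-1) (1-t)^(c-1) over (0,1). Termwise this gives beta integrals, hence the
coefficients (a)_i/(c+a)_i; the substitution t = u/(1+u) gives ∫ u^(a-1) (1+u)^(b-a-1) e^(-zu) du =
Γ(a) U (`hasSum_laguerreL_mul_poch`). Four things remain.

Convergence: `summable_norm_laguerreL` yields ∑ |L_n| (n+1)^(-σ) < ∞ for σ > Re α/2 + 3/4. Only mean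
squares are estimated, through Parseval on circles and a dyadic choice of radii, instead of
pointwise asymptotics.

The integral is Γ(a) U as defined: for 0 < Re b < 1 both sides solve Kummer's equation with the same
behaviour at 0; the identity theorem in b then covers all non-integers.

The restrictions Re c > 0 and Re a > 0: the first is lifted by raising α through summation by parts,
the second by a three-term recurrence in a shared by both sides. The boundary terms H_N of these
telescoping sums converge and satisfy ∑ |H_N|/(N+1) < ∞, so their limit is 0.

Integer b: the integral is continuous in b and the recurrence passes to limits, so the limit
defining `U` exists and equals the series.

Finally Γ(s,z) is z^s e^(-z) times the same integral with a = 1, b = 1 + s. -/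

/-! ### Rising factorials and their growth -/

/-- The rising factorial `a (a + 1) ⋯ (a + n - 1)`. -/
noncomputable def poch (a : ℂ) (n : ℕ) : ℂ := ∏ k ∈ Finset.range n, (a + k)

@[simp] lemma poch_zero (a : ℂ) : poch a 0 = 1 := by simp [poch]

lemma poch_succ (a : ℂ) (n : ℕ) : poch a (n + 1) = poch a n * (a + n) := by
  simp [poch, Finset.prod_range_succ]

lemma poch_add (a : ℂ) (m n : ℕ) : poch a (m + n) = poch a m * poch (a + m) n := by
  simp [poch, Finset.prod_range_add, add_assoc]

lemma poch_succ_left (a : ℂ) (n : ℕ) : poch a (n + 1) = a * poch (a + 1) n := by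
  rw [add_comm n 1, poch_add]
  simp [poch]

lemma poch_ne_zero {a : ℂ} (ha : ∀ n : ℕ, a ≠ -(n : ℂ)) (n : ℕ) : poch a n ≠ 0 :=
  Finset.prod_ne_zero_iff.mpr fun k _ h => ha k (eq_neg_of_add_eq_zero_left h)

lemma poch_one (n : ℕ) : poch 1 n = n.factorial := by
  induction n with
  | zero => simp
  | succ n ih => rw [poch_succ, ih, Nat.factorial_succ]; push_cast; ring

lemma factorial_ne_zero' (n : ℕ) : (n.factorial : ℂ) ≠ 0 := by
  exact_mod_cast n.factorial_ne_zero

lemma choose_add_sub_one (a : ℂ) (n : ℕ) :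
    Ring.choose (a + n - 1) n = poch a n / n.factorial := by
  rw [eq_div_iff (factorial_ne_zero' n), mul_comm, ← Ring.multichoose_eq, ← nsmul_eq_mul,
    Ring.factorial_nsmul_multichoose_eq_ascPochhammer, Polynomial.ascPochhammer_smeval_eq_eval]
  induction n with
  | zero => simp
  | succ n ih => rw [ascPochhammer_succ_eval, ih, poch_succ]

lemma choose_neg_eq (a : ℂ) (n : ℕ) :
    Ring.choose (-a) n = (-1) ^ n * (poch a n / n.factorial) := by
  rw [Ring.choose_neg, choose_add_sub_one]
  simp [Units.smul_def]

/-- Signs and factorials cancel; this is how the coefficients of the series for `M` and `U` become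
quotients of rising factorials. -/
lemma choose_neg_div_choose_neg (a c : ℂ) (n : ℕ) :
    Ring.choose (-a) n / Ring.choose (-c) n = poch a n / poch c n := by
  rw [choose_neg_eq, choose_neg_eq, mul_div_mul_left _ _ (by simp),
    div_div_div_cancel_right₀ (factorial_ne_zero' n)]

lemma Gamma_add_natCast {a : ℂ} (ha : ∀ n : ℕ, a ≠ -(n : ℂ)) (n : ℕ) :
    Complex.Gamma (a + n) = poch a n * Complex.Gamma a := by
  induction n with
  | zero => simp
  | succ n ih =>
    rw [poch_succ, mul_right_comm, ← ih, Nat.cast_succ, ← add_assoc, Complex.Gamma_add_one, mul_comm]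
    exact fun h => ha n (eq_neg_of_add_eq_zero_left h)

/-- Euler's limit formula read backwards. `GammaSeq a n` has n + 1 factors in its denominator,
whence the index n + 1; asymptotics of rising factorials follow from the limit of `GammaSeq`. -/
lemma poch_eq_GammaSeq {a : ℂ} (ha : ∀ n : ℕ, a ≠ -(n : ℂ)) {n : ℕ} (hn : n ≠ 0) :
    poch a (n + 1) = (n : ℂ) ^ a * n.factorial / Complex.GammaSeq a n := by
  have h : poch a (n + 1) ≠ 0 := poch_ne_zero ha _
  have h1 : (n : ℂ) ^ a ≠ 0 := by simp [Complex.cpow_eq_zero_iff, hn]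
  have h2 := factorial_ne_zero' n
  rw [Complex.GammaSeq, ← poch]
  field_simp

/-- `|(a)_n / (c)_n|` grows at most like `n ^ Re (a - c)`. -/
lemma exists_norm_poch_div_poch_le (a : ℂ) {c : ℂ} (hc : ∀ n : ℕ, c ≠ -(n : ℂ)) :
    ∃ C : ℝ, 0 < C ∧ ∀ n : ℕ, ‖poch a n / poch c n‖ ≤ C * ((n : ℝ) + 1) ^ (a - c).re := by
  have key : ∃ L : ℝ, Tendsto
      (fun n : ℕ => ‖poch a n / poch c n‖ / ((n : ℝ) + 1) ^ (a - c).re) atTop (𝓝 L) := by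
    by_cases ha : ∀ n : ℕ, a ≠ -(n : ℂ)
    · refine ⟨‖Complex.Gamma c / Complex.Gamma a‖ * 1, ?_⟩
      rw [← tendsto_add_atTop_iff_nat 1]
      have h1 := ((Complex.GammaSeq_tendsto_Gamma c).div (Complex.GammaSeq_tendsto_Gamma a)
        (Complex.Gamma_ne_zero ha)).norm
      -- The index shift compares n^ρ from Euler's formula with (n+2)^ρ from the normalisation.
      have h2 : Tendsto (fun n : ℕ => ((n : ℝ) / (n + 2)) ^ (a - c).re) atTop (𝓝 1) := by
        have := (tendsto_natCast_div_add_atTop (2 : ℝ)).rpow_const (p := (a - c).re)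
          (Or.inl one_ne_zero)
        simpa using this
      refine (h1.mul h2).congr' ?_
      filter_upwards [eventually_gt_atTop 0] with n hn
      have hn' : (0 : ℝ) < n := by exact_mod_cast hn
      rw [poch_eq_GammaSeq ha hn.ne', poch_eq_GammaSeq hc hn.ne']
      have e : ‖(n : ℂ) ^ a‖ / ‖(n : ℂ) ^ c‖ = (n : ℝ) ^ (a - c).re := by
        rw [← norm_div, ← Complex.cpow_sub _ _ (by exact_mod_cast hn.ne'),
          Complex.norm_natCast_cpow_of_pos hn]
      rw [Real.div_rpow hn'.le (by positivity), ← e]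
      have h3 : ((n : ℝ) + 2) ^ (a - c).re ≠ 0 := by positivity
      have h5 : ‖(n.factorial : ℂ)‖ ≠ 0 := by simpa using factorial_ne_zero' n
      have h6 : ‖(n : ℂ) ^ c‖ ≠ 0 := by simp [Complex.cpow_eq_zero_iff, hn.ne']
      push_cast
      rw [add_assoc, one_add_one_eq_two]
      simp only [Pi.div_apply, norm_div, norm_mul]
      field_simp
    -- Here Γ(a) has a pole, but (a)_n vanishes for n > m, so the limit is 0.
    · push Not at ha
      obtain ⟨m, rfl⟩ := ha
      refine ⟨0, tendsto_const_nhds.congr' ?_⟩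
      filter_upwards [eventually_gt_atTop m] with n hn
      have : poch (-(m : ℂ)) n = 0 :=
        Finset.prod_eq_zero (Finset.mem_range.mpr hn) (by simp)
      simp [this]
  obtain ⟨L, hL⟩ := key
  obtain ⟨C, hC⟩ := hL.bddAbove_range
  refine ⟨max C 1, by positivity, fun n => ?_⟩
  have hn : 0 < ((n : ℝ) + 1) ^ (a - c).re := by positivity
  rw [← div_le_iff₀ hn]
  exact (hC ⟨n, rfl⟩).trans (le_max_left _ _)

/-- Limit of a balanced quotient of rising factorials. -/
lemma tendsto_poch_quotient {p q r s : ℂ} (hp : ∀ n : ℕ, p ≠ -(n : ℂ)) (hq : ∀ n : ℕ, q ≠ -(n : ℂ))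
    (hr : ∀ n : ℕ, r ≠ -(n : ℂ)) (hs : ∀ n : ℕ, s ≠ -(n : ℂ)) (h : p + q = r + s) :
    Tendsto (fun n => poch p n * poch q n / (poch r n * poch s n)) atTop
      (𝓝 (Complex.Gamma r * Complex.Gamma s / (Complex.Gamma p * Complex.Gamma q))) := by
  rw [← tendsto_add_atTop_iff_nat 1]
  have hl := ((Complex.GammaSeq_tendsto_Gamma r).mul (Complex.GammaSeq_tendsto_Gamma s)).div
    ((Complex.GammaSeq_tendsto_Gamma p).mul (Complex.GammaSeq_tendsto_Gamma q))
    (mul_ne_zero (Complex.Gamma_ne_zero hp) (Complex.Gamma_ne_zero hq))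
  refine hl.congr' ?_
  filter_upwards [eventually_ne_atTop 0] with n hn
  have e : (n : ℂ) ^ p * (n : ℂ) ^ q = (n : ℂ) ^ r * (n : ℂ) ^ s := by
    rw [← Complex.cpow_add _ _ (by exact_mod_cast hn), h, Complex.cpow_add _ _ (by exact_mod_cast hn)]
  have hG : ∀ x : ℂ, (∀ n : ℕ, x ≠ -(n : ℂ)) → Complex.GammaSeq x n ≠ 0 := by
    intro x hx
    rw [Complex.GammaSeq]
    refine div_ne_zero (mul_ne_zero ?_ (factorial_ne_zero' n)) (poch_ne_zero hx (n + 1))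
    simp [Complex.cpow_eq_zero_iff, hn]
  have h1 : ∀ x : ℂ, (n : ℂ) ^ x ≠ 0 := by simp [Complex.cpow_eq_zero_iff, hn]
  rw [poch_eq_GammaSeq hp hn, poch_eq_GammaSeq hq hn, poch_eq_GammaSeq hr hn,
    poch_eq_GammaSeq hs hn]
  have := hG p hp
  have := hG q hq
  have := hG r hr
  have := hG s hs
  have := h1 r
  have := h1 s
  have := factorial_ne_zero' n
  simp only [Pi.div_apply]
  field_simp
  linear_combination -e

lemma summable_nat_add_one_rpow {p : ℝ} (hp : p < -1) :
    Summable fun n : ℕ => ((n : ℝ) + 1) ^ p := by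
  have := (summable_nat_add_iff 1).mpr (Real.summable_nat_rpow.mpr hp)
  simpa using this

/-! ### Gauss's summation theorem -/

/-- The terms of the hypergeometric series `₂F₁(A, B; C; 1)`. -/
noncomputable def gaussTerm (A B C : ℂ) (k : ℕ) : ℂ := poch A k / poch C k * (poch B k / poch 1 k)

lemma one_ne_neg_natCast (n : ℕ) : (1 : ℂ) ≠ -(n : ℂ) := by
  intro h
  have := congrArg Complex.re h
  simp at this
  have h2 : (0 : ℝ) ≤ n := n.cast_nonneg
  linarith

/-- The growth bound is applied to (A)_k/(C)_k and to (B)_k/(1)_k; the denominator (1)_k = k! is the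
source of the -1 in the exponent. -/
lemma exists_norm_gaussTerm_le (A B : ℂ) {C : ℂ} (hC : ∀ n : ℕ, C ≠ -(n : ℂ)) :
    ∃ K : ℝ, 0 < K ∧ ∀ k : ℕ, ‖gaussTerm A B C k‖ ≤ K * ((k : ℝ) + 1) ^ ((A + B - C).re - 1) := by
  obtain ⟨K₁, h₁, hK₁⟩ := exists_norm_poch_div_poch_le A hC
  obtain ⟨K₂, h₂, hK₂⟩ := exists_norm_poch_div_poch_le B one_ne_neg_natCast
  refine ⟨K₁ * K₂, by positivity, fun k => ?_⟩
  have e : (A + B - C).re - 1 = (A - C).re + (B - 1).re := by simp; ring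
  rw [gaussTerm, norm_mul, e, Real.rpow_add (by positivity)]
  calc _ ≤ (K₁ * ((k : ℝ) + 1) ^ (A - C).re) * (K₂ * ((k : ℝ) + 1) ^ (B - 1).re) :=
        mul_le_mul (hK₁ k) (hK₂ k) (norm_nonneg _) (by positivity)
    _ = _ := by ring

lemma summable_norm_gaussTerm {A B C : ℂ} (hC : ∀ n : ℕ, C ≠ -(n : ℂ)) (h : 0 < (C - A - B).re) :
    Summable fun k => ‖gaussTerm A B C k‖ := by
  obtain ⟨K, _, hK⟩ := exists_norm_gaussTerm_le A B hC
  refine Summable.of_nonneg_of_le (fun _ => norm_nonneg _) hK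
    ((summable_nat_add_one_rpow ?_).mul_left K)
  simp only [Complex.sub_re, Complex.add_re] at h ⊢
  linarith

lemma add_natCast_ne_neg {C : ℂ} (hC : ∀ n : ℕ, C ≠ -(n : ℂ)) (m n : ℕ) :
    C + m ≠ -(n : ℂ) := fun h => hC (n + m) (by push_cast; linear_combination h)

/-- Contiguity in the lower parameter for Gauss's series at `1`. -/
lemma tsum_gaussTerm_contiguous {A B C : ℂ} (hC : ∀ n : ℕ, C ≠ -(n : ℂ)) (h : 0 < (C - A - B).re) :
    C * (C - A - B) * ∑' k, gaussTerm A B C k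
      = (C - A) * (C - B) * ∑' k, gaussTerm A B (C + 1) k := by
  have hC1 : ∀ n : ℕ, C + 1 ≠ -(n : ℂ) := by simpa using add_natCast_ne_neg hC 1
  have s1 := (summable_norm_gaussTerm hC h).of_norm
  have s2 := (summable_norm_gaussTerm (A := A) (B := B) hC1 (by
    simp only [Complex.sub_re, Complex.add_re, Complex.one_re] at h ⊢; linarith)).of_norm
  -- Termwise, the difference of the two sides is a telescoping difference of -C k times the k-th
  -- term.
  have hstep : ∀ k : ℕ, C * (C - A - B) * gaussTerm A B C k - (C - A) * (C - B) *
      gaussTerm A B (C + 1) k = -C * ((k + 1 : ℕ) : ℂ) * gaussTerm A B C (k + 1)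
        - (-C * (k : ℂ) * gaussTerm A B C k) := by
    intro k
    have h1 := poch_ne_zero hC k
    have h2 := poch_ne_zero hC1 k
    have h3 := poch_ne_zero one_ne_neg_natCast k
    have h4 : C + k ≠ 0 := fun h => hC k (eq_neg_of_add_eq_zero_left h)
    have h5 : (1 : ℂ) + k ≠ 0 := fun h => one_ne_neg_natCast k (eq_neg_of_add_eq_zero_left h)
    have h6 : C ≠ 0 := by simpa using hC 0
    have h7 : poch (C + 1) k = poch C k * (C + k) / C := by
      rw [eq_div_iff h6, mul_comm, ← poch_succ_left, poch_succ]
    simp only [gaussTerm, poch_succ, h7]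
    push_cast
    rw [add_comm (k : ℂ) 1]
    field_simp
    ring
  -- The boundary term is O(k^(-Re(C-A-B))), one power of k worse than the summand, which is exactly
  -- what the hypothesis allows.
  have hlim : Tendsto (fun k : ℕ => -C * (k : ℂ) * gaussTerm A B C k) atTop (𝓝 0) := by
    obtain ⟨K, hK, hb⟩ := exists_norm_gaussTerm_le A B hC
    have hz : Tendsto (fun k : ℕ => ‖C‖ * K * ((k : ℝ) + 1) ^ (-(C - A - B).re)) atTop (𝓝 0) := by
      have := ((tendsto_rpow_neg_atTop h).comp
        (tendsto_atTop_add_const_right _ (1 : ℝ) tendsto_natCast_atTop_atTop)).const_mul (‖C‖ * K)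
      simpa using this
    refine squeeze_zero_norm (fun k => ?_) hz
    rw [norm_mul, norm_mul, norm_neg, Complex.norm_natCast]
    have e : ((k : ℝ) + 1) * ((k : ℝ) + 1) ^ ((A + B - C).re - 1)
        = ((k : ℝ) + 1) ^ (-(C - A - B).re) := by
      rw [← Real.rpow_one_add' (by positivity)]
      · congr 1; simp; ring
      · simp only [Complex.sub_re, Complex.add_re] at h ⊢
        intro h'; linarith
    calc ‖C‖ * k * ‖gaussTerm A B C k‖
        ≤ ‖C‖ * (k + 1) * (K * ((k : ℝ) + 1) ^ ((A + B - C).re - 1)) := by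
          gcongr
          · linarith
          · exact hb k
      _ = _ := by rw [← e]; ring
  have hs := ((s1.mul_left (C * (C - A - B))).sub (s2.mul_left ((C - A) * (C - B)))).hasSum.tendsto_sum_nat
  simp only [hstep] at hs
  simp only [Finset.sum_range_sub (fun k : ℕ => -C * (k : ℂ) * gaussTerm A B C k)] at hs
  have := tendsto_nhds_unique hs (by simpa using hlim)
  simp only [← hstep] at this
  rw [(s1.mul_left _).tsum_sub (s2.mul_left _), tsum_mul_left, tsum_mul_left] at this
  exact sub_eq_zero.mp this

lemma norm_le_norm_add_ofReal {x : ℂ} (hx : 0 ≤ x.re) {t : ℝ} (ht : 0 ≤ t) : ‖x‖ ≤ ‖x + t‖ := by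
  rw [← sq_le_sq₀ (norm_nonneg _) (norm_nonneg _), Complex.sq_norm, Complex.sq_norm,
    Complex.normSq_apply, Complex.normSq_apply]
  simp only [Complex.add_re, Complex.ofReal_re, Complex.add_im, Complex.ofReal_im, add_zero]
  nlinarith [mul_nonneg hx ht]

lemma one_le_norm_poch {x : ℂ} (hx : 1 ≤ x.re) (n : ℕ) : 1 ≤ ‖poch x n‖ := by
  induction n with
  | zero => simp
  | succ n ih =>
    rw [poch_succ, norm_mul]
    refine one_le_mul_of_one_le_of_one_le ih (le_trans ?_ (Complex.re_le_norm _))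
    have : (0 : ℝ) ≤ n := n.cast_nonneg
    simp only [Complex.add_re, Complex.natCast_re]
    linarith

/-- As the lower parameter goes to infinity every term except k = 0 dies. Once Re(C + N₀) > 0,
increasing N further only enlarges the factors of the denominator, so the series at C + N₀
dominates. -/
lemma tendsto_tsum_gaussTerm_add_nat {A B C : ℂ} (hC : ∀ n : ℕ, C ≠ -(n : ℂ)) (h : 0 < (C - A - B).re) :
    Tendsto (fun N : ℕ => ∑' k, gaussTerm A B (C + N) k) atTop (𝓝 1) := by
  obtain ⟨N₀, hN₀⟩ := exists_nat_gt (-C.re)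
  rw [← tendsto_add_atTop_iff_nat N₀]
  have hC0 := add_natCast_ne_neg hC N₀
  have hs : Summable fun k => ‖gaussTerm A B (C + N₀) k‖ := summable_norm_gaussTerm hC0 (by
    have : (0 : ℝ) ≤ N₀ := N₀.cast_nonneg
    simp only [Complex.sub_re, Complex.add_re, Complex.natCast_re] at h ⊢; linarith)
  have hone : (1 : ℂ) = ∑' k : ℕ, if k = 0 then 1 else 0 := by simp
  rw [hone]
  refine tendsto_tsum_of_dominated_convergence hs (fun k => ?_) (Eventually.of_forall fun N k => ?_)
  · rcases Nat.eq_zero_or_pos k with rfl | hk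
    · simp [gaussTerm]
    · rw [if_neg hk.ne']
      have h1 : Tendsto (fun N : ℕ => ‖poch (C + ((N + N₀ : ℕ) : ℂ)) k‖) atTop atTop := by
        obtain ⟨j, rfl⟩ := Nat.exists_eq_succ_of_ne_zero hk.ne'
        refine tendsto_atTop_mono (fun N => ?_) (tendsto_natCast_atTop_atTop (R := ℝ))
        have hre : (N : ℝ) ≤ (C + ((N + N₀ : ℕ) : ℂ)).re := by
          simp only [Complex.add_re, Complex.natCast_re]; push_cast; linarith
        rw [Nat.succ_eq_add_one, poch_succ_left, norm_mul]
        have h0 : (0 : ℝ) ≤ N := N.cast_nonneg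
        calc (N : ℝ) = N * 1 := (mul_one _).symm
          _ ≤ _ := mul_le_mul (hre.trans (Complex.re_le_norm _))
            (one_le_norm_poch (by simpa using h0.trans hre) j) zero_le_one (norm_nonneg _)
      rw [tendsto_zero_iff_norm_tendsto_zero]
      have h2 := (h1.inv_tendsto_atTop).const_mul (‖poch A k‖ * ‖poch B k / poch 1 k‖)
      rw [mul_zero] at h2
      refine h2.congr fun N => ?_
      simp only [gaussTerm, norm_mul, norm_div, Pi.inv_apply]
      ring
  · rw [gaussTerm, gaussTerm, norm_mul, norm_mul, norm_div, norm_div (poch A k)]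
    gcongr ?_ * _
    refine div_le_div_of_nonneg_left (norm_nonneg _) (by simpa using poch_ne_zero hC0 k) ?_
    rw [poch, poch, norm_prod, norm_prod]
    refine Finset.prod_le_prod (fun _ _ => norm_nonneg _) fun i _ => ?_
    have e : C + ((N + N₀ : ℕ) : ℂ) + i = C + N₀ + i + (N : ℝ) := by push_cast; ring
    rw [e]
    refine norm_le_norm_add_ofReal ?_ N.cast_nonneg
    have : (0 : ℝ) ≤ i := i.cast_nonneg
    simp only [Complex.add_re, Complex.natCast_re]
    linarith

/-- **Gauss's summation theorem**. -/
lemma tsum_gaussTerm {A B C : ℂ} (hC : ∀ n : ℕ, C ≠ -(n : ℂ)) (hCA : ∀ n : ℕ, C - A ≠ -(n : ℂ))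
    (hCB : ∀ n : ℕ, C - B ≠ -(n : ℂ)) (h : 0 < (C - A - B).re) :
    ∑' k, gaussTerm A B C k = Complex.Gamma C * Complex.Gamma (C - A - B) /
      (Complex.Gamma (C - A) * Complex.Gamma (C - B)) := by
  have hCAB : ∀ n : ℕ, C - A - B ≠ -(n : ℂ) := by
    intro n hn
    rw [hn] at h
    have : (0 : ℝ) ≤ n := n.cast_nonneg
    simp at h
    linarith
  -- Contiguity is iterated N times; as N → ∞ the prefactor tends to the quotient of Gamma values
  -- and the remaining series to 1.
  have key : ∀ N : ℕ, ∑' k, gaussTerm A B C k = poch (C - A) N * poch (C - B) N /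
      (poch C N * poch (C - A - B) N) * ∑' k, gaussTerm A B (C + N) k := by
    intro N
    induction N with
    | zero => simp
    | succ N ih =>
      have hc := tsum_gaussTerm_contiguous (A := A) (B := B) (add_natCast_ne_neg hC N) (by
        have : (0 : ℝ) ≤ N := N.cast_nonneg
        simp only [Complex.sub_re, Complex.add_re, Complex.natCast_re] at h ⊢; linarith)
      have h1 : C + N ≠ 0 := fun h => hC N (eq_neg_of_add_eq_zero_left h)
      have h2 : C - A - B + N ≠ 0 := fun h => hCAB N (eq_neg_of_add_eq_zero_left h)
      have h3 := poch_ne_zero hC N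
      have h4 := poch_ne_zero hCAB N
      rw [ih]
      simp only [poch_succ]
      push_cast
      rw [← add_assoc]
      field_simp
      linear_combination (poch (C - A) N * poch (C - B) N) * hc
  have hlim := (tendsto_poch_quotient hCA hCB hC hCAB (by ring)).mul
    (tendsto_tsum_gaussTerm_add_nat hC h)
  rw [mul_one] at hlim
  exact tendsto_nhds_unique (tendsto_const_nhds.congr key) hlim

/-! ### Laguerre expansion of the function of the first kind -/

lemma tsum_sum_antidiagonal {F : ℕ × ℕ → ℂ} (hF : Summable fun p => ‖F p‖) :
    (Summable fun n => ∑ p ∈ Finset.HasAntidiagonal.antidiagonal n, F p) ∧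
      ∑' n, ∑ p ∈ Finset.HasAntidiagonal.antidiagonal n, F p = ∑' j, ∑' k, F (j, k) := by
  have h1 : Summable fun x : (Σ n : ℕ, Finset.HasAntidiagonal.antidiagonal n) => F x.2 :=
    (Finset.HasAntidiagonal.sigmaAntidiagonalEquivProd.summable_iff).mpr hF.of_norm
  have h2 := h1.hasSum.sigma (g := fun n => ∑ p ∈ Finset.HasAntidiagonal.antidiagonal n, F p) (fun n => by
    have := hasSum_fintype (fun p : Finset.HasAntidiagonal.antidiagonal n => F p)
    rwa [Finset.sum_coe_sort (Finset.HasAntidiagonal.antidiagonal n) F] at this)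
  refine ⟨h2.summable, ?_⟩
  rw [h2.tsum_eq, ← hF.of_norm.tsum_prod,
    ← Finset.HasAntidiagonal.sigmaAntidiagonalEquivProd.tsum_eq]
  rfl

lemma kummerM_eq_tsum (a b z : ℂ) :
    kummerM a b z = ∑' n : ℕ, poch a n / poch b n * (z ^ n / n.factorial) := by
  refine tsum_congr fun n => ?_
  rw [choose_add_sub_one, choose_add_sub_one, div_div_div_cancel_right₀ (factorial_ne_zero' n)]

/-- With parameter β - i the binomial coefficient is binom(β, i-j), which depends on i - j only, so
the sum is a Cauchy product; the three signs multiply to 1. -/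
lemma laguerreL_sub_natCast (i : ℕ) (β z : ℂ) :
    (-1) ^ i * laguerreL i (β - i) z = ∑ p ∈ Finset.HasAntidiagonal.antidiagonal i,
      z ^ p.1 / p.1.factorial * (poch (-β) p.2 / poch 1 p.2) := by
  rw [Finset.Nat.sum_antidiagonal_eq_sum_range_succ
    (fun j k => z ^ j / j.factorial * (poch (-β) k / poch 1 k)), laguerreL, Finset.mul_sum]
  refine Finset.sum_congr rfl fun j hj => ?_
  have hj' : j ≤ i := Nat.lt_succ_iff.mp (Finset.mem_range.mp hj)
  have e : (i : ℂ) + (β - i) = -(-β) := by ring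
  rw [e, choose_neg_eq, poch_one]
  obtain ⟨k, rfl⟩ := Nat.exists_eq_add_of_le hj'
  have h1 : ((-1 : ℂ) ^ k) ^ 2 = 1 := by rw [← pow_mul, mul_comm, pow_mul]; simp
  have h2 : ((-1 : ℂ) ^ j) ^ 2 = 1 := by rw [← pow_mul, mul_comm, pow_mul]; simp
  rw [Nat.add_sub_cancel_left, pow_add]
  linear_combination (((-1 : ℂ) ^ k) ^ 2 * (poch (-β) k / ↑k.factorial * (z ^ j / j.factorial))) * h2
    + (poch (-β) k / ↑k.factorial * (z ^ j / j.factorial)) * h1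

/-- A power of j + 1 is at most a constant times e^j, so the exponential series at x e dominates. -/
lemma summable_pow_div_factorial_mul_rpow (x ρ : ℝ) (hx : 0 ≤ x) :
    Summable fun j : ℕ => x ^ j / j.factorial * ((j : ℝ) + 1) ^ ρ := by
  obtain ⟨m, hm⟩ := exists_nat_ge ρ
  have h1 : ∀ j : ℕ, ((j : ℝ) + 1) ^ ρ ≤ m.factorial * Real.exp 1 * Real.exp 1 ^ j := by
    intro j
    have h0 : (1 : ℝ) ≤ (j : ℝ) + 1 := by linarith [(Nat.cast_nonneg j : (0 : ℝ) ≤ j)]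
    calc ((j : ℝ) + 1) ^ ρ ≤ ((j : ℝ) + 1) ^ (m : ℝ) := Real.rpow_le_rpow_of_exponent_le h0 hm
      _ = ((j : ℝ) + 1) ^ m := Real.rpow_natCast _ _
      _ ≤ m.factorial * Real.exp ((j : ℝ) + 1) := by
        have := Real.pow_div_factorial_le_exp ((j : ℝ) + 1) (by positivity) m
        rwa [div_le_iff₀' (by positivity)] at this
      _ = _ := by rw [Real.exp_add, ← Real.exp_nat_mul, mul_one]; ring
  refine Summable.of_nonneg_of_le (fun j => by positivity) (fun j => ?_)
    ((Real.summable_pow_div_factorial (x * Real.exp 1)).mul_left (m.factorial * Real.exp 1))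
  calc x ^ j / j.factorial * ((j : ℝ) + 1) ^ ρ
      ≤ x ^ j / j.factorial * (m.factorial * Real.exp 1 * Real.exp 1 ^ j) := by
        gcongr; exact h1 j
    _ = _ := by rw [mul_pow]; ring

/-- Separates the variables of the double series: j + k + 1 ≤ (j+1)(k+1) for ρ ≥ 0, while for ρ ≤ 0
the term j can simply be dropped. -/
lemma add_one_rpow_le (ρ : ℝ) (j k : ℕ) :
    (((j + k : ℕ) : ℝ) + 1) ^ ρ ≤ ((j : ℝ) + 1) ^ |ρ| * ((k : ℝ) + 1) ^ ρ := by
  have hj : (0 : ℝ) ≤ j := j.cast_nonneg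
  have hk : (0 : ℝ) ≤ k := k.cast_nonneg
  push_cast
  rcases le_total 0 ρ with h | h
  · rw [abs_of_nonneg h, ← Real.mul_rpow (by positivity) (by positivity)]
    refine Real.rpow_le_rpow (by positivity) ?_ h
    nlinarith [mul_nonneg hj hk]
  · calc ((j : ℝ) + k + 1) ^ ρ ≤ ((k : ℝ) + 1) ^ ρ :=
          Real.rpow_le_rpow_of_nonpos (by positivity) (by linarith) h
      _ ≤ _ := le_mul_of_one_le_left (by positivity)
          (Real.one_le_rpow (by linarith) (abs_nonneg _))

lemma succ_rpow_le (ρ : ℝ) (n : ℕ) :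
    (((n + 1 : ℕ) : ℝ) + 1) ^ ρ ≤ 2 ^ |ρ| * ((n : ℝ) + 1) ^ ρ := by
  have h := add_one_rpow_le ρ 1 n
  rw [add_comm n 1]
  convert h using 3
  norm_num

/-- The Laguerre expansion of Kummer's function of the first kind. -/
lemma kummerM_laguerre_expansion {a b β : ℂ} (z : ℂ) (h : 0 < (b - a).re)
    (hb : ∀ n : ℕ, b ≠ -(n : ℂ)) (hbβ : ∀ n : ℕ, b - β ≠ -(n : ℂ))
    (hbβa : ∀ n : ℕ, b - β - a ≠ -(n : ℂ)) :
    (Summable fun i : ℕ => (-1 : ℂ) ^ i * laguerreL i (β - i) z *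
        (Ring.choose (-a) i / Ring.choose (β - b) i)) ∧
      kummerM a b z = (Complex.Gamma b / Complex.Gamma (b - a)) /
          (Complex.Gamma (b - β) / Complex.Gamma (b - β - a)) *
        ∑' i : ℕ, (-1 : ℂ) ^ i * laguerreL i (β - i) z *
          (Ring.choose (-a) i / Ring.choose (β - b) i) := by
  set F : ℕ × ℕ → ℂ := fun p => z ^ p.1 / p.1.factorial * (poch (-β) p.2 / poch 1 p.2) *
    (poch a (p.1 + p.2) / poch (b - β) (p.1 + p.2)) with hFdef
  have hterm : ∀ i : ℕ, (-1 : ℂ) ^ i * laguerreL i (β - i) z *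
      (Ring.choose (-a) i / Ring.choose (β - b) i) = ∑ p ∈ Finset.HasAntidiagonal.antidiagonal i, F p := by
    intro i
    rw [laguerreL_sub_natCast, ← neg_sub b β, choose_neg_div_choose_neg, Finset.sum_mul]
    refine Finset.sum_congr rfl fun p hp => ?_
    rw [hFdef, ← Finset.HasAntidiagonal.mem_antidiagonal.mp hp]
  obtain ⟨K₁, h₁, hK₁⟩ := exists_norm_poch_div_poch_le (-β) one_ne_neg_natCast
  obtain ⟨K₂, h₂, hK₂⟩ := exists_norm_poch_div_poch_le a hbβ
  -- The majorant factors into a series of exponential type in j and ∑ (k+1)^(Re(a-b)-1); the latter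
  -- converges because Re(b-a) > 0.
  have hF : Summable fun p => ‖F p‖ := by
    have hs := ((summable_pow_div_factorial_mul_rpow ‖z‖ |(a - (b - β)).re| (norm_nonneg z)).mul_of_nonneg
      (summable_nat_add_one_rpow (p := (a - b).re - 1) (by
        simp only [Complex.sub_re] at h ⊢; linarith)) (fun _ => by positivity)
        (fun _ => by positivity)).mul_left (K₁ * K₂)
    refine Summable.of_nonneg_of_le (fun _ => norm_nonneg _) (fun p => ?_) hs
    obtain ⟨j, k⟩ := p
    have e : (a - b).re - 1 = (-β - 1).re + (a - (b - β)).re := by simp; ring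
    simp only [hFdef, norm_mul]
    rw [e, Real.rpow_add (by positivity)]
    calc _ ≤ ‖z‖ ^ j / j.factorial * (K₁ * ((k : ℝ) + 1) ^ (-β - 1).re) *
          (K₂ * (((j + k : ℕ) : ℝ) + 1) ^ (a - (b - β)).re) := by
          gcongr
          · simp
          · exact hK₁ k
          · exact hK₂ (j + k)
      _ ≤ ‖z‖ ^ j / j.factorial * (K₁ * ((k : ℝ) + 1) ^ (-β - 1).re) *
          (K₂ * (((j : ℝ) + 1) ^ |(a - (b - β)).re| * ((k : ℝ) + 1) ^ (a - (b - β)).re)) := by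
          gcongr
          exact add_one_rpow_le _ j k
      _ = _ := by ring
  have hba : ∀ n : ℕ, b - a ≠ -(n : ℂ) := by
    intro n hn
    have : (0 : ℝ) ≤ n := n.cast_nonneg
    rw [hn] at h
    simp at h
    linarith
  obtain ⟨hsum, htsum⟩ := tsum_sum_antidiagonal hF
  simp only [hterm]
  refine ⟨hsum, ?_⟩
  rw [htsum, kummerM_eq_tsum, ← tsum_mul_left]
  refine tsum_congr fun j => ?_
  -- Splitting (a)_(j+k) = (a)_j (a+j)_k, and likewise below, leaves Gauss's series in k.
  have hinner : ∑' k, F (j, k) = z ^ j / j.factorial * (poch a j / poch (b - β) j) *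
      ∑' k, gaussTerm (a + j) (-β) (b - β + j) k := by
    rw [← tsum_mul_left]
    refine tsum_congr fun k => ?_
    simp only [hFdef, gaussTerm, poch_add]
    ring
  have e1 : b - β + j - (a + j) = b - β - a := by ring
  have e2 : b - β + j - -β = b + j := by ring
  have e3 : b - β + j - (a + j) - -β = b - a := by ring
  rw [hinner, tsum_gaussTerm (add_natCast_ne_neg hbβ j) (by rwa [e1])
    (by rw [e2]; exact add_natCast_ne_neg hb j) (by rwa [e3]), e1, e2]
  have e3' : b - β - a - -β = b - a := by ring
  rw [e3', Gamma_add_natCast hbβ, Gamma_add_natCast hb]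
  have n1 := Complex.Gamma_ne_zero hb
  have n2 := Complex.Gamma_ne_zero hbβ
  have n3 := Complex.Gamma_ne_zero hba
  have n4 := Complex.Gamma_ne_zero hbβa
  have n5 := poch_ne_zero hb j
  have n6 := poch_ne_zero hbβ j
  have n7 := factorial_ne_zero' j
  field_simp

/-! ### Identities and generating function of the Laguerre polynomials -/

lemma laguerreL_eq_sum_range (i : ℕ) (α z : ℂ) :
    laguerreL i α z = ∑ j ∈ Finset.range (i + 1),
      (-z) ^ j / j.factorial * (poch (α + 1 + j) (i - j) / (i - j).factorial) := by
  refine Finset.sum_congr rfl fun j hj => ?_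
  have hj' : j ≤ i := Nat.lt_succ_iff.mp (Finset.mem_range.mp hj)
  have e : (i : ℂ) + α = (α + 1 + j) + ((i - j : ℕ) : ℂ) - 1 := by
    rw [Nat.cast_sub hj']; ring
  rw [e, choose_add_sub_one, neg_pow z]
  ring

@[simp] lemma laguerreL_zero (α z : ℂ) : laguerreL 0 α z = 1 := by
  simp [laguerreL_eq_sum_range]

/-- Pascal's rule for the coefficients `(x)_k / k!`. -/
lemma poch_div_factorial_pascal (x : ℂ) (k : ℕ) :
    poch x (k + 1) / (k + 1).factorial =
      poch (x + 1) (k + 1) / (k + 1).factorial - poch (x + 1) k / k.factorial := by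
  have h := factorial_ne_zero' k
  have h1 : (k : ℂ) + 1 ≠ 0 := by exact_mod_cast k.succ_ne_zero
  rw [poch_succ_left, poch_succ (x + 1), Nat.factorial_succ]
  push_cast
  field_simp
  ring

/-- Pascal's rule applied termwise; the leading term j = n + 1 does not depend on α. -/
lemma laguerreL_succ_eq_sub (n : ℕ) (α z : ℂ) :
    laguerreL (n + 1) α z = laguerreL (n + 1) (α + 1) z - laguerreL n (α + 1) z := by
  simp only [laguerreL_eq_sum_range]
  rw [Finset.sum_range_succ _ (n + 1), Finset.sum_range_succ _ (n + 1), add_sub_right_comm,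
    ← Finset.sum_sub_distrib]
  simp only [Nat.sub_self, poch_zero]
  congr 1
  refine Finset.sum_congr rfl fun j hj => ?_
  have hj' : j ≤ n := Nat.lt_succ_iff.mp (Finset.mem_range.mp hj)
  rw [Nat.succ_sub hj', Nat.succ_eq_add_one, poch_div_factorial_pascal,
    show α + 1 + j + 1 = α + 1 + 1 + j by ring]
  ring

/-- Trades a lower parameter for a factor 1/(n+1). The coefficient identity splits off (α+1)
L_n^(α+1); what remains carries a factor j, which cancels against j! and after the shift of j
becomes -z L_n^(α+2). -/
lemma succ_mul_laguerreL (n : ℕ) (α z : ℂ) :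
    ((n : ℂ) + 1) * laguerreL (n + 1) α z =
      (α + 1) * laguerreL n (α + 1) z - z * laguerreL n (α + 2) z := by
  simp only [laguerreL_eq_sum_range]
  have h1 : ((n : ℂ) + 1) * ∑ j ∈ Finset.range (n + 1 + 1), (-z) ^ j / j.factorial *
        (poch (α + 1 + j) (n + 1 - j) / (n + 1 - j).factorial) =
      (α + 1) * (∑ j ∈ Finset.range (n + 1), (-z) ^ j / j.factorial *
        (poch (α + 1 + 1 + j) (n - j) / (n - j).factorial)) +
      ∑ j ∈ Finset.range (n + 1 + 1), (j : ℂ) * ((-z) ^ j / j.factorial *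
        (poch (α + 2 + j) (n + 1 - j) / (n + 1 - j).factorial)) := by
    rw [Finset.sum_range_succ _ (n + 1), Finset.sum_range_succ _ (n + 1), mul_add, Finset.mul_sum,
      Finset.mul_sum, ← add_assoc, ← Finset.sum_add_distrib]
    simp only [Nat.sub_self, poch_zero]
    congr 1
    · refine Finset.sum_congr rfl fun j hj => ?_
      have hj' : j ≤ n := Nat.lt_succ_iff.mp (Finset.mem_range.mp hj)
      obtain ⟨k, rfl⟩ := Nat.exists_eq_add_of_le hj'
      rw [add_assoc j k 1, Nat.add_sub_cancel_left, Nat.add_sub_cancel_left,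
        show α + 2 + (j : ℂ) = α + 1 + j + 1 by ring,
        show α + 1 + 1 + (j : ℂ) = α + 1 + j + 1 by ring, poch_succ_left, poch_succ (α + 1 + j + 1),
        Nat.factorial_succ]
      have h := factorial_ne_zero' k
      have h2 := factorial_ne_zero' j
      have h1 : (k : ℂ) + 1 ≠ 0 := by exact_mod_cast k.succ_ne_zero
      push_cast
      field_simp
      ring
    · push_cast; ring
  rw [h1, sub_eq_add_neg, add_right_inj, Finset.sum_range_succ']
  simp only [Nat.cast_zero, zero_mul, add_zero, Nat.add_sub_add_right]
  rw [Finset.mul_sum, ← Finset.sum_neg_distrib]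
  refine Finset.sum_congr rfl fun j _ => ?_
  have h2 := factorial_ne_zero' j
  have h1 : (j : ℂ) + 1 ≠ 0 := by exact_mod_cast j.succ_ne_zero
  rw [Nat.factorial_succ, pow_succ]
  push_cast
  rw [show α + 2 + ((j : ℂ) + 1) = α + 2 + 1 + j by ring]
  field_simp

lemma laguerreL_one (α z : ℂ) : laguerreL 1 α z = 1 + α - z := by
  have := succ_mul_laguerreL 0 α z
  simp only [laguerreL_zero, Nat.cast_zero, zero_add, one_mul, mul_one] at this
  rw [this]; ring

/-- The three-term recurrence of the Laguerre polynomials. -/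
lemma laguerreL_three_term (n : ℕ) (α z : ℂ) :
    ((n : ℂ) + 2) * laguerreL (n + 2) α z =
      (2 * n + 3 + α - z) * laguerreL (n + 1) α z - (n + 1 + α) * laguerreL n α z := by
  have i1 := laguerreL_succ_eq_sub n α z
  have i2 := laguerreL_succ_eq_sub n (α + 1) z
  have a0 := succ_mul_laguerreL n α z
  have a1 := succ_mul_laguerreL (n + 1) α z
  rw [show α + 1 + 1 = α + 2 by ring] at i2
  push_cast at a1
  -- Eliminating the polynomials of parameter α + 1 and α + 2 needs the identities at index n - 1 as
  -- well, hence the separate case n = 0.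
  rcases n with _ | m
  · simp only [zero_add, Nat.cast_zero, laguerreL_zero, laguerreL_one] at *
    linear_combination a1
  · have i3 := laguerreL_succ_eq_sub m (α + 1) z
    have i4 := laguerreL_succ_eq_sub m α z
    have a2 := succ_mul_laguerreL m α z
    rw [show α + 1 + 1 = α + 2 by ring] at i3
    push_cast at *
    linear_combination a1 - 2 * a0 + a2 - (α + 1 - z) * i1 + (α + 1) * i4 + z * i2 - z * i3

/-- The majorant is a coefficient of the real binomial series (1-x)^(-(‖α‖+1+j)), so the series of
absolute values can again be summed in closed form. -/
lemma norm_poch_le (α : ℂ) (j k : ℕ) :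
    ‖poch (α + 1 + j) k / k.factorial‖ ≤ Ring.choose (‖α‖ + 1 + j + k - 1) k := by
  have e : Ring.choose (‖α‖ + 1 + j + k - 1) k =
      (∏ i ∈ Finset.range k, (‖α‖ + 1 + j + i)) / k.factorial := by
    apply Complex.ofReal_injective
    rw [Complex.ofReal_choose]
    have := choose_add_sub_one ((‖α‖ : ℂ) + 1 + j) k
    push_cast
    rw [this, poch]
  rw [e, norm_div, Complex.norm_natCast, poch, norm_prod]
  gcongr with i
  calc ‖α + 1 + j + i‖ ≤ ‖α‖ + ‖(1 : ℂ)‖ + ‖(j : ℂ)‖ + ‖(i : ℂ)‖ := by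
        refine (norm_add_le _ _).trans (add_le_add_left ((norm_add_le _ _).trans
          (add_le_add_left (norm_add_le _ _) _)) _)
    _ = _ := by simp

/-- The generating function of the Laguerre polynomials. -/
lemma hasSum_laguerreL (α z : ℂ) {t : ℂ} (ht : ‖t‖ < 1) :
    HasSum (fun n => laguerreL n α z * t ^ n)
      (1 / (1 - t) ^ (α + 1) * Complex.exp (-z * t / (1 - t))) := by
  have hball : t ∈ Metric.eball (0 : ℂ) 1 := by
    rw [← ENNReal.ofReal_one, Metric.eball_ofReal]; simpa using ht
  have h1t : (1 : ℂ) - t ≠ 0 := by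
    intro h
    rw [← sub_eq_zero.mp h] at ht
    simp at ht
  -- Rows sum, by the binomial series, to (-zt)^j / j! · (1-t)^(-α-1-j), and then to an exponential;
  -- antidiagonals sum to L_n t^n.
  set F : ℕ × ℕ → ℂ := fun p => (-z * t) ^ p.1 / p.1.factorial *
    (poch (α + 1 + p.1) p.2 / p.2.factorial * t ^ p.2) with hFdef
  have hF : Summable fun p => ‖F p‖ := by
    have hr : ∀ j : ℕ, HasSum (fun k : ℕ => ‖-z * t‖ ^ j / j.factorial *
        (Ring.choose (‖α‖ + 1 + j + k - 1) k * ‖t‖ ^ k))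
        (‖-z * t‖ ^ j / j.factorial * (1 / (1 - ‖t‖) ^ (‖α‖ + 1 + j))) := by
      intro j
      refine HasSum.mul_left _ ?_
      have hb : ‖t‖ ∈ Metric.eball (0 : ℝ) 1 := by
        rw [← ENNReal.ofReal_one, Metric.eball_ofReal]; simpa using ht
      have := (Real.one_div_one_sub_rpow_hasFPowerSeriesOnBall_zero (‖α‖ + 1 + j)).hasSum hb
      simpa [FormalMultilinearSeries.ofScalars_apply_eq, mul_comm] using this
    have hsum : Summable fun p : ℕ × ℕ => ‖-z * t‖ ^ p.1 / p.1.factorial *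
        (Ring.choose (‖α‖ + 1 + p.1 + p.2 - 1) p.2 * ‖t‖ ^ p.2) := by
      have hn : ∀ j k : ℕ, 0 ≤ Ring.choose (‖α‖ + 1 + j + k - 1) k := fun j k =>
        (norm_nonneg _).trans (norm_poch_le α j k)
      rw [summable_prod_of_nonneg (fun p => mul_nonneg (by positivity)
        (mul_nonneg (hn _ _) (by positivity)))]
      refine ⟨fun j => (hr j).summable, ?_⟩
      have h0 : 0 < 1 - ‖t‖ := by linarith
      refine ((Real.summable_pow_div_factorial (‖-z * t‖ / (1 - ‖t‖))).mul_left
        (1 / (1 - ‖t‖) ^ (‖α‖ + 1))).congr fun j => ?_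
      simp only []
      rw [(hr j).tsum_eq, Real.rpow_add h0 (‖α‖ + 1) j, Real.rpow_natCast, div_pow]
      field_simp
    refine Summable.of_nonneg_of_le (fun _ => norm_nonneg _) (fun p => ?_) hsum
    simp only [hFdef, norm_mul _ (_ * _), norm_mul _ (t ^ _), norm_div _ (Nat.cast (Nat.factorial p.1) : ℂ), norm_pow,
      Complex.norm_natCast]
    gcongr
    exact norm_poch_le α p.1 p.2
  obtain ⟨h1, h2⟩ := tsum_sum_antidiagonal hF
  have hterm : ∀ n, ∑ p ∈ Finset.HasAntidiagonal.antidiagonal n, F p = laguerreL n α z * t ^ n := by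
    intro n
    rw [Finset.Nat.sum_antidiagonal_eq_sum_range_succ_mk, laguerreL_eq_sum_range, Finset.sum_mul]
    refine Finset.sum_congr rfl fun j hj => ?_
    have hj' : j ≤ n := Nat.lt_succ_iff.mp (Finset.mem_range.mp hj)
    obtain ⟨k, rfl⟩ := Nat.exists_eq_add_of_le hj'
    simp only [hFdef, Nat.add_sub_cancel_left, mul_pow, pow_add]
    ring
  simp only [hterm] at h1 h2
  rw [h1.hasSum_iff, h2]
  have hinner : ∀ j : ℕ, ∑' k, F (j, k) =
      1 / (1 - t) ^ (α + 1) * ((-z * t / (1 - t)) ^ j / j.factorial) := by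
    intro j
    have := (Complex.one_div_one_sub_cpow_hasFPowerSeriesOnBall_zero (α + 1 + j)).hasSum hball
    simp only [FormalMultilinearSeries.ofScalars_apply_eq, choose_add_sub_one, zero_add,
      smul_eq_mul] at this
    simp only [hFdef]
    rw [tsum_mul_left, this.tsum_eq, Complex.cpow_add _ _ h1t, Complex.cpow_natCast, div_pow]
    field_simp
  simp only [hinner]
  rw [tsum_mul_left, Complex.exp_eq_exp_ℂ, NormedSpace.exp_eq_tsum_div]

/-! ### Mean-square size of the Laguerre polynomials -/

lemma exists_rpow_le_mul_exp (A : ℝ) (hA : 0 ≤ A) :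
    ∃ K : ℝ, 0 < K ∧ ∀ x : ℝ, 0 ≤ x → x ^ A ≤ K * Real.exp x := by
  obtain ⟨m, hm⟩ := exists_nat_ge A
  refine ⟨m.factorial * Real.exp 1, by positivity, fun x hx => ?_⟩
  calc x ^ A ≤ (1 + x) ^ A := Real.rpow_le_rpow hx (by linarith) hA
    _ ≤ (1 + x) ^ (m : ℝ) := Real.rpow_le_rpow_of_exponent_le (by linarith) hm
    _ = (1 + x) ^ m := Real.rpow_natCast _ _
    _ ≤ m.factorial * Real.exp (1 + x) := by
      have := Real.pow_div_factorial_le_exp (1 + x) (by positivity) m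
      rwa [div_le_iff₀' (by positivity)] at this
    _ = _ := by rw [Real.exp_add]; ring

/-- The generating function of the Laguerre polynomials in the unit disc is controlled by
the distance to the line `Re t = 1`. -/
lemma exists_norm_genFun_sq_le (α : ℂ) (hα : 0 ≤ α.re + 1) {z : ℝ} (hz : 0 < z) :
    ∃ C : ℝ, 0 < C ∧ ∀ t : ℂ, ‖t‖ < 1 →
      ‖1 / (1 - t) ^ (α + 1) * Complex.exp (-z * t / (1 - t))‖ ^ 2 ≤
        C * (1 - t.re) ^ (-(α.re + 1)) := by
  obtain ⟨K, hK, hexp⟩ := exists_rpow_le_mul_exp (α.re + 1) hα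
  refine ⟨Real.exp (Real.pi * |α.im|) ^ 2 * Real.exp (2 * z) * K * (2 * z) ^ (-(α.re + 1)),
    by positivity, fun t ht => ?_⟩
  have hq : 0 < 1 - t.re := by linarith [(Complex.re_le_norm t).trans_lt ht]
  have h1t : (1 : ℂ) - t ≠ 0 := by
    intro h
    have := congrArg Complex.re h
    simp at this
    linarith
  have hD : 0 < ‖1 - t‖ := norm_pos_iff.mpr h1t
  set D := ‖1 - t‖ with hDdef
  set A := α.re + 1 with hA
  -- y = Re 1/(1-t) governs the decay of the exponential factor.
  set y := (1 - t.re) / D ^ 2 with hy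
  have hy0 : 0 < y := by positivity
  have e1 : ‖1 / (1 - t) ^ (α + 1)‖ ≤ D ^ (-A) * Real.exp (Real.pi * |α.im|) := by
    rw [norm_div, norm_one, Complex.norm_cpow_of_ne_zero h1t, one_div_div, Real.rpow_neg hD.le]
    simp only [Complex.add_re, Complex.one_re, Complex.add_im, Complex.one_im, add_zero]
    rw [div_eq_inv_mul]
    refine mul_le_mul_of_nonneg_left (Real.exp_le_exp.mpr ?_) (by positivity)
    calc (1 - t).arg * α.im ≤ |(1 - t).arg * α.im| := le_abs_self _
      _ = |(1 - t).arg| * |α.im| := abs_mul _ _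
      _ ≤ _ := by gcongr; exact Complex.abs_arg_le_pi _
  have e2 : ‖Complex.exp (-z * t / (1 - t))‖ = Real.exp (z - z * y) := by
    rw [Complex.norm_exp]
    congr 1
    have : -z * t / (1 - t) = z - z * (1 - t)⁻¹ := by field_simp; ring
    rw [this, Complex.sub_re, Complex.re_ofReal_mul, Complex.ofReal_re, Complex.inv_re, hy, hDdef,
      Complex.sq_norm]
    simp
  -- Exponential decay is spent as y^(-A): since y = (1 - Re t)/D², this exactly compensates D^(-2A)
  -- and leaves (1 - Re t)^(-A). Positivity of z is essential.
  have e3 : Real.exp (-(2 * z * y)) ≤ K * (2 * z * y) ^ (-A) := by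
    rw [Real.exp_neg, Real.rpow_neg (by positivity), inv_eq_one_div, div_le_iff₀ (by positivity)]
    have h := hexp (2 * z * y) (by positivity)
    have h2 : 0 < (2 * z * y) ^ A := by positivity
    calc 1 = (2 * z * y) ^ A * ((2 * z * y) ^ A)⁻¹ := (mul_inv_cancel₀ h2.ne').symm
      _ ≤ K * Real.exp (2 * z * y) * ((2 * z * y) ^ A)⁻¹ := by gcongr
      _ = _ := by ring
  have e4 : (D ^ (-A)) ^ 2 * y ^ (-A) = (1 - t.re) ^ (-A) := by
    rw [hy, Real.div_rpow hq.le (by positivity), ← Real.rpow_natCast, ← Real.rpow_natCast,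
      ← Real.rpow_mul hD.le, ← Real.rpow_mul hD.le]
    have : D ^ (((2 : ℕ) : ℝ) * -A) ≠ 0 := by positivity
    rw [mul_comm (-A)]
    field_simp
  rw [norm_mul, mul_pow, e2]
  calc _ ≤ (D ^ (-A) * Real.exp (Real.pi * |α.im|)) ^ 2 * Real.exp (z - z * y) ^ 2 := by gcongr
    _ = (D ^ (-A)) ^ 2 * Real.exp (Real.pi * |α.im|) ^ 2 * Real.exp (2 * z) *
          Real.exp (-(2 * z * y)) := by
        rw [mul_pow, ← Real.exp_nat_mul (z - z * y), mul_assoc _ (Real.exp (2 * z)), ← Real.exp_add]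
        congr 2; push_cast; ring
    _ ≤ (D ^ (-A)) ^ 2 * Real.exp (Real.pi * |α.im|) ^ 2 * Real.exp (2 * z) *
          (K * (2 * z * y) ^ (-A)) := by gcongr
    _ = _ := by
        rw [Real.mul_rpow (by positivity) hy0.le, ← e4]
        ring

/-- Bessel's inequality for power series on circles inside the disc of convergence. -/
lemma sum_sq_le_integral_of_hasSum {c : ℕ → ℂ} {r : ℝ} (hr : 0 < r) {G : ℂ → ℂ}
    (hs : Summable fun n => ‖c n‖ * r ^ n) (hG : ∀ t : ℂ, ‖t‖ = r → HasSum (fun n => c n * t ^ n) (G t))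
    (N : ℕ) : ∑ n ∈ Finset.range N, ‖c n‖ ^ 2 * r ^ (2 * n) ≤
      (2 * Real.pi)⁻¹ * ∫ θ in (-Real.pi)..Real.pi, ‖G (r * Complex.exp (θ * Complex.I))‖ ^ 2 := by
  set e : ℝ → ℂ := fun θ => Complex.exp (θ * Complex.I) with he
  have hnorm : ∀ θ : ℝ, ‖(r : ℂ) * e θ‖ = r := fun θ => by
    rw [norm_mul, he, Complex.norm_exp_ofReal_mul_I, mul_one, Complex.norm_real,
      Real.norm_of_nonneg hr.le]
  -- Parseval is an identity for the polynomial partial sums; dominated convergence on the circle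
  -- lets M → ∞, after which the terms beyond N are dropped.
  have hparseval : ∀ M : ℕ, ∑ n ∈ Finset.range M, ‖c n‖ ^ 2 * r ^ (2 * n) =
      (2 * Real.pi)⁻¹ * ∫ θ in (-Real.pi)..Real.pi,
        ‖∑ n ∈ Finset.range M, c n * (r * e θ) ^ n‖ ^ 2 := by
    intro M
    set p : Polynomial ℂ := ∑ n ∈ Finset.range M, Polynomial.monomial n (c n * r ^ n) with hp
    have hcoeff : ∀ n, p.coeff n = if n < M then c n * r ^ n else 0 := by
      intro n
      simp [hp, Polynomial.finsetSum_coeff, Polynomial.coeff_monomial]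
    have h1 := p.sum_sq_norm_coeff_eq_circleAverage
    have h2 : ∑ i ∈ p.support, ‖p.coeff i‖ ^ 2 = ∑ n ∈ Finset.range M, ‖c n‖ ^ 2 * r ^ (2 * n) := by
      rw [Finset.sum_subset (s₂ := Finset.range M)]
      · refine Finset.sum_congr rfl fun n hn => ?_
        rw [hcoeff, if_pos (Finset.mem_range.mp hn), norm_mul, norm_pow, Complex.norm_real,
          Real.norm_of_nonneg hr.le]
        ring
      · intro n hn
        rw [Polynomial.mem_support_iff, hcoeff] at hn
        by_contra h
        simp_all
      · intro n _ hn
        simpa using hn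
    rw [← h2, h1, Real.circleAverage, smul_eq_mul]
    congr 1
    have hper : Function.Periodic (fun θ : ℝ => ‖∑ n ∈ Finset.range M, c n * (r * e θ) ^ n‖ ^ 2)
        (2 * Real.pi) := by
      intro θ
      have : e (θ + 2 * Real.pi) = e θ := by
        rw [he]
        simp only []
        push_cast
        rw [add_mul, Complex.exp_add, Complex.exp_two_pi_mul_I, mul_one]
      simp only [this]
    have h3 := hper.intervalIntegral_add_eq (-Real.pi) 0
    rw [show -Real.pi + 2 * Real.pi = Real.pi by ring, zero_add] at h3
    rw [h3]
    refine intervalIntegral.integral_congr fun θ _ => ?_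
    simp only [hp, Polynomial.eval_finsetSum, Polynomial.eval_monomial, circleMap, he, zero_add,
      Complex.ofReal_one, one_mul]
    congr 2
    refine Finset.sum_congr rfl fun n _ => ?_
    ring
  have hlim : Tendsto (fun M : ℕ => ∑ n ∈ Finset.range M, ‖c n‖ ^ 2 * r ^ (2 * n)) atTop
      (𝓝 ((2 * Real.pi)⁻¹ * ∫ θ in (-Real.pi)..Real.pi, ‖G (r * e θ)‖ ^ 2)) := by
    simp only [hparseval]
    refine Tendsto.const_mul _ ?_
    refine intervalIntegral.tendsto_integral_filter_of_dominated_convergence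
      (fun _ => (∑' n, ‖c n‖ * r ^ n) ^ 2) ?_ ?_ (by simp) ?_
    · refine Eventually.of_forall fun M => Continuous.aestronglyMeasurable ?_
      simp only [he]
      fun_prop
    · refine Eventually.of_forall fun M => Eventually.of_forall fun θ _ => ?_
      rw [norm_pow, norm_norm]
      gcongr
      refine (norm_sum_le _ _).trans ?_
      refine le_trans (Finset.sum_le_sum fun n _ => ?_)
        (hs.sum_le_tsum (Finset.range M) fun n _ => by positivity)
      rw [norm_mul, norm_pow, hnorm]
    · exact Eventually.of_forall fun θ _ =>
        ((hG (r * e θ) (hnorm θ)).tendsto_sum_nat.norm.pow 2)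
  refine ge_of_tendsto hlim ?_
  filter_upwards [eventually_ge_atTop N] with M hM
  exact Finset.sum_le_sum_of_subset_of_nonneg (Finset.range_mono hM) fun n _ _ => by positivity

lemma intervalIntegrable_abs_rpow {s : ℝ} (hs : -1 < s) (a b : ℝ) :
    IntervalIntegrable (fun θ : ℝ => |θ| ^ s) MeasureTheory.volume a b := by
  suffices h : ∀ c : ℝ, IntervalIntegrable (fun θ : ℝ => |θ| ^ s) MeasureTheory.volume 0 c from
    (h a).symm.trans (h b)
  have hpos : ∀ c : ℝ, 0 ≤ c → IntervalIntegrable (fun θ : ℝ => |θ| ^ s) MeasureTheory.volume 0 c := by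
    intro c hc
    refine (intervalIntegral.intervalIntegrable_rpow' hs).congr fun θ hθ => ?_
    rw [Set.uIoc_of_le hc] at hθ
    simp only [abs_of_pos hθ.1]
  intro c
  rcases le_total 0 c with h | h
  · exact hpos c h
  · rw [IntervalIntegrable.iff_comp_neg]
    simpa using hpos (-c) (by linarith)

/-- Two lower bounds for 1 - r cos θ are interpolated: 1 - r, used to the power x, and θ²/π² (valid
for r ≥ 1/2), used to the power A - x. The remaining |θ|^(-2(A-x)) is integrable because A - x <
1/2. -/
lemma exists_integral_le (A x : ℝ) (hx0 : 0 ≤ x) (hxA : x < A) (hx : A - 1 / 2 < x) :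
    ∃ C : ℝ, 0 ≤ C ∧ ∀ r : ℝ, 1 / 2 ≤ r → r < 1 →
      ∫ θ in (-Real.pi)..Real.pi, (1 - r * Real.cos θ) ^ (-A) ≤ C * (1 - r) ^ (-x) := by
  have hpi := Real.pi_pos
  refine ⟨∫ θ in (-Real.pi)..Real.pi, (Real.pi ^ 2) ^ (A - x) * |θ| ^ (-(2 * (A - x))),
    intervalIntegral.integral_nonneg (by linarith) fun θ _ => by positivity, fun r hr hr1 => ?_⟩
  have hδ : 0 < 1 - r := by linarith
  have hq : ∀ θ : ℝ, 1 - r ≤ 1 - r * Real.cos θ := fun θ => by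
    nlinarith [Real.cos_le_one θ]
  rw [← intervalIntegral.integral_mul_const]
  have hint := (intervalIntegrable_abs_rpow (s := -(2 * (A - x))) (by linarith) (-Real.pi)
    Real.pi).const_mul ((Real.pi ^ 2) ^ (A - x))
  refine intervalIntegral.integral_mono_ae_restrict (by linarith) ?_ (hint.mul_const _) ?_
  · refine Continuous.intervalIntegrable ?_ _ _
    refine Continuous.rpow_const (by fun_prop) fun θ => Or.inl (hδ.trans_le (hq θ)).ne'
  · have h0 : ∀ᵐ θ : ℝ ∂(MeasureTheory.volume.restrict (Set.Icc (-Real.pi) Real.pi)), θ ≠ 0 :=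
      MeasureTheory.ae_restrict_of_ae (MeasureTheory.Measure.ae_ne _ _)
    filter_upwards [h0, MeasureTheory.ae_restrict_mem measurableSet_Icc] with θ hθ hmem
    have habs : |θ| ≤ Real.pi := abs_le.mpr hmem
    have h1 : |θ| ^ 2 / Real.pi ^ 2 ≤ 1 - r * Real.cos θ := by
      have := Real.cos_le_one_sub_mul_cos_sq habs
      rw [sq_abs]
      have e : 2 / Real.pi ^ 2 * θ ^ 2 = 2 * (θ ^ 2 / Real.pi ^ 2) := by ring
      rw [e] at this
      have hp : 0 ≤ θ ^ 2 / Real.pi ^ 2 := by positivity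
      nlinarith
    have habs0 : 0 < |θ| := abs_pos.mpr hθ
    have e : -A = -x + -(A - x) := by ring
    have hq0 := hδ.trans_le (hq θ)
    rw [e, Real.rpow_add hq0]
    have k1 : (1 - r * Real.cos θ) ^ (-x) ≤ (1 - r) ^ (-x) :=
      Real.rpow_le_rpow_of_nonpos hδ (hq θ) (by linarith)
    have k2 : (1 - r * Real.cos θ) ^ (-(A - x)) ≤ (|θ| ^ 2 / Real.pi ^ 2) ^ (-(A - x)) :=
      Real.rpow_le_rpow_of_nonpos (by positivity) h1 (by linarith)
    have k3 : (|θ| ^ 2 / Real.pi ^ 2) ^ (-(A - x)) =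
        (Real.pi ^ 2) ^ (A - x) * |θ| ^ (-(2 * (A - x))) := by
      rw [Real.div_rpow (by positivity) (by positivity), Real.rpow_neg (x := Real.pi ^ 2) (by positivity),
        div_inv_eq_mul, mul_comm, ← Real.rpow_natCast |θ| 2, ← Real.rpow_mul habs0.le]
      congr 2
      push_cast
      ring
    rw [← k3, mul_comm]
    exact mul_le_mul k2 k1 (by positivity) (by positivity)

/-- Parseval combined with the bound on the generating function. The exponent x just above Re α +
1/2 reflects a mean size n^(Re α - 1/2) of |L_n|². -/
lemma exists_sum_sq_laguerreL_le {α : ℂ} (hα : 0 ≤ α.re) {z : ℝ} (hz : 0 < z) {x : ℝ}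
    (hx : α.re + 1 / 2 < x) (hxA : x < α.re + 1) :
    ∃ C : ℝ, 0 ≤ C ∧ ∀ r : ℝ, 1 / 2 ≤ r → r < 1 → ∀ N : ℕ,
      ∑ n ∈ Finset.range N, ‖laguerreL n α z‖ ^ 2 * r ^ (2 * n) ≤ C * (1 - r) ^ (-x) := by
  obtain ⟨C₁, h₁, hC₁⟩ := exists_norm_genFun_sq_le α (by linarith) hz
  obtain ⟨C₂, h₂, hC₂⟩ := exists_integral_le (α.re + 1) x (by linarith) hxA (by linarith)
  have hpi := Real.pi_pos
  refine ⟨(2 * Real.pi)⁻¹ * (C₁ * C₂), by positivity, fun r hr hr1 N => ?_⟩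
  have hr0 : 0 < r := by linarith
  have hs : Summable fun n => ‖laguerreL n α z‖ * r ^ n := by
    have h := (hasSum_laguerreL α z (t := (r : ℂ)) (by
      rw [Complex.norm_real, Real.norm_of_nonneg hr0.le]; exact hr1)).summable.norm
    refine h.congr fun n => ?_
    rw [norm_mul, norm_pow, Complex.norm_real, Real.norm_of_nonneg hr0.le]
  refine (sum_sq_le_integral_of_hasSum hr0 hs (fun t ht => hasSum_laguerreL α z (ht.trans_lt hr1))
    N).trans ?_
  rw [mul_assoc, mul_assoc]
  gcongr
  refine le_trans ?_ (mul_le_mul_of_nonneg_left (hC₂ r hr hr1) h₁.le)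
  rw [← intervalIntegral.integral_const_mul]
  have hn : ∀ θ : ℝ, ‖(r : ℂ) * Complex.exp (θ * Complex.I)‖ = r := fun θ => by
    rw [norm_mul, Complex.norm_exp_ofReal_mul_I, mul_one, Complex.norm_real,
      Real.norm_of_nonneg hr0.le]
  have hre : ∀ θ : ℝ, ((r : ℂ) * Complex.exp (θ * Complex.I)).re = r * Real.cos θ := fun θ => by
    rw [Complex.re_ofReal_mul, Complex.exp_ofReal_mul_I_re]
  have hpos : ∀ θ : ℝ, 0 < 1 - r * Real.cos θ := fun θ => by nlinarith [Real.cos_le_one θ]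
  have hslit : ∀ θ : ℝ, 1 - (r : ℂ) * Complex.exp (θ * Complex.I) ∈ Complex.slitPlane := fun θ => by
    left
    rw [Complex.sub_re, hre]
    exact hpos θ
  refine intervalIntegral.integral_mono_on (by linarith) (Continuous.intervalIntegrable ?_ _ _)
    (Continuous.intervalIntegrable ?_ _ _) fun θ _ => ?_
  · have hne : ∀ θ : ℝ, 1 - (r : ℂ) * Complex.exp (θ * Complex.I) ≠ 0 := fun θ =>
      Complex.slitPlane_ne_zero (hslit θ)
    have hc : Continuous fun θ : ℝ => 1 - (r : ℂ) * Complex.exp (θ * Complex.I) := by fun_prop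
    have hne' : ∀ θ : ℝ, (1 - (r : ℂ) * Complex.exp (θ * Complex.I)) ^ (α + 1) ≠ 0 := fun θ => by
      simp [Complex.cpow_eq_zero_iff, hne θ]
    refine ((Continuous.mul (continuous_const.div
      (hc.cpow continuous_const hslit) hne') ?_).norm).pow 2
    refine Complex.continuous_exp.comp (Continuous.div (by fun_prop) hc hne)
  · exact continuous_const.mul (Continuous.rpow_const (by fun_prop) fun θ => Or.inl (hpos θ).ne')
  · have := hC₁ _ ((hn θ).trans_lt hr1)
    rwa [hre] at this

/-- Bernoulli gives at least 1/2 for the exponent 2^m, and 2n is at most 4 · 2^m. -/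
lemma one_sixteenth_le_one_sub_pow (m n : ℕ) (hn : n + 1 < 2 ^ (m + 1)) :
    (1 / 16 : ℝ) ≤ (1 - ((2 : ℝ) ^ (m + 1))⁻¹) ^ (2 * n) := by
  have hM : (0 : ℝ) < 2 ^ (m + 1) := by positivity
  have hM1 : ((2 : ℝ) ^ (m + 1))⁻¹ ≤ 1 := inv_le_one_of_one_le₀ (one_le_pow₀ (by norm_num))
  have h1 : (1 / 2 : ℝ) ≤ (1 - ((2 : ℝ) ^ (m + 1))⁻¹) ^ (2 ^ m) := by
    have := one_add_mul_le_pow (a := -((2 : ℝ) ^ (m + 1))⁻¹) (by linarith) (2 ^ m)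
    rw [← sub_eq_add_neg (1 : ℝ) (((2 : ℝ) ^ (m + 1))⁻¹)] at this
    refine le_trans (le_of_eq ?_) this
    rw [pow_succ]
    push_cast
    field_simp
    norm_num
  calc (1 / 16 : ℝ) = (1 / 2) ^ 4 := by norm_num
    _ ≤ ((1 - ((2 : ℝ) ^ (m + 1))⁻¹) ^ (2 ^ m)) ^ 4 := by gcongr
    _ = (1 - ((2 : ℝ) ^ (m + 1))⁻¹) ^ (2 ^ m * 4) := by rw [← pow_mul]
    _ ≤ _ := pow_le_pow_of_le_one (by linarith) (by simp) (by rw [pow_succ] at hn; omega)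

/-- An Abel-type bound on a power series with nonnegative coefficients
controls the weighted sums of the coefficients. -/
lemma summable_mul_rpow_of_abel_bound {d : ℕ → ℝ} (hd : ∀ n, 0 ≤ d n) {C x p : ℝ} (hC : 0 ≤ C)
    (hx : 0 ≤ x) (hxp : x < p)
    (h : ∀ r : ℝ, 1 / 2 ≤ r → r < 1 → ∀ N : ℕ,
      ∑ n ∈ Finset.range N, d n * r ^ (2 * n) ≤ C * (1 - r) ^ (-x)) :
    Summable fun n : ℕ => d n * ((n : ℝ) + 1) ^ (-p) := by
  -- Dyadic radii 1 - 1/w_m: an index n with 2^m ≤ n + 1 < 2^(m+1) is charged to w_m, where r^(2n) ≥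
  -- 1/16 and (n+1)^(-p) is comparable to w_m^(-p). Block m then costs O(w_m^(x-p)), a geometric
  -- series.
  set w : ℕ → ℝ := fun m => (2 : ℝ) ^ (m + 1) with hw
  have hw0 : ∀ m, 0 < w m := fun m => by positivity
  have hw2 : ∀ m, 2 ≤ w m := fun m => by
    rw [hw]
    calc (2 : ℝ) = 2 ^ 1 := by norm_num
      _ ≤ 2 ^ (m + 1) := pow_le_pow_right₀ (by norm_num) (by omega)
  have hr : ∀ m, 1 / 2 ≤ 1 - (w m)⁻¹ := fun m => by
    have : (w m)⁻¹ ≤ 2⁻¹ := inv_anti₀ (by norm_num) (hw2 m)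
    linarith
  have hgeo : Summable fun m : ℕ => (w m) ^ (x - p) := by
    have : (2 : ℝ) ^ (x - p) < 1 := Real.rpow_lt_one_of_one_lt_of_neg (by norm_num) (by linarith)
    have h2 := (summable_nat_add_iff 1).mpr (summable_geometric_of_lt_one (by positivity) this)
    refine h2.congr fun m => ?_
    rw [hw]
    simp only []
    rw [← Real.rpow_natCast, ← Real.rpow_natCast, ← Real.rpow_mul (by norm_num),
      ← Real.rpow_mul (by norm_num), mul_comm]
  refine summable_of_sum_range_le (c := 16 * 2 ^ p * (C * ∑' m, (w m) ^ (x - p)))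
    (fun n => mul_nonneg (hd n) (by positivity)) fun N => ?_
  have hstep : ∀ n ∈ Finset.range N, d n * ((n : ℝ) + 1) ^ (-p) ≤
      16 * 2 ^ p * ∑ m ∈ Finset.range N, (w m) ^ (-p) * (d n * (1 - (w m)⁻¹) ^ (2 * n)) := by
    intro n hn
    have hm : Nat.log 2 (n + 1) ∈ Finset.range N := by
      have := Nat.log_lt_self 2 (x := n + 1) (by omega)
      rw [Finset.mem_range] at hn ⊢
      omega
    set m := Nat.log 2 (n + 1) with hmdef
    have l1 : n + 1 < 2 ^ (m + 1) := Nat.lt_pow_succ_log_self (by norm_num) _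
    have l2 : 2 ^ m ≤ n + 1 := Nat.pow_log_le_self 2 (by omega)
    have l3 := one_sixteenth_le_one_sub_pow m n l1
    have l4 : (2 : ℝ) ^ (-p) * ((n : ℝ) + 1) ^ (-p) ≤ (w m) ^ (-p) := by
      rw [← Real.mul_rpow (by norm_num) (by positivity)]
      refine Real.rpow_le_rpow_of_nonpos (hw0 m) ?_ (by linarith)
      have : ((2 ^ m : ℕ) : ℝ) ≤ ((n + 1 : ℕ) : ℝ) := by exact_mod_cast l2
      rw [hw]
      push_cast at this
      simp only [pow_succ]
      linarith
    have l5 : 0 < (2 : ℝ) ^ p := by positivity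
    calc d n * ((n : ℝ) + 1) ^ (-p)
        = 16 * 2 ^ p * ((2 : ℝ) ^ (-p) * ((n : ℝ) + 1) ^ (-p) * (d n * (1 / 16))) := by
          rw [Real.rpow_neg (by norm_num : (0 : ℝ) ≤ 2)]
          field_simp
      _ ≤ 16 * 2 ^ p * ((w m) ^ (-p) * (d n * (1 - (w m)⁻¹) ^ (2 * n))) := by
          have := hd n
          gcongr
      _ ≤ _ := by
          gcongr
          refine Finset.single_le_sum (f := fun m => (w m) ^ (-p) * (d n * (1 - (w m)⁻¹) ^ (2 * n)))
            (fun i _ => ?_) hm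
          have := hd n
          have := hr i
          have := hw0 i
          have : 0 ≤ 1 - (w i)⁻¹ := by linarith
          positivity
  refine (Finset.sum_le_sum hstep).trans ?_
  rw [← Finset.mul_sum, Finset.sum_comm]
  refine mul_le_mul_of_nonneg_left ?_ (by positivity)
  rw [← tsum_mul_left]
  refine le_trans (Finset.sum_le_sum fun m _ => ?_) ((hgeo.mul_left C).sum_le_tsum (Finset.range N)
    fun m _ => by have := hw0 m; positivity)
  rw [← Finset.mul_sum]
  have hi : 0 < (w m)⁻¹ := inv_pos.mpr (hw0 m)
  have := h (1 - (w m)⁻¹) (hr m) (by linarith) N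
  rw [sub_sub_cancel, Real.inv_rpow (hw0 m).le, Real.rpow_neg (hw0 m).le, inv_inv] at this
  calc _ ≤ (w m) ^ (-p) * (C * (w m) ^ x) :=
        mul_le_mul_of_nonneg_left this (Real.rpow_nonneg (hw0 m).le _)
    _ = _ := by rw [sub_eq_add_neg, Real.rpow_add (hw0 m)]; ring

lemma summable_norm_laguerreL_of_re_nonneg {α : ℂ} (hα : 0 ≤ α.re) {z : ℝ} (hz : 0 < z) {σ : ℝ}
    (hσ : α.re / 2 + 3 / 4 < σ) :
    Summable fun n : ℕ => ‖laguerreL n α z‖ * ((n : ℝ) + 1) ^ (-σ) := by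
  -- The Cauchy–Schwarz split. This p makes both requirements, p > Re α + 1/2 for the mean squares
  -- and 2σ - p > 1 for the powers, equivalent to the hypothesis on σ.
  set p := α.re / 2 + σ - 1 / 4 with hp
  obtain ⟨x, hx1, hx2⟩ := exists_between (show α.re + 1 / 2 < min p (α.re + 1) by
    rw [lt_min_iff]; constructor <;> linarith)
  rw [lt_min_iff] at hx2
  obtain ⟨C, hC, hb⟩ := exists_sum_sq_laguerreL_le hα hz hx1 hx2.2
  have h1 := summable_mul_rpow_of_abel_bound (d := fun n => ‖laguerreL n α z‖ ^ 2)
    (fun n => by positivity) hC (by linarith) hx2.1 hb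
  have h2 := summable_nat_add_one_rpow (p := -2 * σ + p) (by linarith)
  refine Summable.of_nonneg_of_le (fun n => by positivity) (fun n => ?_) (h1.add h2)
  have hn : (0 : ℝ) < (n : ℝ) + 1 := by positivity
  have e1 : ((n : ℝ) + 1) ^ (-p) = (((n : ℝ) + 1) ^ (-p / 2)) ^ 2 := by
    rw [← Real.rpow_natCast, ← Real.rpow_mul hn.le]; congr 1; push_cast; ring
  have e2 : ((n : ℝ) + 1) ^ (-2 * σ + p) = (((n : ℝ) + 1) ^ (-σ + p / 2)) ^ 2 := by
    rw [← Real.rpow_natCast, ← Real.rpow_mul hn.le]; congr 1; push_cast; ring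
  have e3 : ((n : ℝ) + 1) ^ (-σ) = ((n : ℝ) + 1) ^ (-p / 2) * ((n : ℝ) + 1) ^ (-σ + p / 2) := by
    rw [← Real.rpow_add hn]; congr 1; ring
  rw [e1, e2, e3]
  set u := ‖laguerreL n α z‖ * ((n : ℝ) + 1) ^ (-p / 2)
  set v := ((n : ℝ) + 1) ^ (-σ + p / 2)
  nlinarith [sq_nonneg (u - v), sq_nonneg u, sq_nonneg v]

/-- Convergence of the weighted series of Laguerre polynomials
in the range given by Fejér's asymptotics. -/
lemma summable_norm_laguerreL (α : ℂ) {z : ℝ} (hz : 0 < z) {σ : ℝ}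
    (hσ : α.re / 2 + 3 / 4 < σ) :
    Summable fun n : ℕ => ‖laguerreL n α z‖ * ((n : ℝ) + 1) ^ (-σ) := by
  obtain ⟨k, hk⟩ := exists_nat_ge (-α.re)
  -- Descent in Re α: L_(n+1)^(α) is a combination of the polynomials with parameters α + 1 and α +
  -- 2, divided by n + 1. Raising α by 2 and σ by 1 leaves the threshold exactly unchanged.
  induction k generalizing α σ with
  | zero => exact summable_norm_laguerreL_of_re_nonneg (by simpa using hk) hz hσ
  | succ k ih =>
    push_cast at hk
    have h1 := ih (α + 1) (σ := σ + 1) (by simp; linarith) (by simp; linarith)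
    have h2 := ih (α + 2) (σ := σ + 1) (by simp; linarith) (by simp; linarith)
    rw [← summable_nat_add_iff 1]
    refine Summable.of_nonneg_of_le (fun n => by positivity) (fun n => ?_)
      (((h1.mul_left ‖α + 1‖).add (h2.mul_left z)).mul_left (2 ^ |-σ|))
    have hn : (0 : ℝ) < (n : ℝ) + 1 := by positivity
    have e : ‖laguerreL (n + 1) α z‖ ≤ (‖α + 1‖ * ‖laguerreL n (α + 1) z‖ +
        z * ‖laguerreL n (α + 2) z‖) / ((n : ℝ) + 1) := by
      rw [le_div_iff₀' hn]
      have := congrArg norm (succ_mul_laguerreL n α z)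
      rw [norm_mul, show ((n : ℂ) + 1) = ((n + 1 : ℕ) : ℂ) by push_cast; rfl,
        Complex.norm_natCast] at this
      push_cast at this
      rw [this]
      refine (norm_sub_le _ _).trans (le_of_eq ?_)
      rw [norm_mul, norm_mul, Complex.norm_real, Real.norm_of_nonneg hz.le]
    have e2 : ((n : ℝ) + 1) ^ (-(σ + 1)) = ((n : ℝ) + 1) ^ (-σ) / ((n : ℝ) + 1) := by
      rw [neg_add, ← sub_eq_add_neg, Real.rpow_sub_one hn.ne']
    calc _ ≤ (‖α + 1‖ * ‖laguerreL n (α + 1) z‖ +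
        z * ‖laguerreL n (α + 2) z‖) / ((n : ℝ) + 1) *
          (2 ^ |-σ| * ((n : ℝ) + 1) ^ (-σ)) := by
          gcongr
          exact succ_rpow_le _ n
      _ = _ := by rw [e2]; ring

/-! ### Termwise integration of the generating function -/

/-- The function `u ^ s (1 + u) ^ q e ^ (-z u)`. -/
noncomputable def tricomiKernel (s q : ℂ) (z u : ℝ) : ℂ :=
  (u : ℂ) ^ s * (1 + u : ℂ) ^ q * Complex.exp (-z * u)

/-- The integral `∫₀^∞ u ^ (a - 1) (1 + u) ^ (b - a - 1) e ^ (-z u) du`,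
which represents `Γ(a) U(a; b; z)`. -/
noncomputable def tricomiIntegral (a b : ℂ) (z : ℝ) : ℂ :=
  ∫ u in Set.Ioi (0 : ℝ), tricomiKernel (a - 1) (b - a - 1) z u

lemma image_div_one_add : (fun u : ℝ => u / (1 + u)) '' Set.Ioi 0 = Set.Ioo 0 1 := by
  ext t
  constructor
  · rintro ⟨u, hu, rfl⟩
    have hu' : (0 : ℝ) < u := hu
    exact ⟨by positivity, by rw [div_lt_one (by positivity)]; linarith⟩
  · rintro ⟨h0, h1⟩
    refine ⟨t / (1 - t), div_pos h0 (by linarith), ?_⟩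
    have : 1 - t ≠ 0 := by linarith
    simp only []
    field_simp
    ring

lemma hasDerivWithinAt_div_one_add (u : ℝ) (hu : u ∈ Set.Ioi (0 : ℝ)) :
    HasDerivWithinAt (fun u : ℝ => u / (1 + u)) (1 / (1 + u) ^ 2) (Set.Ioi 0) u := by
  have hu' : (0 : ℝ) < u := hu
  have := (hasDerivAt_id u).div ((hasDerivAt_id u).const_add 1) (by simp; positivity)
  refine HasDerivAt.hasDerivWithinAt (this.congr_deriv ?_)
  simp

lemma injOn_div_one_add : Set.InjOn (fun u : ℝ => u / (1 + u)) (Set.Ioi 0) := by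
  intro u hu v hv h
  have hu' : (0 : ℝ) < u := hu
  have hv' : (0 : ℝ) < v := hv
  simp only [] at h
  rw [div_eq_div_iff (by positivity) (by positivity)] at h
  linarith

/-- Under t = u/(1+u) one has 1 - t = 1/(1+u) and t/(1-t) = u; with the Jacobian (1+u)^(-2) the
powers of 1 + u add up to b - a - 1. -/
lemma abs_smul_eq_tricomiKernel (a b : ℂ) (z : ℝ) {u : ℝ} (hu : u ∈ Set.Ioi (0 : ℝ)) :
    |1 / (1 + u) ^ 2| • (((u / (1 + u) : ℝ) : ℂ) ^ (a - 1) * (1 - (u / (1 + u) : ℝ) : ℂ) ^ (-b) *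
      Complex.exp (-z * (u / (1 + u) : ℝ) / (1 - (u / (1 + u) : ℝ)))) =
    tricomiKernel (a - 1) (b - a - 1) z u := by
  have hu' : (0 : ℝ) < u := hu
  have h1 : (0 : ℝ) < 1 + u := by positivity
  have h1c : (1 + u : ℂ) ≠ 0 := by exact_mod_cast h1.ne'
  have e1 : (1 : ℂ) - ((u / (1 + u) : ℝ) : ℂ) = (((1 + u)⁻¹ : ℝ) : ℂ) := by
    push_cast; field_simp; ring
  have e2 : (((u / (1 + u) : ℝ) : ℂ)) = (u : ℂ) * (((1 + u)⁻¹ : ℝ) : ℂ) := by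
    push_cast; rw [div_eq_mul_inv]
  have e3 : ∀ s : ℂ, (((1 + u)⁻¹ : ℝ) : ℂ) ^ s = (1 + u : ℂ) ^ (-s) := by
    intro s
    rw [Complex.ofReal_inv, Complex.inv_cpow _ _ (by
      rw [Complex.arg_ofReal_of_nonneg h1.le]; exact Real.pi_pos.ne), Complex.cpow_neg]
    push_cast
    rfl
  rw [e1, e2, Complex.mul_cpow_ofReal_nonneg hu'.le (by positivity), e3, e3, Complex.real_smul]
  have e4 : -(z : ℂ) * ((u : ℂ) * (((1 + u)⁻¹ : ℝ) : ℂ)) / (((1 + u)⁻¹ : ℝ) : ℂ) = -z * u := by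
    push_cast; field_simp
  have e5 : (1 + u : ℂ) ^ (b - a - 1) =
      (1 + u : ℂ) ^ (-(a - 1)) * (1 + u : ℂ) ^ (- -b) / (1 + u) ^ 2 := by
    rw [← Complex.cpow_add _ _ h1c, ← Complex.cpow_natCast, ← Complex.cpow_sub _ _ h1c]
    congr 1; push_cast; ring
  rw [tricomiKernel, e4, e5, abs_of_pos (by positivity)]
  push_cast
  ring

lemma setIntegral_Ioo_eq_tricomiIntegral (a b : ℂ) (z : ℝ) :
    ∫ t in Set.Ioo (0 : ℝ) 1, (t : ℂ) ^ (a - 1) * (1 - t : ℂ) ^ (-b) *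
      Complex.exp (-z * t / (1 - t)) = tricomiIntegral a b z := by
  rw [← image_div_one_add, MeasureTheory.integral_image_eq_integral_abs_deriv_smul measurableSet_Ioi
    hasDerivWithinAt_div_one_add injOn_div_one_add, tricomiIntegral]
  exact MeasureTheory.setIntegral_congr_fun measurableSet_Ioi fun u hu =>
    abs_smul_eq_tricomiKernel a b z hu

lemma summable_laguerreL_mul_poch (α a : ℂ) {c : ℂ} {z : ℝ} (hz : 0 < z)
    (hc : α.re / 2 + 3 / 4 < c.re) (hca : ∀ n : ℕ, c + a ≠ -(n : ℂ)) :
    Summable fun i : ℕ => laguerreL i α z * (poch a i / poch (c + a) i) := by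
  obtain ⟨K, hK, hb⟩ := exists_norm_poch_div_poch_le a hca
  refine Summable.of_norm_bounded ((summable_norm_laguerreL α hz hc).mul_left K) fun i => ?_
  have e : (a - (c + a)).re = -c.re := by simp
  have := hb i
  rw [e] at this
  rw [norm_mul]
  calc _ ≤ ‖laguerreL i α z‖ * (K * ((i : ℝ) + 1) ^ (-c.re)) := by gcongr
    _ = _ := by ring

lemma ne_neg_natCast_of_re_pos {a : ℂ} (ha : 0 < a.re) (n : ℕ) : a ≠ -(n : ℂ) := by
  rintro rfl
  have : (0 : ℝ) ≤ n := n.cast_nonneg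
  simp at ha
  linarith

lemma betaIntegral_add_natCast {a c : ℂ} (ha : 0 < a.re) (hc : 0 < c.re) (i : ℕ) :
    Complex.betaIntegral (a + i) c = Complex.Gamma a * Complex.Gamma c / Complex.Gamma (c + a) *
      (poch a i / poch (c + a) i) := by
  have h0 : (0 : ℝ) ≤ i := i.cast_nonneg
  have hca : 0 < (c + a).re := by simp; linarith
  rw [Complex.betaIntegral_eq_Gamma_mul_div _ _ (by simp; linarith) hc,
    Gamma_add_natCast (ne_neg_natCast_of_re_pos ha), show a + i + c = c + a + i by ring,
    Gamma_add_natCast (ne_neg_natCast_of_re_pos hca)]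
  ring

lemma setIntegral_Ioo_eq_betaIntegral (u v : ℂ) :
    ∫ t in Set.Ioo (0 : ℝ) 1, (t : ℂ) ^ (u - 1) * (1 - t : ℂ) ^ (v - 1) =
      Complex.betaIntegral u v := by
  rw [Complex.betaIntegral, intervalIntegral.integral_of_le zero_le_one,
    MeasureTheory.integral_Ioc_eq_integral_Ioo]

lemma integrableOn_Ioo_beta {u v : ℂ} (hu : 0 < u.re) (hv : 0 < v.re) :
    MeasureTheory.IntegrableOn (fun t : ℝ => (t : ℂ) ^ (u - 1) * (1 - t : ℂ) ^ (v - 1))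
      (Set.Ioo 0 1) := by
  have := Complex.betaIntegral_convergent hu hv
  rw [intervalIntegrable_iff_integrableOn_Ioo_of_le zero_le_one] at this
  exact this

/-- Taking norms replaces the parameters by their real parts, so absolute summability of the
integrated series is again a statement about beta values, now with real parameters. -/
lemma setIntegral_Ioo_norm_beta {u v : ℂ} :
    ∫ t in Set.Ioo (0 : ℝ) 1, ‖(t : ℂ) ^ (u - 1) * (1 - t : ℂ) ^ (v - 1)‖ =
      ‖Complex.betaIntegral u.re v.re‖ := by
  have e : ∀ t ∈ Set.Ioo (0 : ℝ) 1, (t : ℂ) ^ ((u.re : ℂ) - 1) * (1 - t : ℂ) ^ ((v.re : ℂ) - 1) =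
      ((‖(t : ℂ) ^ (u - 1) * (1 - t : ℂ) ^ (v - 1)‖ : ℝ) : ℂ) := by
    intro t ht
    have h1 : 0 < 1 - t := by linarith [ht.2]
    have e1 : (1 : ℂ) - t = ((1 - t : ℝ) : ℂ) := by push_cast; rfl
    rw [norm_mul, e1, Complex.norm_cpow_eq_rpow_re_of_pos ht.1,
      Complex.norm_cpow_eq_rpow_re_of_pos h1]
    rw [Complex.ofReal_mul, Complex.ofReal_cpow ht.1.le, Complex.ofReal_cpow h1.le]
    simp
  rw [← setIntegral_Ioo_eq_betaIntegral, MeasureTheory.setIntegral_congr_fun measurableSet_Ioo e,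
    integral_complex_ofReal, Complex.norm_real, Real.norm_of_nonneg]
  exact MeasureTheory.integral_nonneg fun _ => norm_nonneg _

/-- The Laguerre series of `U` in terms of its integral representation. -/
lemma hasSum_laguerreL_mul_poch {a b α : ℂ} {z : ℝ} (hz : 0 < z) (ha : 0 < a.re)
    (hc0 : 0 < (2 + α - b).re) (hc : α.re / 2 + 3 / 4 < (2 + α - b).re) :
    HasSum (fun i : ℕ => laguerreL i α z * (poch a i / poch (2 + α - b + a) i))
      (Complex.Gamma (2 + α - b + a) / (Complex.Gamma a * Complex.Gamma (2 + α - b)) *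
        tricomiIntegral a b z) := by
  set c := 2 + α - b with hcdef
  have hca : 0 < (c + a).re := by rw [Complex.add_re]; linarith
  set F : ℕ → ℝ → ℂ := fun i t => laguerreL i α z *
    ((t : ℂ) ^ (a + i - 1) * (1 - t : ℂ) ^ (c - 1)) with hF
  have hai : ∀ i : ℕ, 0 < (a + i).re := fun i => by
    have : (0 : ℝ) ≤ i := i.cast_nonneg
    rw [Complex.add_re, Complex.natCast_re]; linarith
  have hint : ∀ i, MeasureTheory.IntegrableOn (F i) (Set.Ioo 0 1) := fun i =>
    (integrableOn_Ioo_beta (hai i) hc0).const_mul _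
  have hnorm : Summable fun i => ∫ t in Set.Ioo (0 : ℝ) 1, ‖F i t‖ := by
    have h1 := (summable_laguerreL_mul_poch α (a.re : ℂ) (c := (c.re : ℂ)) hz (by simpa using hc)
      (ne_neg_natCast_of_re_pos (by simpa using hca))).norm
    refine (h1.mul_left ‖Complex.Gamma (a.re : ℂ) * Complex.Gamma (c.re : ℂ) /
      Complex.Gamma ((c.re : ℂ) + (a.re : ℂ))‖).congr fun i => ?_
    simp only [hF, norm_mul (laguerreL _ _ _)]
    rw [MeasureTheory.integral_const_mul, setIntegral_Ioo_norm_beta]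
    have := betaIntegral_add_natCast (a := (a.re : ℂ)) (c := (c.re : ℂ)) (by simpa using ha)
      (by simpa using hc0) i
    have e : (((a + i).re : ℝ) : ℂ) = (a.re : ℂ) + i := by simp
    rw [e, this, norm_mul (_ / _)]
    ring
  have hsum := MeasureTheory.hasSum_integral_of_summable_integral_norm hint hnorm
  have hG : ∫ t in Set.Ioo (0 : ℝ) 1, ∑' i, F i t = tricomiIntegral a b z := by
    rw [← setIntegral_Ioo_eq_tricomiIntegral]
    refine MeasureTheory.setIntegral_congr_fun measurableSet_Ioo fun t ht => ?_
    have ht0 : (t : ℂ) ≠ 0 := by exact_mod_cast ht.1.ne'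
    have h1 : 0 < 1 - t := by linarith [ht.2]
    have h1c : (1 : ℂ) - t ≠ 0 := by exact_mod_cast h1.ne'
    have hs := (hasSum_laguerreL α z (t := (t : ℂ)) (by
      rw [Complex.norm_real, Real.norm_of_nonneg ht.1.le]; exact ht.2)).mul_left
        ((t : ℂ) ^ (a - 1) * (1 - t : ℂ) ^ (c - 1))
    have e : ∀ i : ℕ, (t : ℂ) ^ (a - 1) * (1 - t : ℂ) ^ (c - 1) * (laguerreL i α z * (t : ℂ) ^ i) =
        F i t := by
      intro i
      simp only [hF]
      rw [show a + i - 1 = a - 1 + i by ring, Complex.cpow_add _ _ ht0, Complex.cpow_natCast]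
      ring
    simp only [e] at hs
    -- This is what dictates c: the weight (1-t)^(c-1) times (1-t)^(-α-1) must be (1-t)^(-b).
    rw [hs.tsum_eq, show -b = c - 1 - (α + 1) by rw [hcdef]; ring, Complex.cpow_sub (c - 1) (α + 1) h1c]
    ring
  rw [hG] at hsum
  have h2 := hsum.mul_left (Complex.Gamma (c + a) / (Complex.Gamma a * Complex.Gamma c))
  have hterm : ∀ i, Complex.Gamma (c + a) / (Complex.Gamma a * Complex.Gamma c) *
      ∫ t in Set.Ioo (0 : ℝ) 1, F i t = laguerreL i α z * (poch a i / poch (c + a) i) := by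
    intro i
    rw [MeasureTheory.integral_const_mul, setIntegral_Ioo_eq_betaIntegral,
      betaIntegral_add_natCast ha hc0]
    have n1 := Complex.Gamma_ne_zero_of_re_pos ha
    have n2 := Complex.Gamma_ne_zero_of_re_pos hc0
    have n3 := Complex.Gamma_ne_zero_of_re_pos hca
    have n4 := poch_ne_zero (ne_neg_natCast_of_re_pos hca) i
    field_simp
  simpa only [hterm] using h2

/-! ### Kummer's equation and the integral representation in the strip 0 < Re b < 1 -/

/-- Kummer's equation on the positive axis, as a first-order system for `D` and `K = -e⁻ᶻ zᵇ D'`. -/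
def KummerSystem (a b : ℂ) (D K : ℝ → ℂ) : Prop :=
  ∀ z : ℝ, 0 < z → HasDerivAt D (-(Complex.exp z * (z : ℂ) ^ (-b)) * K z) z ∧
    HasDerivAt K (-a * (Complex.exp (-z) * (z : ℂ) ^ (b - 1)) * D z) z

lemma KummerSystem.add {a b : ℂ} {D K D' K' : ℝ → ℂ} (h : KummerSystem a b D K)
    (h' : KummerSystem a b D' K') : KummerSystem a b (fun z => D z + D' z) (fun z => K z + K' z) :=
  fun z hz => ⟨((h z hz).1.add (h' z hz).1).congr_deriv (by ring),
    ((h z hz).2.add (h' z hz).2).congr_deriv (by ring)⟩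

lemma KummerSystem.const_mul {a b : ℂ} {D K : ℝ → ℂ} (c : ℂ) (h : KummerSystem a b D K) :
    KummerSystem a b (fun z => c * D z) (fun z => c * K z) :=
  fun z hz => ⟨((h z hz).1.const_mul c).congr_deriv (by ring),
    ((h z hz).2.const_mul c).congr_deriv (by ring)⟩

/-- Uniqueness from the singular point 0, by a Grönwall argument. The coefficients of the system are
O(z^(-Re b)) and O(z^(Re b - 1)), both integrable at 0 precisely because 0 < Re b < 1; hence a
solution with zero limits at 0 vanishes. -/
lemma KummerSystem.eq_zero {a b : ℂ} (hb0 : 0 < b.re) (hb1 : b.re < 1) {D K : ℝ → ℂ}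
    (h : KummerSystem a b D K) (hD : Tendsto D (𝓝[>] 0) (𝓝 0)) (hK : Tendsto K (𝓝[>] 0) (𝓝 0))
    {z₀ : ℝ} (hz₀ : 0 < z₀) : D z₀ = 0 := by
  set β := b.re with hβ
  set E := Real.exp z₀ with hE
  -- A primitive of the sum of the two coefficient bounds on (0, z₀], with E = exp z₀ bounding the
  -- exponential; damping by exp(-Φ) makes |D|² + |K|² nonincreasing.
  set Φ : ℝ → ℝ := fun z => E * (z ^ (1 - β) / (1 - β)) + ‖a‖ * (z ^ β / β) with hΦ
  set g : ℝ → ℝ := fun z => Real.exp (-Φ z) * (‖D z‖ ^ 2 + ‖K z‖ ^ 2) with hg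
  have hderiv : ∀ z : ℝ, 0 < z → HasDerivAt g (Real.exp (-Φ z) *
      -(E * z ^ (-β) + ‖a‖ * z ^ (β - 1)) * (‖D z‖ ^ 2 + ‖K z‖ ^ 2) + Real.exp (-Φ z) *
      (2 * inner ℝ (D z) (-(Complex.exp z * (z : ℂ) ^ (-b)) * K z) +
        2 * inner ℝ (K z) (-a * (Complex.exp (-z) * (z : ℂ) ^ (b - 1)) * D z))) z := by
    intro z hz
    have h1 : HasDerivAt Φ (E * z ^ (-β) + ‖a‖ * z ^ (β - 1)) z := by
      have k1 := ((Real.hasDerivAt_rpow_const (x := z) (p := 1 - β) (Or.inl hz.ne')).div_const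
        (1 - β)).const_mul E
      have k2 := ((Real.hasDerivAt_rpow_const (x := z) (p := β) (Or.inl hz.ne')).div_const
        β).const_mul ‖a‖
      refine (k1.add k2).congr_deriv ?_
      have : 1 - β ≠ 0 := by linarith
      rw [show 1 - β - 1 = -β by ring]
      field_simp
    exact (h1.neg.exp).mul ((h z hz).1.norm_sq.add (h z hz).2.norm_sq)
  have hanti : AntitoneOn g (Set.Ioc 0 z₀) := by
    refine antitoneOn_of_deriv_nonpos (convex_Ioc 0 z₀) ?_ ?_ ?_
    · exact fun z hz => (hderiv z hz.1).continuousAt.continuousWithinAt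
    · rw [interior_Ioc]
      exact fun z hz => (hderiv z hz.1).differentiableAt.differentiableWithinAt
    · rw [interior_Ioc]
      intro z hz
      rw [(hderiv z hz.1).deriv]
      have hz0 : 0 < z := hz.1
      have k1 : ‖Complex.exp z * (z : ℂ) ^ (-b)‖ ≤ E * z ^ (-β) := by
        rw [norm_mul, Complex.norm_cpow_eq_rpow_re_of_pos hz0, Complex.norm_exp, Complex.ofReal_re,
          Complex.neg_re]
        gcongr
        exact Real.exp_le_exp.mpr hz.2.le
      have k2 : ‖a * (Complex.exp (-z) * (z : ℂ) ^ (b - 1))‖ ≤ ‖a‖ * z ^ (β - 1) := by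
        rw [norm_mul, norm_mul, Complex.norm_cpow_eq_rpow_re_of_pos hz0, Complex.norm_exp,
          Complex.sub_re, Complex.one_re, Complex.neg_re, Complex.ofReal_re]
        gcongr
        exact mul_le_of_le_one_left (by positivity) (Real.exp_le_one_iff.mpr (by linarith))
      have i1 : inner ℝ (D z) (-(Complex.exp z * (z : ℂ) ^ (-b)) * K z) ≤
          E * z ^ (-β) * (‖D z‖ * ‖K z‖) := by
        refine (real_inner_le_norm _ _).trans ?_
        rw [norm_mul, norm_neg]
        calc _ = ‖Complex.exp z * (z : ℂ) ^ (-b)‖ * (‖D z‖ * ‖K z‖) := by ring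
          _ ≤ _ := by gcongr
      have i2 : inner ℝ (K z) (-a * (Complex.exp (-z) * (z : ℂ) ^ (b - 1)) * D z) ≤
          ‖a‖ * z ^ (β - 1) * (‖D z‖ * ‖K z‖) := by
        refine (real_inner_le_norm _ _).trans ?_
        rw [norm_mul, neg_mul, norm_neg]
        calc _ = ‖a * (Complex.exp (-z) * (z : ℂ) ^ (b - 1))‖ * (‖D z‖ * ‖K z‖) := by ring
          _ ≤ _ := by gcongr
      have i3 : 2 * (‖D z‖ * ‖K z‖) ≤ ‖D z‖ ^ 2 + ‖K z‖ ^ 2 := by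
        nlinarith [sq_nonneg (‖D z‖ - ‖K z‖)]
      have i4 : 0 ≤ E * z ^ (-β) + ‖a‖ * z ^ (β - 1) := by positivity
      have i5 := mul_le_mul_of_nonneg_left i3 i4
      rw [mul_assoc, ← mul_add]
      refine mul_nonpos_of_nonneg_of_nonpos (Real.exp_pos _).le ?_
      linarith
  have hle : ∀ᶠ w in 𝓝[>] (0 : ℝ), g z₀ ≤ ‖D w‖ ^ 2 + ‖K w‖ ^ 2 := by
    filter_upwards [Ioc_mem_nhdsGT hz₀] with w hw
    refine (hanti hw ⟨hz₀, le_rfl⟩ hw.2).trans ?_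
    refine mul_le_of_le_one_left (by positivity) (Real.exp_le_one_iff.mpr ?_)
    have : 0 < w := hw.1
    have : 0 < 1 - β := by linarith
    simp only [hΦ, Left.neg_nonpos_iff]
    positivity
  have hlim : Tendsto (fun w => ‖D w‖ ^ 2 + ‖K w‖ ^ 2) (𝓝[>] (0 : ℝ)) (𝓝 0) := by
    simpa using (hD.norm.pow 2).add (hK.norm.pow 2)
  have hg0 : g z₀ ≤ 0 := ge_of_tendsto hlim hle
  have h2 : ‖D z₀‖ ^ 2 + ‖K z₀‖ ^ 2 ≤ 0 := by
    by_contra hcon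
    push Not at hcon
    have : 0 < g z₀ := mul_pos (Real.exp_pos _) hcon
    linarith
  have : ‖D z₀‖ ^ 2 = 0 := by nlinarith [sq_nonneg ‖D z₀‖, sq_nonneg ‖K z₀‖]
  simpa using this

/-- Coefficient sequences whose exponential generating series is entire. -/
def EntireCoeff (c : ℕ → ℂ) : Prop := ∀ R : ℝ, 0 ≤ R → Summable fun n => ‖c n‖ * (R ^ n / n.factorial)

lemma EntireCoeff.shift {c : ℕ → ℂ} (hc : EntireCoeff c) : EntireCoeff fun n => c (n + 1) := by
  intro R hR
  refine Summable.of_nonneg_of_le (fun n => by positivity) (fun n => ?_)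
    ((summable_nat_add_iff 1).mpr (hc (2 * (R + 1)) (by positivity)))
  gcongr ?_ * ?_
  rw [Nat.factorial_succ, div_le_div_iff₀ (by positivity) (by positivity)]
  have h1 : ((n + 1 : ℕ) : ℝ) ≤ 2 ^ (n + 1) := by exact_mod_cast Nat.lt_two_pow_self.le
  have h2 : R ^ n ≤ (R + 1) ^ (n + 1) := by
    calc R ^ n ≤ (R + 1) ^ n := by gcongr; linarith
      _ ≤ (R + 1) ^ (n + 1) := pow_le_pow_right₀ (by linarith) (by omega)
  push_cast at h1 ⊢
  calc R ^ n * (((n : ℝ) + 1) * n.factorial)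
      ≤ (R + 1) ^ (n + 1) * (2 ^ (n + 1) * n.factorial) := by gcongr
    _ = _ := by rw [mul_pow]; ring

lemma EntireCoeff.summable {c : ℕ → ℂ} (hc : EntireCoeff c) (z : ℂ) :
    Summable fun n => c n * (z ^ n / n.factorial) :=
  Summable.of_norm (by simpa using hc ‖z‖ (norm_nonneg z))

lemma EntireCoeff.hasDerivAt {c : ℕ → ℂ} (hc : EntireCoeff c) (z : ℂ) :
    HasDerivAt (fun z : ℂ => ∑' n, c n * (z ^ n / n.factorial))
      (∑' n, c (n + 1) * (z ^ n / n.factorial)) z := by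
  set g' : ℕ → ℂ → ℂ := fun n y => c n * (n * y ^ (n - 1) / n.factorial) with hg'
  have hsucc : ∀ n y, g' (n + 1) y = c (n + 1) * (y ^ n / n.factorial) := by
    intro n y
    have h1 : (n : ℂ) + 1 ≠ 0 := by exact_mod_cast n.succ_ne_zero
    have h2 := factorial_ne_zero' n
    simp only [hg', Nat.factorial_succ, Nat.add_sub_cancel]
    push_cast
    field_simp
  set R := ‖z‖ + 1 with hR
  have hu : Summable fun n => ‖g' n (R : ℂ)‖ := by
    rw [← summable_nat_add_iff 1]
    simp only [hsucc]
    refine (hc.shift R (by positivity)).congr fun n => ?_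
    simp [abs_of_nonneg (show 0 ≤ R by positivity)]
  have key := hasDerivAt_tsum_of_isPreconnected hu (Metric.isOpen_ball (x := (0 : ℂ)) (ε := R))
    (convex_ball _ _).isPreconnected (g := fun n y => c n * (y ^ n / n.factorial)) (g' := g')
    (fun n y _ => ((hasDerivAt_pow n y).div_const _).const_mul _) (fun n y hy => by
      have hy' : ‖y‖ ≤ R := by simpa using (Metric.mem_ball.mp hy).le
      simp only [hg', norm_mul, norm_div, norm_pow, Complex.norm_natCast, Complex.norm_real]
      gcongr
      rwa [Real.norm_of_nonneg (by positivity)])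
    (y₀ := z) (y := z) (by simp [hR]) (hc.summable z) (by simp [hR])
  refine key.congr_deriv ?_
  have hs : Summable fun n => g' n z := by
    rw [← summable_nat_add_iff 1]
    simp only [hsucc]
    exact hc.shift.summable z
  rw [hs.tsum_eq_zero_add]
  simp only [hsucc]
  simp [hg']

lemma entireCoeff_poch (a : ℂ) {b : ℂ} (hb : ∀ n : ℕ, b ≠ -(n : ℂ)) :
    EntireCoeff fun n => poch a n / poch b n := by
  intro R hR
  obtain ⟨K, hK, hbd⟩ := exists_norm_poch_div_poch_le a hb
  refine Summable.of_nonneg_of_le (fun n => by positivity) (fun n => ?_)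
    ((summable_pow_div_factorial_mul_rpow R (a - b).re hR).mul_left K)
  calc _ ≤ K * ((n : ℝ) + 1) ^ (a - b).re * (R ^ n / n.factorial) := by
        gcongr; exact hbd n
    _ = _ := by ring

/-- The derivatives of Kummer's function of the first kind. -/
noncomputable def kummerMDeriv (k : ℕ) (a b z : ℂ) : ℂ :=
  ∑' n : ℕ, poch a (n + k) / poch b (n + k) * (z ^ n / n.factorial)

lemma kummerM_eq_kummerMDeriv (a b z : ℂ) : kummerM a b z = kummerMDeriv 0 a b z :=
  kummerM_eq_tsum a b z

lemma entireCoeff_poch_add (a : ℂ) {b : ℂ} (hb : ∀ n : ℕ, b ≠ -(n : ℂ)) (k : ℕ) :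
    EntireCoeff fun n => poch a (n + k) / poch b (n + k) := by
  induction k with
  | zero => exact entireCoeff_poch a hb
  | succ k ih =>
    have := ih.shift
    simpa only [add_right_comm, add_assoc] using this

lemma hasDerivAt_kummerMDeriv (k : ℕ) (a : ℂ) {b : ℂ} (hb : ∀ n : ℕ, b ≠ -(n : ℂ)) (z : ℂ) :
    HasDerivAt (kummerMDeriv k a b) (kummerMDeriv (k + 1) a b z) z := by
  refine ((entireCoeff_poch_add a hb k).hasDerivAt z).congr_deriv ?_
  rw [kummerMDeriv]
  simp only [add_assoc, add_comm 1 k]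

/-- Multiplication of an exponential generating series by the variable. -/
lemma EntireCoeff.mul_tsum {c : ℕ → ℂ} (hc : EntireCoeff fun n => c (n + 1)) (z : ℂ) :
    z * ∑' n, c (n + 1) * (z ^ n / n.factorial) = ∑' n, n * c n * (z ^ n / n.factorial) ∧
      Summable fun n => n * c n * (z ^ n / n.factorial) := by
  have hsucc : ∀ n : ℕ, ((n + 1 : ℕ) : ℂ) * c (n + 1) * (z ^ (n + 1) / (n + 1).factorial) =
      z * (c (n + 1) * (z ^ n / n.factorial)) := by
    intro n
    have h1 : (n : ℂ) + 1 ≠ 0 := by exact_mod_cast n.succ_ne_zero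
    have h2 := factorial_ne_zero' n
    rw [Nat.factorial_succ]
    push_cast
    field_simp
    ring
  have hs : Summable fun n => n * c n * (z ^ n / n.factorial) := by
    rw [← summable_nat_add_iff 1]
    simp only [hsucc]
    exact (hc.summable z).mul_left z
  refine ⟨?_, hs⟩
  rw [hs.tsum_eq_zero_add]
  simp only [hsucc]
  rw [tsum_mul_left]
  simp

/-- Kummer's differential equation. -/
lemma kummerMDeriv_ode (a : ℂ) {b : ℂ} (hb : ∀ n : ℕ, b ≠ -(n : ℂ)) (z : ℂ) :
    z * kummerMDeriv 2 a b z + (b - z) * kummerMDeriv 1 a b z - a * kummerMDeriv 0 a b z = 0 := by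
  have h2 := EntireCoeff.mul_tsum (c := fun n => poch a (n + 1) / poch b (n + 1))
    (by simpa only [add_assoc] using entireCoeff_poch_add a hb 2) z
  have h1 := EntireCoeff.mul_tsum (c := fun n => poch a n / poch b n)
    (entireCoeff_poch_add a hb 1) z
  have e2 : z * kummerMDeriv 2 a b z = _ := h2.1
  have e1 : z * kummerMDeriv 1 a b z = _ := h1.1
  have s1 := (entireCoeff_poch_add a hb 1).summable z
  have s0 := (entireCoeff_poch_add a hb 0).summable z
  rw [sub_mul, e2, e1, kummerMDeriv, kummerMDeriv, ← tsum_mul_left, ← tsum_mul_left,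
    ← (s1.mul_left b).tsum_sub h1.2, ← h2.2.tsum_add ((s1.mul_left b).sub h1.2),
    ← (h2.2.add ((s1.mul_left b).sub h1.2)).tsum_sub (s0.mul_left a)]
  -- The equation holds coefficient by coefficient.
  refine (tsum_congr fun n => ?_).trans tsum_zero
  have n1 := poch_ne_zero hb n
  have n2 : b + n ≠ 0 := fun h => hb n (eq_neg_of_add_eq_zero_left h)
  simp only [poch_succ, add_zero]
  field_simp
  ring

lemma measurable_tricomiKernel (s q : ℂ) (z : ℝ) : Measurable (tricomiKernel s q z) := by
  unfold tricomiKernel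
  fun_prop

lemma norm_tricomiKernel (s q : ℂ) (z : ℝ) {u : ℝ} (hu : 0 < u) :
    ‖tricomiKernel s q z u‖ = u ^ s.re * (1 + u) ^ q.re * Real.exp (-z * u) := by
  have h1 : 0 < 1 + u := by positivity
  have e1 : (1 + u : ℂ) = ((1 + u : ℝ) : ℂ) := by push_cast; rfl
  rw [tricomiKernel, norm_mul, norm_mul, e1, Complex.norm_cpow_eq_rpow_re_of_pos hu,
    Complex.norm_cpow_eq_rpow_re_of_pos h1, Complex.norm_exp]
  simp

lemma exists_one_add_rpow_le (q : ℝ) {ε : ℝ} (hε : 0 < ε) :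
    ∃ K : ℝ, 0 < K ∧ ∀ u : ℝ, 0 ≤ u → (1 + u) ^ q ≤ K * Real.exp (ε * u) := by
  obtain ⟨K, hK, h⟩ := exists_rpow_le_mul_exp |q| (abs_nonneg q)
  refine ⟨(ε ^ |q|)⁻¹ * (K * Real.exp ε), by positivity, fun u hu => ?_⟩
  have h2 := h (ε * (1 + u)) (by positivity)
  rw [Real.mul_rpow hε.le (by positivity)] at h2
  calc (1 + u) ^ q ≤ (1 + u) ^ |q| :=
        Real.rpow_le_rpow_of_exponent_le (by linarith) (le_abs_self q)
    _ = (ε ^ |q|)⁻¹ * (ε ^ |q| * (1 + u) ^ |q|) := by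
        have : ε ^ |q| ≠ 0 := by positivity
        field_simp
    _ ≤ (ε ^ |q|)⁻¹ * (K * Real.exp (ε * (1 + u))) := by gcongr
    _ = _ := by rw [mul_add, mul_one, Real.exp_add]; ring

/-- Half of the exponential decay absorbs the power of 1 + u, whatever q is; only the singularity at
0 restricts s. -/
lemma integrableOn_tricomiKernel {s : ℂ} (q : ℂ) {z : ℝ} (hs : -1 < s.re) (hz : 0 < z) :
    MeasureTheory.IntegrableOn (tricomiKernel s q z) (Set.Ioi 0) := by
  obtain ⟨K, hK, h⟩ := exists_one_add_rpow_le q.re (half_pos hz)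
  have hint := (integrableOn_rpow_mul_exp_neg_mul_rpow hs one_pos (half_pos hz)).const_mul K
  refine MeasureTheory.Integrable.mono' hint (measurable_tricomiKernel s q z).aestronglyMeasurable ?_
  filter_upwards [MeasureTheory.ae_restrict_mem measurableSet_Ioi] with u hu
  have hu' : 0 < u := hu
  rw [norm_tricomiKernel s q z hu', Real.rpow_one]
  calc u ^ s.re * (1 + u) ^ q.re * Real.exp (-z * u)
      ≤ u ^ s.re * (K * Real.exp (z / 2 * u)) * Real.exp (-z * u) := by
        gcongr; exact h u hu'.le
    _ = K * (u ^ s.re * (Real.exp (z / 2 * u) * Real.exp (-z * u))) := by ring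
    _ = _ := by rw [← Real.exp_add]; congr 3; ring

/-- The integral of `tricomiKernel`. -/
noncomputable def tricomiLaplace (s q : ℂ) (z : ℝ) : ℂ :=
  ∫ u in Set.Ioi (0 : ℝ), tricomiKernel s q z u

lemma tricomiKernel_mul_left {s q : ℂ} {z u : ℝ} (hu : 0 < u) :
    (u : ℂ) * tricomiKernel s q z u = tricomiKernel (s + 1) q z u := by
  have : (u : ℂ) ≠ 0 := by exact_mod_cast hu.ne'
  rw [tricomiKernel, tricomiKernel, Complex.cpow_add _ _ this, Complex.cpow_one]
  ring

lemma hasDerivAt_tricomiLaplace {s : ℂ} (q : ℂ) {z : ℝ} (hs : -1 < s.re) (hz : 0 < z) :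
    HasDerivAt (tricomiLaplace s q) (-tricomiLaplace (s + 1) q z) z := by
  -- The derivative is dominated uniformly for x > z/2 by the kernel at z/2.
  have hs1 : -1 < (s + 1).re := by simp; linarith
  have key := hasDerivAt_integral_of_dominated_loc_of_deriv_le
    (μ := MeasureTheory.volume.restrict (Set.Ioi (0 : ℝ))) (F := fun z u => tricomiKernel s q z u)
    (F' := fun z u => -tricomiKernel (s + 1) q z u) (s := Set.Ioi (z / 2)) (x₀ := z)
    (bound := fun u => ‖tricomiKernel (s + 1) q (z / 2) u‖)
    (Ioi_mem_nhds (by linarith))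
    (Eventually.of_forall fun x => (measurable_tricomiKernel s q x).aestronglyMeasurable)
    (integrableOn_tricomiKernel q hs hz)
    (measurable_tricomiKernel _ q z).neg.aestronglyMeasurable
    ?_ (integrableOn_tricomiKernel q hs1 (half_pos hz)).norm ?_
  · have := key.2
    rw [MeasureTheory.integral_neg] at this
    exact this
  · filter_upwards [MeasureTheory.ae_restrict_mem measurableSet_Ioi] with u hu x hx
    have hu' : 0 < u := hu
    have hx' : z / 2 < x := hx
    rw [norm_neg, norm_tricomiKernel _ _ _ hu', norm_tricomiKernel _ _ _ hu']
    gcongr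
  · filter_upwards [MeasureTheory.ae_restrict_mem measurableSet_Ioi] with u hu x _
    rw [← tricomiKernel_mul_left hu]
    have h1 : HasDerivAt (fun x : ℝ => Complex.exp (-(x : ℂ) * u))
        (Complex.exp (-(x : ℂ) * u) * (-1 * u)) x :=
      (((hasDerivAt_id (x : ℂ)).neg.mul_const (u : ℂ)).cexp).comp_ofReal
    refine (h1.const_mul ((u : ℂ) ^ s * (1 + u : ℂ) ^ q)).congr_deriv ?_
    rw [tricomiKernel]
    ring

/-- Integration by parts for the Laplace integrals. -/
lemma tricomiLaplace_by_parts {a : ℂ} (b : ℂ) {z : ℝ} (ha : 0 < a.re) (hz : 0 < z) :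
    a * tricomiLaplace (a - 1) (b - a - 1) z + (b - z) * tricomiLaplace a (b - a - 1) z
      - z * tricomiLaplace (a + 1) (b - a - 1) z = 0 := by
  have i0 := integrableOn_tricomiKernel (b - a - 1) (s := a - 1) (by simp; linarith) hz
  have i1 := integrableOn_tricomiKernel (b - a - 1) (s := a) (by linarith) hz
  have i2 := integrableOn_tricomiKernel (b - a - 1) (s := a + 1) (by simp; linarith) hz
  have i3 := integrableOn_tricomiKernel (b - a) (s := a) (by linarith) hz
  -- The derivative of u^a (1+u)^(b-a) e^(-zu), rewritten with the common factor (1+u)^(b-a-1); that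
  -- function vanishes at 0 and at infinity.
  set f' : ℝ → ℂ := fun u => a * tricomiKernel (a - 1) (b - a - 1) z u +
    (b - z) * tricomiKernel a (b - a - 1) z u - z * tricomiKernel (a + 1) (b - a - 1) z u with hf'
  have f'int : MeasureTheory.IntegrableOn f' (Set.Ioi 0) :=
    ((i0.const_mul a).add (i1.const_mul (b - z))).sub (i2.const_mul (z : ℂ))
  have hderiv : ∀ u ∈ Set.Ioi (0 : ℝ), HasDerivAt (tricomiKernel a (b - a) z) (f' u) u := by
    intro u hu
    have hu' : (0 : ℝ) < u := hu
    have hu0 : (u : ℂ) ≠ 0 := by exact_mod_cast hu'.ne'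
    have h1 : (0 : ℝ) < 1 + u := by positivity
    have h1c : (1 + u : ℂ) ≠ 0 := by exact_mod_cast h1.ne'
    have hsl : (1 + u : ℂ) ∈ Complex.slitPlane := by
      left; simp; positivity
    have hsl0 : (u : ℂ) ∈ Complex.slitPlane := by
      left; simpa using hu'
    have d1 := (hasDerivAt_id (u : ℂ)).cpow_const (c := a) hsl0
    have d2 := ((hasDerivAt_id (u : ℂ)).const_add 1).cpow_const (c := b - a) hsl
    have d3 := ((hasDerivAt_id (u : ℂ)).const_mul (-(z : ℂ))).cexp
    refine ((d1.mul d2).mul d3).comp_ofReal.congr_deriv ?_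
    have e1 : (u : ℂ) ^ a = u * (u : ℂ) ^ (a - 1) := by
      rw [Complex.cpow_sub _ _ hu0, Complex.cpow_one]; field_simp
    have e2 : (1 + u : ℂ) ^ (b - a) = (1 + u) * (1 + u : ℂ) ^ (b - a - 1) := by
      rw [Complex.cpow_sub (b - a) 1 h1c, Complex.cpow_one]; field_simp
    have e3 : (u : ℂ) ^ (a + 1) = u * (u * (u : ℂ) ^ (a - 1)) := by
      rw [Complex.cpow_add _ _ hu0, Complex.cpow_one, e1]; ring
    simp only [hf', tricomiKernel, id, Pi.mul_apply, e1, e2, e3]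
    ring
  have hcont : ContinuousWithinAt (tricomiKernel a (b - a) z) (Set.Ici 0) 0 := by
    refine ContinuousAt.continuousWithinAt ?_
    unfold tricomiKernel
    refine ContinuousAt.mul (ContinuousAt.mul ?_ ?_) ?_
    · exact Complex.continuousAt_ofReal_cpow_const _ _ (Or.inl ha)
    · refine ContinuousAt.cpow (by fun_prop) continuousAt_const ?_
      simp
    · fun_prop
  have hlim := MeasureTheory.tendsto_zero_of_hasDerivAt_of_integrableOn_Ioi hderiv f'int i3
  have key := MeasureTheory.integral_Ioi_of_hasDerivAt_of_tendsto hcont hderiv f'int hlim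
  have h0 : tricomiKernel a (b - a) z 0 = 0 := by
    have : a ≠ 0 := by rintro rfl; simp at ha
    simp [tricomiKernel, this]
  have i01 : MeasureTheory.IntegrableOn (fun u => a * tricomiKernel (a - 1) (b - a - 1) z u +
    (b - z) * tricomiKernel a (b - a - 1) z u) (Set.Ioi 0) :=
    (i0.const_mul a).add (i1.const_mul (b - z))
  simp only [h0, sub_zero, hf'] at key
  rw [MeasureTheory.integral_sub i01 (i2.const_mul (z : ℂ)),
    MeasureTheory.integral_add (i0.const_mul a) (i1.const_mul (b - z)),
    MeasureTheory.integral_const_mul, MeasureTheory.integral_const_mul,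
    MeasureTheory.integral_const_mul] at key
  exact key

lemma hasDerivAt_ofReal_cpow (s : ℂ) {z : ℝ} (hz : 0 < z) :
    HasDerivAt (fun z : ℝ => (z : ℂ) ^ s) (s * (z : ℂ) ^ (s - 1)) z := by
  have hsl : (z : ℂ) ∈ Complex.slitPlane := by left; simpa using hz
  exact (((hasDerivAt_id (z : ℂ)).cpow_const (c := s) hsl).comp_ofReal).congr_deriv (by simp)

lemma hasDerivAt_exp_neg_ofReal (z : ℝ) :
    HasDerivAt (fun z : ℝ => Complex.exp (-(z : ℂ))) (-Complex.exp (-(z : ℂ))) z :=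
  (((hasDerivAt_id (z : ℂ)).neg.cexp).comp_ofReal).congr_deriv (by simp)

lemma exp_mul_exp_neg (z : ℂ) : Complex.exp z * Complex.exp (-z) = 1 := by
  rw [← Complex.exp_add]; simp

/-- Differentiation under the integral raises the exponent of u by one and gives the first equation;
the second is the integration by parts. -/
lemma kummerSystem_tricomiIntegral {a : ℂ} (b : ℂ) (ha : 0 < a.re) :
    KummerSystem a b (tricomiIntegral a b)
      (fun z => Complex.exp (-z) * (z : ℂ) ^ b * tricomiLaplace a (b - a - 1) z) := by
  intro z hz
  have hz0 : (z : ℂ) ≠ 0 := by exact_mod_cast hz.ne'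
  have d0 := hasDerivAt_tricomiLaplace (b - a - 1) (s := a - 1) (by simp; linarith) hz
  have d1 := hasDerivAt_tricomiLaplace (b - a - 1) (s := a) (by linarith) hz
  have hexp := exp_mul_exp_neg z
  have hpow : (z : ℂ) ^ (-b) * (z : ℂ) ^ b = 1 := by
    rw [← Complex.cpow_add _ _ hz0]; simp
  have hpow1 : (z : ℂ) ^ b = z * (z : ℂ) ^ (b - 1) := by
    rw [Complex.cpow_sub _ _ hz0, Complex.cpow_one]; field_simp
  constructor
  · refine d0.congr_deriv ?_
    rw [sub_add_cancel]
    linear_combination tricomiLaplace a (b - a - 1) z * (Complex.exp z * Complex.exp (-z)) * hpow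
      + tricomiLaplace a (b - a - 1) z * hexp
  · refine (((hasDerivAt_exp_neg_ofReal z).mul (hasDerivAt_ofReal_cpow b hz)).mul d1).congr_deriv ?_
    have hp := tricomiLaplace_by_parts b ha hz
    have hJ : tricomiIntegral a b z = tricomiLaplace (a - 1) (b - a - 1) z := rfl
    simp only [Pi.mul_apply]
    rw [hJ, hpow1]
    linear_combination (Complex.exp (-z) * (z : ℂ) ^ (b - 1)) * hp

lemma kummerSystem_kummerM (a : ℂ) {b : ℂ} (hb : ∀ n : ℕ, b ≠ -(n : ℂ)) :
    KummerSystem a b (fun z => kummerM a b z)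
      (fun z => -(Complex.exp (-z) * (z : ℂ) ^ b) * kummerMDeriv 1 a b z) := by
  intro z hz
  have hz0 : (z : ℂ) ≠ 0 := by exact_mod_cast hz.ne'
  have d0 := (hasDerivAt_kummerMDeriv 0 a hb z).comp_ofReal
  have d1 := (hasDerivAt_kummerMDeriv 1 a hb z).comp_ofReal
  have hexp := exp_mul_exp_neg z
  have hpow : (z : ℂ) ^ (-b) * (z : ℂ) ^ b = 1 := by
    rw [← Complex.cpow_add _ _ hz0]; simp
  have hpow1 : (z : ℂ) ^ b = z * (z : ℂ) ^ (b - 1) := by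
    rw [Complex.cpow_sub _ _ hz0, Complex.cpow_one]; field_simp
  simp only [kummerM_eq_kummerMDeriv]
  constructor
  · refine d0.congr_deriv ?_
    rw [zero_add]
    linear_combination -kummerMDeriv 1 a b z * (Complex.exp z * Complex.exp (-z)) * hpow
      - kummerMDeriv 1 a b z * hexp
  · refine (((hasDerivAt_exp_neg_ofReal z).mul
      (hasDerivAt_ofReal_cpow b hz)).neg.mul d1).congr_deriv ?_
    have hode := kummerMDeriv_ode a hb z
    simp only [Pi.mul_apply, Pi.neg_apply, one_add_one_eq_two]
    rw [hpow1]
    linear_combination -(Complex.exp (-z) * (z : ℂ) ^ (b - 1)) * hode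

/-- In the second component the powers of z cancel, so it stays bounded at 0 although the derivative
of z^(1-b) does not. -/
lemma kummerSystem_second (a : ℂ) {b : ℂ} (hb : ∀ n : ℕ, 2 - b ≠ -(n : ℂ)) :
    KummerSystem a b (fun z => (z : ℂ) ^ (1 - b) * kummerM (a - b + 1) (2 - b) z)
      (fun z => -Complex.exp (-z) * ((1 - b) * kummerMDeriv 0 (a - b + 1) (2 - b) z +
        z * kummerMDeriv 1 (a - b + 1) (2 - b) z)) := by
  intro z hz
  have hz0 : (z : ℂ) ≠ 0 := by exact_mod_cast hz.ne'
  have d0 := (hasDerivAt_kummerMDeriv 0 (a - b + 1) hb z).comp_ofReal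
  have d1 := (hasDerivAt_kummerMDeriv 1 (a - b + 1) hb z).comp_ofReal
  have hexp := exp_mul_exp_neg z
  have hid : HasDerivAt (fun z : ℝ => (z : ℂ)) 1 z := (hasDerivAt_id (z : ℂ)).comp_ofReal
  have hpow1 : (z : ℂ) ^ (1 - b) = z * (z : ℂ) ^ (-b) := by
    rw [sub_eq_add_neg, Complex.cpow_add _ _ hz0, Complex.cpow_one]
  have hpow2 : (z : ℂ) ^ (b - 1) * (z : ℂ) ^ (1 - b) = 1 := by
    rw [← Complex.cpow_add _ _ hz0]; simp
  simp only [kummerM_eq_kummerMDeriv]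
  rw [zero_add] at d0
  rw [one_add_one_eq_two] at d1
  constructor
  · refine ((hasDerivAt_ofReal_cpow (1 - b) hz).mul d0).congr_deriv ?_
    rw [show 1 - b - 1 = -b by ring, hpow1]
    linear_combination -((z : ℂ) ^ (-b) * ((1 - b) * kummerMDeriv 0 (a - b + 1) (2 - b) z +
        z * kummerMDeriv 1 (a - b + 1) (2 - b) z)) * hexp
  · refine ((hasDerivAt_exp_neg_ofReal z).neg.mul
      ((d0.const_mul (1 - b)).add (hid.mul d1))).congr_deriv ?_
    have hode := kummerMDeriv_ode (a - b + 1) hb z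
    simp only [Pi.mul_apply, Pi.neg_apply, Pi.add_apply]
    linear_combination -Complex.exp (-z) * hode +
      a * Complex.exp (-z) * kummerMDeriv 0 (a - b + 1) (2 - b) z * hpow2

lemma kummerMDeriv_zero_right (k : ℕ) (a b : ℂ) : kummerMDeriv k a b 0 = poch a k / poch b k := by
  rw [kummerMDeriv, tsum_eq_single 0]
  · simp
  · intro n hn
    simp [hn]

lemma tendsto_kummerMDeriv (k : ℕ) (a : ℂ) {b : ℂ} (hb : ∀ n : ℕ, b ≠ -(n : ℂ)) :
    Tendsto (fun z : ℝ => kummerMDeriv k a b z) (𝓝[>] 0) (𝓝 (poch a k / poch b k)) := by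
  have := ((hasDerivAt_kummerMDeriv k a hb ((0 : ℝ) : ℂ)).comp_ofReal).continuousAt.tendsto
  rw [Complex.ofReal_zero, kummerMDeriv_zero_right] at this
  exact this.mono_left nhdsWithin_le_nhds

lemma tendsto_ofReal_cpow {s : ℂ} (hs : 0 < s.re) :
    Tendsto (fun z : ℝ => (z : ℂ) ^ s) (𝓝[>] 0) (𝓝 0) := by
  have h0 : s ≠ 0 := by rintro rfl; simp at hs
  have := (Complex.continuousAt_ofReal_cpow_const 0 s (Or.inl hs)).tendsto
  rw [Complex.ofReal_zero, Complex.zero_cpow h0] at this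
  exact this.mono_left nhdsWithin_le_nhds

lemma tendsto_exp_neg_ofReal :
    Tendsto (fun z : ℝ => Complex.exp (-(z : ℂ))) (𝓝[>] 0) (𝓝 1) := by
  have : Continuous fun z : ℝ => Complex.exp (-(z : ℂ)) := by fun_prop
  have h := this.tendsto 0
  simp only [Complex.ofReal_zero, neg_zero, Complex.exp_zero] at h
  exact h.mono_left nhdsWithin_le_nhds

/-- At z = 0 the integral is a beta integral, convergent because Re b < 1, and its integrand
dominates for z > 0. -/
lemma tendsto_tricomiIntegral_zero {a b : ℂ} (ha : 0 < a.re) (hb : b.re < 1) :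
    Tendsto (tricomiIntegral a b) (𝓝[>] 0)
      (𝓝 (Complex.Gamma a * Complex.Gamma (1 - b) / Complex.Gamma (1 - b + a))) := by
  have hb' : 0 < (1 - b).re := by simp; linarith
  have hval : tricomiIntegral a b 0 =
      Complex.Gamma a * Complex.Gamma (1 - b) / Complex.Gamma (1 - b + a) := by
    rw [add_comm (1 - b) a, ← Complex.betaIntegral_eq_Gamma_mul_div a (1 - b) ha hb', ← setIntegral_Ioo_eq_tricomiIntegral,
      ← setIntegral_Ioo_eq_betaIntegral]
    refine MeasureTheory.setIntegral_congr_fun measurableSet_Ioo fun t _ => ?_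
    simp only [Complex.ofReal_zero, neg_zero, zero_mul, zero_div, Complex.exp_zero, mul_one]
    rw [show 1 - b - 1 = -b by ring]
  have hint : MeasureTheory.IntegrableOn (tricomiKernel (a - 1) (b - a - 1) 0) (Set.Ioi 0) := by
    have h1 := integrableOn_Ioo_beta ha hb'
    rw [← image_div_one_add, MeasureTheory.integrableOn_image_iff_integrableOn_abs_deriv_smul
      measurableSet_Ioi hasDerivWithinAt_div_one_add injOn_div_one_add] at h1
    refine h1.congr_fun (fun u hu => ?_) measurableSet_Ioi
    rw [← abs_smul_eq_tricomiKernel a b 0 hu]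
    simp only [Complex.ofReal_zero, neg_zero, zero_mul, zero_div, Complex.exp_zero, mul_one]
    rw [show 1 - b - 1 = -b by ring]
  rw [← hval]
  refine MeasureTheory.tendsto_integral_filter_of_dominated_convergence
    (fun u => ‖tricomiKernel (a - 1) (b - a - 1) 0 u‖)
    (Eventually.of_forall fun z => (measurable_tricomiKernel _ _ z).aestronglyMeasurable)
    ?_ hint.norm ?_
  · filter_upwards [self_mem_nhdsWithin] with z hz
    filter_upwards [MeasureTheory.ae_restrict_mem measurableSet_Ioi] with u hu
    have hz' : 0 < z := hz
    have hu' : 0 < u := hu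
    rw [norm_tricomiKernel _ _ _ hu', norm_tricomiKernel _ _ _ hu']
    gcongr
  · refine Eventually.of_forall fun u => ?_
    have : Continuous fun z : ℝ => tricomiKernel (a - 1) (b - a - 1) z u := by
      unfold tricomiKernel; fun_prop
    exact (this.tendsto 0).mono_left nhdsWithin_le_nhds

/-- Rescaling v = zu gives ∫ v^a (z+v)^(b-a-1) e^(-v) dv. As Re(b-a-1) < 0, the integrand is
dominated by its form at z = 0, which is the integrand of Γ(b). -/
lemma tendsto_cpow_mul_tricomiLaplace {a b : ℂ} (ha : 0 < a.re) (hb0 : 0 < b.re) (hb1 : b.re < 1) :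
    Tendsto (fun z : ℝ => (z : ℂ) ^ b * tricomiLaplace a (b - a - 1) z) (𝓝[>] 0)
      (𝓝 (Complex.Gamma b)) := by
  have hscale : ∀ z : ℝ, 0 < z → (z : ℂ) ^ b * tricomiLaplace a (b - a - 1) z =
      ∫ v in Set.Ioi (0 : ℝ), (v : ℂ) ^ a * ((z + v : ℝ) : ℂ) ^ (b - a - 1) * Complex.exp (-v) := by
    intro z hz
    have hz0 : (z : ℂ) ≠ 0 := by exact_mod_cast hz.ne'
    have h := MeasureTheory.integral_comp_mul_left_Ioi (fun v : ℝ =>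
      (v : ℂ) ^ a * ((z + v : ℝ) : ℂ) ^ (b - a - 1) * Complex.exp (-v)) 0 hz
    rw [mul_zero, eq_inv_smul_iff₀ hz.ne'] at h
    rw [← h, tricomiLaplace, ← MeasureTheory.integral_const_mul, Complex.real_smul,
      ← MeasureTheory.integral_const_mul]
    refine MeasureTheory.setIntegral_congr_fun measurableSet_Ioi fun u hu => ?_
    have hu' : (0 : ℝ) < u := hu
    have e1 : z + z * u = z * (1 + u) := by ring
    have e2 : (z : ℂ) ^ b = z * ((z : ℂ) ^ a * (z : ℂ) ^ (b - a - 1)) := by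
      nth_rw 2 [← Complex.cpow_one (z : ℂ)]
      rw [← Complex.cpow_add _ _ hz0, ← Complex.cpow_add _ _ hz0]
      congr 1; ring
    simp only [tricomiKernel]
    rw [e1, Complex.ofReal_mul, Complex.ofReal_mul, Complex.mul_cpow_ofReal_nonneg hz.le hu'.le,
      Complex.mul_cpow_ofReal_nonneg hz.le (by positivity), e2]
    push_cast
    ring_nf
  rw [Complex.Gamma_eq_integral hb0, Complex.GammaIntegral]
  refine Tendsto.congr' (f₁ := fun z : ℝ => ∫ v in Set.Ioi (0 : ℝ),
    (v : ℂ) ^ a * ((z + v : ℝ) : ℂ) ^ (b - a - 1) * Complex.exp (-v)) ?_ ?_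
  · filter_upwards [self_mem_nhdsWithin] with z hz
    exact (hscale z hz).symm
  refine MeasureTheory.tendsto_integral_filter_of_dominated_convergence
    (fun v => Real.exp (-v) * v ^ (b.re - 1)) (Eventually.of_forall fun z => ?_)
    ?_ (Real.GammaIntegral_convergent hb0) ?_
  · exact Measurable.aestronglyMeasurable (by fun_prop)
  · filter_upwards [self_mem_nhdsWithin] with z hz
    filter_upwards [MeasureTheory.ae_restrict_mem measurableSet_Ioi] with v hv
    have hz' : 0 < z := hz
    have hv' : 0 < v := hv
    rw [norm_mul, norm_mul, Complex.norm_cpow_eq_rpow_re_of_pos hv',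
      Complex.norm_cpow_eq_rpow_re_of_pos (by positivity), Complex.norm_exp]
    have e : b.re - 1 = a.re + (b - a - 1).re := by simp; ring
    have : (z + v) ^ (b - a - 1).re ≤ v ^ (b - a - 1).re :=
      Real.rpow_le_rpow_of_nonpos hv' (by linarith) (by simp; linarith)
    rw [e, Real.rpow_add hv', mul_comm (Real.exp _)]
    simp only [Complex.neg_re, Complex.ofReal_re]
    gcongr
  · filter_upwards [MeasureTheory.ae_restrict_mem measurableSet_Ioi] with v hv
    have hv' : (0 : ℝ) < v := hv
    have hv0 : (v : ℂ) ≠ 0 := by exact_mod_cast hv'.ne'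
    have hc : ContinuousAt (fun z : ℝ => (v : ℂ) ^ a * ((z + v : ℝ) : ℂ) ^ (b - a - 1) *
        Complex.exp (-v)) 0 := by
      refine (continuousAt_const.mul (ContinuousAt.cpow (by fun_prop) continuousAt_const ?_)).mul
        continuousAt_const
      left; simpa using hv'
    have h := hc.tendsto.mono_left (nhdsWithin_le_nhds (s := Set.Ioi 0))
    convert h using 2
    rw [zero_add, show b - 1 = a + (b - a - 1) by ring, Complex.cpow_add _ _ hv0]
    push_cast
    ring

/-- The integral representation of `U` for a second parameter in the critical strip. -/
lemma kummerUGeneric_eq_of_strip {a b : ℂ} (ha : 0 < a.re) (hb0 : 0 < b.re) (hb1 : b.re < 1) {z : ℝ}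
    (hz : 0 < z) : kummerUGeneric a b z = (Complex.Gamma a)⁻¹ * tricomiIntegral a b z := by
  have hb := ne_neg_natCast_of_re_pos hb0
  have hb2 := ne_neg_natCast_of_re_pos (a := 2 - b) (by simp; linarith)
  have hb1' : 1 - b ≠ 0 := by
    intro h
    have := congrArg Complex.re h
    simp at this
    linarith
  have hGa := Complex.Gamma_ne_zero_of_re_pos ha
  -- The first coefficient cancels the limit at 0 of the integral, the second that of its weighted
  -- derivative (where Γ(b) = (b-1) Γ(b-1) enters); uniqueness then makes the combination vanish.
  set c₁ := -(Complex.Gamma a * Complex.Gamma (1 - b) / Complex.Gamma (1 - b + a)) with hc₁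
  set c₂ := -Complex.Gamma (b - 1) with hc₂
  have hsys := ((kummerSystem_tricomiIntegral b ha).add
    ((kummerSystem_kummerM a hb).const_mul c₁)).add ((kummerSystem_second a hb2).const_mul c₂)
  have hG : Complex.Gamma b = (b - 1) * Complex.Gamma (b - 1) := by
    have := Complex.Gamma_add_one (b - 1) (by intro h; exact hb1' (by linear_combination -h))
    rwa [sub_add_cancel] at this
  have t0 := tendsto_kummerMDeriv 0 a hb
  have t1 := tendsto_kummerMDeriv 1 a hb
  have w0 := tendsto_kummerMDeriv 0 (a - b + 1) hb2
  have w1 := tendsto_kummerMDeriv 1 (a - b + 1) hb2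
  have tz : Tendsto (fun z : ℝ => (z : ℂ)) (𝓝[>] 0) (𝓝 0) := by
    simpa using tendsto_ofReal_cpow (s := 1) (by simp)
  simp only [poch_zero, div_one] at t0 w0
  have hzero := hsys.eq_zero hb0 hb1 ?_ ?_ hz
  · rw [kummerUGeneric]
    have e : tricomiIntegral a b z = Complex.Gamma a * Complex.Gamma (1 - b) /
        Complex.Gamma (1 - b + a) * kummerM a b z + Complex.Gamma (b - 1) *
          ((z : ℂ) ^ (1 - b) * kummerM (a - b + 1) (2 - b) z) := by
      rw [hc₁, hc₂] at hzero
      linear_combination hzero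
    rw [e]
    field_simp
  · have h := ((tendsto_tricomiIntegral_zero ha hb1).add (t0.const_mul c₁)).add
      (((tendsto_ofReal_cpow (s := 1 - b) (by simp; linarith)).mul w0).const_mul c₂)
    simp only [← kummerM_eq_kummerMDeriv] at h
    convert h using 2
    rw [hc₁]; ring
  · have h := (((tendsto_exp_neg_ofReal.mul (tendsto_cpow_mul_tricomiLaplace ha hb0 hb1)).add
      (((tendsto_exp_neg_ofReal.mul (tendsto_ofReal_cpow hb0)).neg.mul t1).const_mul c₁)).add
      ((tendsto_exp_neg_ofReal.neg.mul ((w0.const_mul (1 - b)).add (tz.mul w1))).const_mul c₂))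
    simp only [← mul_assoc] at h ⊢
    convert h using 2
    rw [hc₂, hG]; ring

/-! ### Analytic continuation in the second parameter -/

lemma differentiable_tricomiIntegral {a : ℂ} (ha : 0 < a.re) {z : ℝ} (hz : 0 < z) :
    Differentiable ℂ fun b => tricomiIntegral a b z := by
  intro b₀
  have hs1 : -1 < (a - 1).re := by simp; linarith
  -- Differentiation in b produces log(1+u) ≤ u, and on the unit ball Re b exceeds Re b₀ by less
  -- than 1; raising both exponents of the kernel by one therefore dominates.
  have key := hasDerivAt_integral_of_dominated_loc_of_deriv_le
    (μ := MeasureTheory.volume.restrict (Set.Ioi (0 : ℝ)))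
    (F := fun b u => tricomiKernel (a - 1) (b - a - 1) z u)
    (F' := fun b u => Complex.log (1 + u) * tricomiKernel (a - 1) (b - a - 1) z u)
    (s := Metric.ball b₀ 1) (x₀ := b₀)
    (bound := fun u => ‖tricomiKernel a (b₀ - a) z u‖)
    (Metric.ball_mem_nhds _ one_pos)
    (Eventually.of_forall fun b => (measurable_tricomiKernel _ _ z).aestronglyMeasurable)
    (integrableOn_tricomiKernel _ hs1 hz)
    (Measurable.aestronglyMeasurable
      (Measurable.mul (by fun_prop) (measurable_tricomiKernel _ _ z)))
    ?_ (integrableOn_tricomiKernel _ (by linarith) hz).norm ?_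
  · exact key.2.differentiableAt
  · filter_upwards [MeasureTheory.ae_restrict_mem measurableSet_Ioi] with u hu b hb
    have hu' : 0 < u := hu
    have h1 : 0 < 1 + u := by positivity
    have hlog : ‖Complex.log (1 + u)‖ ≤ u := by
      have e : (1 + u : ℂ) = ((1 + u : ℝ) : ℂ) := by push_cast; rfl
      rw [e, ← Complex.ofReal_log h1.le, Complex.norm_real, Real.norm_of_nonneg
        (Real.log_nonneg (by linarith))]
      linarith [Real.log_le_sub_one_of_pos h1]
    have hre : (b - a - 1).re ≤ (b₀ - a).re := by
      have := (Complex.re_le_norm (b - b₀)).trans_lt (mem_ball_iff_norm.mp hb)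
      simp only [Complex.sub_re, Complex.one_re] at this ⊢
      linarith
    rw [norm_mul, norm_tricomiKernel _ _ _ hu', norm_tricomiKernel _ _ _ hu']
    have e : a.re = 1 + (a - 1).re := by simp
    rw [e, Real.rpow_add hu', Real.rpow_one]
    have h2 : (1 + u) ^ (b - a - 1).re ≤ (1 + u) ^ (b₀ - a).re :=
      Real.rpow_le_rpow_of_exponent_le (by linarith) hre
    calc _ ≤ u * (u ^ (a - 1).re * (1 + u) ^ (b₀ - a).re * Real.exp (-z * u)) := by gcongr
      _ = _ := by ring
  · filter_upwards [MeasureTheory.ae_restrict_mem measurableSet_Ioi] with u hu b _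
    have hu' : (0 : ℝ) < u := hu
    have h1 : (1 + u : ℂ) ≠ 0 := by
      have : (0 : ℝ) < 1 + u := by positivity
      exact_mod_cast this.ne'
    have d := (((hasDerivAt_id b).sub_const a).sub_const 1).const_cpow (c := (1 + u : ℂ)) (Or.inl h1)
    refine ((d.const_mul ((u : ℂ) ^ (a - 1))).mul_const (Complex.exp (-z * u))).congr_deriv ?_
    simp only [tricomiKernel, id]
    ring

/-- The points -n are zeros of the entire function 1/Γ, so a ball around b₀ avoids them all at once.
-/
lemma exists_forall_norm_add_ge {b₀ : ℂ} (hb : ∀ n : ℕ, b₀ ≠ -(n : ℂ)) :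
    ∃ δ : ℝ, 0 < δ ∧ ∀ b ∈ Metric.ball b₀ δ, ∀ n : ℕ, δ ≤ ‖b + n‖ := by
  have hopen : IsOpen {b : ℂ | (Complex.Gamma b)⁻¹ ≠ 0} :=
    isOpen_ne.preimage Complex.differentiable_one_div_Gamma.continuous
  obtain ⟨ε, hε, hball⟩ := Metric.isOpen_iff.mp hopen b₀ (inv_ne_zero (Complex.Gamma_ne_zero hb))
  refine ⟨ε / 2, half_pos hε, fun b hmem n => ?_⟩
  by_contra hlt
  push Not at hlt
  have hmem' : -(n : ℂ) ∈ Metric.ball b₀ ε := by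
    rw [Metric.mem_ball] at hmem ⊢
    have h1 : dist (-(n : ℂ)) b < ε / 2 := by
      rw [dist_comm, dist_eq_norm, sub_neg_eq_add]; exact hlt
    linarith [dist_triangle (-(n : ℂ)) b b₀]
  exact hball hmem' (by rw [Complex.Gamma_neg_nat_eq_zero, inv_zero])

/-- Consecutive factors (A+n)/(B+n) = 1 + (A-B)/(B+n) are bounded by one constant near b₀, so the
exponential series in C‖z‖ is a majorant and the sum of holomorphic terms is holomorphic. -/
lemma differentiableAt_kummerM {A B : ℂ → ℂ} (hA : Differentiable ℂ A) (hB : Differentiable ℂ B)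
    {b₀ : ℂ} (hb : ∀ n : ℕ, B b₀ ≠ -(n : ℂ)) (z : ℂ) :
    DifferentiableAt ℂ (fun b => kummerM (A b) (B b) z) b₀ := by
  obtain ⟨δ, hδ, hge⟩ := exists_forall_norm_add_ge hb
  set s : Set ℂ := A ⁻¹' Metric.ball (A b₀) 1 ∩ B ⁻¹' Metric.ball (B b₀) δ with hs
  have hopen : IsOpen s := (Metric.isOpen_ball.preimage hA.continuous).inter
    (Metric.isOpen_ball.preimage hB.continuous)
  have hmem : b₀ ∈ s := ⟨Metric.mem_ball_self one_pos, Metric.mem_ball_self hδ⟩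
  set C := 1 + (‖A b₀‖ + 1 + ‖B b₀‖ + δ) / δ with hC
  have hpochdiff : ∀ (f : ℂ → ℂ), Differentiable ℂ f → ∀ n, Differentiable ℂ fun b => poch (f b) n := by
    intro f hf n
    induction n with
    | zero => simp
    | succ n ih => simp only [poch_succ]; exact ih.mul (hf.add_const _)
  have hratio : ∀ b ∈ s, ∀ n : ℕ, ‖poch (A b) n / poch (B b) n‖ ≤ C ^ n := by
    intro b hbs n
    induction n with
    | zero => simp
    | succ n ih =>
      rw [poch_succ, poch_succ, mul_div_mul_comm, norm_mul, pow_succ]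
      gcongr
      have hn : δ ≤ ‖B b + n‖ := hge (B b) hbs.2 n
      have hne : B b + n ≠ 0 := norm_pos_iff.mp (hδ.trans_le hn)
      have e : (A b + n) / (B b + n) = 1 + (A b - B b) / (B b + n) := by field_simp; ring
      have h1 : ‖A b‖ ≤ ‖A b₀‖ + 1 := by
        have := norm_sub_norm_le (A b) (A b₀)
        have := mem_ball_iff_norm.mp hbs.1
        linarith
      have h2 : ‖B b‖ ≤ ‖B b₀‖ + δ := by
        have := norm_sub_norm_le (B b) (B b₀)
        have := mem_ball_iff_norm.mp hbs.2
        linarith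
      rw [e, hC]
      refine (norm_add_le _ _).trans ?_
      rw [norm_one, norm_div]
      gcongr
      exact (norm_sub_le _ _).trans (by linarith)
  have hdiff := Complex.differentiableOn_tsum_of_summable_norm
    (u := fun n : ℕ => (C * ‖z‖) ^ n / n.factorial) (Real.summable_pow_div_factorial _)
    (F := fun n b => poch (A b) n / poch (B b) n * (z ^ n / n.factorial)) (U := s)
    (fun n b hbs => ?_) hopen (fun n b hbs => ?_)
  · simp only [← kummerM_eq_tsum] at hdiff
    exact hdiff.differentiableAt (hopen.mem_nhds hmem)
  · have hne : poch (B b) n ≠ 0 := poch_ne_zero (fun k h => by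
      have := hge (B b) hbs.2 k
      rw [h] at this
      simp at this
      linarith) n
    exact (((hpochdiff A hA n b).div (hpochdiff B hB n b) hne).mul_const _).differentiableWithinAt
  · rw [norm_mul, norm_div (z ^ n), norm_pow, Complex.norm_natCast, mul_pow, mul_div_assoc]
    gcongr
    exact hratio b hbs n

lemma differentiableAt_kummerUGeneric (a : ℂ) {b : ℂ} (hb : ∀ n : ℤ, b ≠ n) {z : ℝ} (hz : 0 < z) :
    DifferentiableAt ℂ (fun b => kummerUGeneric a b z) b := by
  have hz0 : (z : ℂ) ≠ 0 := by exact_mod_cast hz.ne'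
  have h1 : ∀ n : ℕ, b ≠ -(n : ℂ) := fun n h => hb (-n) (by simpa using h)
  have h2 : ∀ n : ℕ, 2 - b ≠ -(n : ℂ) := fun n h => hb (n + 2) (by
    push_cast; linear_combination -h)
  have g1 : DifferentiableAt ℂ (fun b => Complex.Gamma (1 - b)) b :=
    (Complex.differentiableAt_Gamma (1 - b) fun n h => hb (n + 1) (by
      push_cast; linear_combination -h)).comp b (by fun_prop)
  have g2 : DifferentiableAt ℂ (fun b => Complex.Gamma (b - 1)) b :=
    (Complex.differentiableAt_Gamma (b - 1) fun n h => hb (-n + 1) (by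
      push_cast; linear_combination h)).comp b (by fun_prop)
  have g3 : DifferentiableAt ℂ (fun b => (Complex.Gamma (1 - b + a))⁻¹) b :=
    DifferentiableAt.comp (g := fun s => (Complex.Gamma s)⁻¹) (f := fun b => 1 - b + a) b
      (Complex.differentiable_one_div_Gamma (1 - b + a)) (by fun_prop)
  have m1 := differentiableAt_kummerM (A := fun _ => a) (B := fun b => b) (by fun_prop)
    (by fun_prop) h1 z
  have m2 := differentiableAt_kummerM (A := fun b => a - b + 1) (B := fun b => 2 - b) (by fun_prop)
    (by fun_prop) h2 z
  have p : DifferentiableAt ℂ (fun b => (z : ℂ) ^ (1 - b)) b :=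
    DifferentiableAt.const_cpow (by fun_prop) (Or.inl hz0)
  simp only [kummerUGeneric, div_eq_mul_inv]
  exact ((g1.mul g3).mul m1).add (((g2.mul_const _).mul p).mul m2)

/-- The integral representation of `U`. -/
lemma kummerUGeneric_eq_tricomiIntegral {a b : ℂ} (ha : 0 < a.re) (hb : ∀ n : ℤ, b ≠ n) {z : ℝ}
    (hz : 0 < z) : kummerUGeneric a b z = (Complex.Gamma a)⁻¹ * tricomiIntegral a b z := by
  set s : Set ℂ := (Set.range fun n : ℤ => (n : ℂ))ᶜ with hs
  have hmem : ∀ b, b ∈ s ↔ ∀ n : ℤ, b ≠ n := by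
    intro b
    simp only [hs, Set.mem_compl_iff, Set.mem_range, not_exists]
    exact forall_congr' fun n => ne_comm
  have hopen : IsOpen s := by
    rw [hs, isOpen_compl_iff]
    exact Complex.isClosedEmbedding_intCast.isClosed_range
  -- Removing a countable set leaves the plane connected, so agreement near 1/2, which lies in the
  -- strip, propagates.
  have hconn : IsPreconnected s :=
    ((Set.countable_range _).isConnected_compl_of_one_lt_rank (by simp)).isPreconnected
  have hf : AnalyticOnNhd ℂ (fun b => kummerUGeneric a b z) s :=
    DifferentiableOn.analyticOnNhd (fun b hbs =>
      (differentiableAt_kummerUGeneric a ((hmem b).mp hbs) hz).differentiableWithinAt) hopen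
  have hg : AnalyticOnNhd ℂ (fun b => (Complex.Gamma a)⁻¹ * tricomiIntegral a b z) s :=
    DifferentiableOn.analyticOnNhd
      ((differentiable_tricomiIntegral ha hz).const_mul _).differentiableOn hopen
  have hhalf : (1 / 2 : ℂ) ∈ s := by
    rw [hmem]
    intro n h
    have h2 : ((1 : ℤ) : ℂ) = ((2 * n : ℤ) : ℂ) := by push_cast; linear_combination 2 * h
    have := Int.cast_injective h2
    omega
  have hev : (fun b => kummerUGeneric a b z) =ᶠ[𝓝 (1 / 2 : ℂ)]
      fun b => (Complex.Gamma a)⁻¹ * tricomiIntegral a b z := by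
    have hre : (1 / 2 : ℂ).re = 1 / 2 := by
      rw [show (1 / 2 : ℂ) = ((1 / 2 : ℝ) : ℂ) by push_cast; rfl, Complex.ofReal_re]
    have o1 : ∀ᶠ b : ℂ in 𝓝 (1 / 2 : ℂ), 0 < b.re :=
      continuousAt_const.eventually_lt Complex.continuous_re.continuousAt (by rw [hre]; norm_num)
    have o2 : ∀ᶠ b : ℂ in 𝓝 (1 / 2 : ℂ), b.re < 1 :=
      Complex.continuous_re.continuousAt.eventually_lt continuousAt_const (by rw [hre]; norm_num)
    filter_upwards [o1, o2] with b hb0 hb1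
    exact kummerUGeneric_eq_of_strip ha hb0 hb1 hz
  exact hf.eqOn_of_preconnected_of_eventuallyEq hg hconn hhalf hev ((hmem b).mpr hb)

/-! ### Recurrences in α and a, and removal of the restrictions -/

/-- A nonzero limit would force the harmonic series to converge. This disposes of the boundary terms
of telescoping sums with no pointwise bound on Laguerre polynomials, only summability. -/
lemma eq_zero_of_tendsto_of_summable_div {H : ℕ → ℂ} {l : ℂ} (h : Tendsto H atTop (𝓝 l))
    (hs : Summable fun n : ℕ => ‖H n‖ / ((n : ℝ) + 1)) : l = 0 := by
  by_contra hl
  have hl0 : 0 < ‖l‖ := norm_pos_iff.mpr hl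
  have hev : ∀ᶠ n in atTop, ‖l‖ / 2 < ‖H n‖ := h.norm.eventually_const_lt (by linarith)
  have hsum : Summable fun n : ℕ => 1 / ((n : ℝ) + 1) := by
    refine Summable.of_norm_bounded_eventually_nat (hs.mul_left (2 / ‖l‖)) ?_
    filter_upwards [hev] with n hn
    rw [Real.norm_of_nonneg (by positivity), mul_div_assoc']
    gcongr
    rw [div_mul_eq_mul_div, le_div_iff₀ hl0]
    linarith
  have h2 : Summable fun n : ℕ => 1 / (n : ℝ) := by
    rw [← summable_nat_add_iff 1]
    simpa using hsum
  exact Real.not_summable_one_div_natCast h2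

lemma rpow_le_succ_rpow (ρ : ℝ) (n : ℕ) :
    ((n : ℝ) + 1) ^ ρ ≤ 2 ^ |ρ| * (((n + 1 : ℕ) : ℝ) + 1) ^ ρ := by
  have h := succ_rpow_le (-ρ) n
  rw [abs_neg, Real.rpow_neg (by positivity), Real.rpow_neg (by positivity)] at h
  have h1 : 0 < ((n : ℝ) + 1) ^ ρ := by positivity
  have h2 : 0 < (((n + 1 : ℕ) : ℝ) + 1) ^ ρ := by positivity
  rw [← div_eq_mul_inv, le_div_iff₀ h1, inv_mul_le_iff₀ h2] at h
  linarith

/-- Raising the parameter `α` in the Laguerre series of `U`. -/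
lemma tsum_laguerreL_shift {a c α : ℂ} {z : ℝ} (hz : 0 < z)
    (hc : α.re / 2 + 3 / 4 < c.re) (hca : ∀ n : ℕ, c + a ≠ -(n : ℂ)) :
    (c + a) * ∑' i : ℕ, laguerreL i α z * (poch a i / poch (c + a) i) =
      c * ∑' i : ℕ, laguerreL i (α + 1) z * (poch a i / poch (c + 1 + a) i) := by
  have hca1 : ∀ n : ℕ, c + 1 + a ≠ -(n : ℂ) := fun n h => hca (n + 1) (by
    push_cast; linear_combination h)
  have s0 := summable_laguerreL_mul_poch α a hz hc hca
  have s1 := summable_laguerreL_mul_poch (α + 1) a (c := c + 1) hz (by simp; linarith) hca1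
  have hx : c + a ≠ 0 := by simpa using hca 0
  have hp1 : ∀ n, poch (c + a) (n + 1) = (c + a) * poch (c + 1 + a) n := fun n => by
    rw [poch_succ_left, add_right_comm]
  -- Summation by parts: L_n^(α) is the difference of consecutive L^(α+1), and H is the boundary
  -- term that this leaves.
  set H : ℕ → ℂ := fun n => (c + a) * (laguerreL n (α + 1) z *
    (poch a (n + 1) / poch (c + a) (n + 1))) with hH
  have hsum : ∀ N : ℕ, ∑ i ∈ Finset.range (N + 1),
      ((c + a) * (laguerreL i α z * (poch a i / poch (c + a) i)) -
        c * (laguerreL i (α + 1) z * (poch a i / poch (c + 1 + a) i))) = H N := by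
    have hstep : ∀ n : ℕ, (c + a) * (poch a n / poch (c + a) n) -
        c * (poch a n / poch (c + 1 + a) n) = (c + a) * (poch a (n + 1) / poch (c + a) (n + 1)) := by
      intro n
      have n1 := poch_ne_zero hca n
      have n2 : c + a + n ≠ 0 := fun h => hca n (eq_neg_of_add_eq_zero_left h)
      have e : poch (c + 1 + a) n = poch (c + a) n * (c + a + n) / (c + a) := by
        rw [eq_div_iff hx, mul_comm, ← hp1, poch_succ]
      rw [e, poch_succ, poch_succ]
      field_simp
      ring
    intro N
    induction N with
    | zero =>
      have := hstep 0
      simp only [zero_add, Finset.range_one, Finset.sum_singleton, laguerreL_zero, hH, one_mul]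
      exact this
    | succ N ih =>
      rw [Finset.sum_range_succ, ih, laguerreL_succ_eq_sub]
      simp only [hH]
      linear_combination laguerreL (N + 1) (α + 1) z * hstep (N + 1)
  have hlim := ((s0.mul_left (c + a)).sub (s1.mul_left c)).hasSum.tendsto_sum_nat
  rw [← tendsto_add_atTop_iff_nat 1] at hlim
  simp only [hsum] at hlim
  rw [(s0.mul_left (c + a)).tsum_sub (s1.mul_left c), tsum_mul_left, tsum_mul_left] at hlim
  refine sub_eq_zero.mp (eq_zero_of_tendsto_of_summable_div hlim ?_)
  refine Summable.of_nonneg_of_le (fun n => by positivity) (fun n => ?_)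
    (s1.norm.mul_left (‖a‖ + 1))
  -- H n is a + n times the n-th term of the raised series, so H n / (n+1) is summable.
  have e : H n = (a + n) * (laguerreL n (α + 1) z * (poch a n / poch (c + 1 + a) n)) := by
    simp only [hH]
    rw [hp1, poch_succ]
    have := poch_ne_zero hca1 n
    field_simp
  rw [e, norm_mul, div_le_iff₀ (by positivity), mul_right_comm]
  gcongr
  refine (norm_add_le _ _).trans ?_
  rw [Complex.norm_natCast]
  nlinarith [norm_nonneg a, (Nat.cast_nonneg n : (0 : ℝ) ≤ n)]

/-- The recurrence in `a` of the Laguerre series of `U`. -/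
lemma tsum_laguerreL_recurrence {a c α : ℂ} {z : ℝ} (hz : 0 < z)
    (hc : α.re / 2 + 3 / 4 < c.re) (hca : ∀ n : ℕ, c + a - 1 ≠ -(n : ℂ)) :
    (c + a) * (c + a - 1) * ∑' i : ℕ, laguerreL i α z * (poch (a - 1) i / poch (c + (a - 1)) i) +
      (c + a) * (2 + α - c - 2 * a - z) * ∑' i : ℕ, laguerreL i α z * (poch a i / poch (c + a) i) +
      a * (a + c - 1 - α) * ∑' i : ℕ, laguerreL i α z * (poch (a + 1) i / poch (c + (a + 1)) i) = 0 := by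
  have hc0 : ∀ n : ℕ, c + (a - 1) ≠ -(n : ℂ) := fun n h => hca n (by linear_combination h)
  have hc1 : ∀ n : ℕ, c + a ≠ -(n : ℂ) := fun n h => hca (n + 1) (by
    push_cast; linear_combination h)
  have hc2 : ∀ n : ℕ, c + (a + 1) ≠ -(n : ℂ) := fun n h => hca (n + 2) (by
    push_cast; linear_combination h)
  have s0 := summable_laguerreL_mul_poch α (a - 1) hz hc hc0
  have s1 := summable_laguerreL_mul_poch α a hz hc hc1
  have s2 := summable_laguerreL_mul_poch α (a + 1) hz hc hc2
  set x := c + a with hx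
  have hx1 : c + (a - 1) = x - 1 := by rw [hx]; ring
  have hx2 : c + (a + 1) = x + 1 := by rw [hx]; ring
  have hcx : c = x - a := by rw [hx]; ring
  rw [hx1] at hc0 s0 ⊢
  rw [hx2] at hc2 s2 ⊢
  set T : ℕ → ℂ := fun n => poch a n / poch x n with hT
  -- Closed form of the partial sums: its increment is the next term, by the three-term recurrence
  -- of the Laguerre polynomials and an identity between the coefficients.
  set H : ℕ → ℂ := fun n => x * (((n : ℂ) + 1) * (laguerreL (n + 1) α z * T n) -
    (n + 1 + α) * (laguerreL n α z * T (n + 1))) with hH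
  have hx0 : x ≠ 0 := by simpa using hc1 0
  have hx10 : x - 1 ≠ 0 := by simpa using hc0 0
  set term : ℕ → ℂ := fun i => x * (x - 1) * (laguerreL i α z * (poch (a - 1) i / poch (x - 1) i)) +
    x * (2 + α - c - 2 * a - z) * (laguerreL i α z * T i) +
    a * (a + c - 1 - α) * (laguerreL i α z * (poch (a + 1) i / poch (x + 1) i)) with hterm
  have hsum : ∀ N : ℕ, ∑ i ∈ Finset.range (N + 1), term i = H N := by
    have hcoef : ∀ n : ℕ, x * (x - 1) * (poch (a - 1) (n + 1) / poch (x - 1) (n + 1)) +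
        x * (2 + α - c - 2 * a) * T (n + 1) +
        a * (a + c - 1 - α) * (poch (a + 1) (n + 1) / poch (x + 1) (n + 1)) -
        x * (2 * (n + 1) + 1 + α) * T (n + 1) + x * (n + 1) * T n + x * (n + 2 + α) * T (n + 2) = 0 := by
      intro n
      have n1 := poch_ne_zero hc1 n
      have n2 : x + n ≠ 0 := fun h => hc1 n (eq_neg_of_add_eq_zero_left h)
      have n3 : x + (n + 1 : ℂ) ≠ 0 := fun h => hc1 (n + 1) (by push_cast; linear_combination h)
      have e1 : poch (x - 1) (n + 1) = (x - 1) * poch x n := by rw [poch_succ_left, sub_add_cancel]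
      have e2 : poch (a - 1) (n + 1) = (a - 1) * poch a n := by rw [poch_succ_left, sub_add_cancel]
      have e3 : poch (x + 1) (n + 1) = poch x (n + 2) / x := by
        rw [eq_div_iff hx0, mul_comm, ← poch_succ_left]
      have e4 : a * poch (a + 1) (n + 1) = poch a (n + 2) := by rw [← poch_succ_left]
      have e5 : a * (a + c - 1 - α) * (poch (a + 1) (n + 1) / poch (x + 1) (n + 1)) =
          (a + c - 1 - α) * (x * poch a (n + 2) / poch x (n + 2)) := by
        rw [e3, ← e4, div_div_eq_mul_div]; ring
      simp only [hT]
      rw [e5, e1, e2, poch_succ a (n + 1), poch_succ x (n + 1), poch_succ a n, poch_succ x n, hcx]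
      push_cast
      field_simp
      ring
    intro N
    induction N with
    | zero =>
      simp only [zero_add, Finset.range_one, Finset.sum_singleton, hterm, hH, laguerreL_zero,
        laguerreL_one, hT, poch_zero, Nat.cast_zero, poch_succ_left a 0, poch_succ_left x 0]
      rw [hcx]
      field_simp
      ring
    | succ N ih =>
      rw [Finset.sum_range_succ, ih]
      have h3 := laguerreL_three_term N α z
      have hc' := hcoef N
      simp only [hterm, hH]
      push_cast
      linear_combination laguerreL (N + 1) α z * hc' - x * T (N + 1) * h3
  have hlim := (((s0.mul_left (x * (x - 1))).add
    (s1.mul_left (x * (2 + α - c - 2 * a - z)))).add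
      (s2.mul_left (a * (a + c - 1 - α)))).hasSum.tendsto_sum_nat
  rw [← tendsto_add_atTop_iff_nat 1] at hlim
  have hsum' : ∀ N : ℕ, _ = H N := hsum
  simp only [hterm, hT] at hsum'
  simp only [hsum'] at hlim
  rw [((s0.mul_left _).add (s1.mul_left _)).tsum_add (s2.mul_left _),
    (s0.mul_left _).tsum_add (s1.mul_left _), tsum_mul_left, tsum_mul_left, tsum_mul_left] at hlim
  refine eq_zero_of_tendsto_of_summable_div hlim ?_
  obtain ⟨K, hK, hb⟩ := exists_norm_poch_div_poch_le a hc1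
  have hre : (a - x).re = -c.re := by rw [hx]; simp
  rw [hre] at hb
  have sL := summable_norm_laguerreL α hz hc
  have sL1 := (summable_nat_add_iff 1).mpr sL
  refine Summable.of_nonneg_of_le (fun n => by positivity) (fun n => ?_)
    ((sL1.mul_left (‖x‖ * (K * 2 ^ |-c.re|))).add
      (sL.mul_left (‖x‖ * ((1 + ‖α‖) * (K * 2 ^ |-c.re|)))))
  have hn : (0 : ℝ) < (n : ℝ) + 1 := by positivity
  have t1 : ‖T n‖ ≤ K * (2 ^ |-c.re| * (((n + 1 : ℕ) : ℝ) + 1) ^ (-c.re)) :=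
    (hb n).trans (by gcongr; exact rpow_le_succ_rpow _ n)
  have t2 : ‖T (n + 1)‖ ≤ K * (2 ^ |-c.re| * ((n : ℝ) + 1) ^ (-c.re)) :=
    (hb (n + 1)).trans (by gcongr; exact succ_rpow_le _ n)
  have nn : ‖(n : ℂ) + 1‖ = (n : ℝ) + 1 := by
    rw [show ((n : ℂ) + 1) = ((n + 1 : ℕ) : ℂ) by push_cast; rfl, Complex.norm_natCast]
    push_cast; rfl
  have na : ‖(n : ℂ) + 1 + α‖ ≤ ((n : ℝ) + 1) * (1 + ‖α‖) := by
    refine (norm_add_le _ _).trans ?_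
    rw [nn]
    nlinarith [norm_nonneg α, (Nat.cast_nonneg n : (0 : ℝ) ≤ n)]
  rw [div_le_iff₀ hn]
  calc ‖H n‖ ≤ ‖x‖ * (((n : ℝ) + 1) * (‖laguerreL (n + 1) α z‖ * ‖T n‖) +
        ‖(n : ℂ) + 1 + α‖ * (‖laguerreL n α z‖ * ‖T (n + 1)‖)) := by
        simp only [hH]
        rw [norm_mul]
        gcongr
        refine (norm_sub_le _ _).trans ?_
        rw [norm_mul, norm_mul, norm_mul, norm_mul, nn]
    _ ≤ ‖x‖ * (((n : ℝ) + 1) * (‖laguerreL (n + 1) α z‖ *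
          (K * (2 ^ |-c.re| * (((n + 1 : ℕ) : ℝ) + 1) ^ (-c.re)))) +
        ((n : ℝ) + 1) * (1 + ‖α‖) * (‖laguerreL n α z‖ *
          (K * (2 ^ |-c.re| * ((n : ℝ) + 1) ^ (-c.re))))) := by gcongr
    _ = _ := by ring

/-- The contiguous relation of `M` in its first parameter. -/
lemma kummerM_contiguous (a : ℂ) {b : ℂ} (hb : ∀ n : ℕ, b ≠ -(n : ℂ)) (z : ℂ) :
    (b - a) * kummerM (a - 1) b z + (2 * a - b + z) * kummerM a b z - a * kummerM (a + 1) b z = 0 := by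
  -- Multiplication by z shifts the coefficients. At n = 0 the truncated n - 1 is harmless, as that
  -- coefficient is multiplied by n.
  have hz := EntireCoeff.mul_tsum (c := fun n => poch a (n - 1) / poch b (n - 1))
    (by simpa using entireCoeff_poch a hb) z
  have s0 := (entireCoeff_poch (a - 1) hb).summable z
  have s1 := (entireCoeff_poch a hb).summable z
  have s2 := (entireCoeff_poch (a + 1) hb).summable z
  simp only [Nat.add_sub_cancel] at hz
  rw [add_mul (2 * a - b), kummerM_eq_tsum, kummerM_eq_tsum, kummerM_eq_tsum, hz.1,
    ← tsum_mul_left, ← tsum_mul_left, ← tsum_mul_left, ← (s1.mul_left _).tsum_add hz.2,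
    ← (s0.mul_left _).tsum_add ((s1.mul_left _).add hz.2),
    ← ((s0.mul_left _).add ((s1.mul_left _).add hz.2)).tsum_sub (s2.mul_left _)]
  refine (tsum_congr fun n => ?_).trans tsum_zero
  rcases n with _ | n
  · simp; ring
  · have n1 := poch_ne_zero hb n
    have n2 : b + n ≠ 0 := fun h => hb n (eq_neg_of_add_eq_zero_left h)
    have e1 : poch (a - 1) (n + 1) = (a - 1) * poch a n := by rw [poch_succ_left, sub_add_cancel]
    have e2 : a * poch (a + 1) (n + 1) = poch a n * (a + n) * (a + (n + 1)) := by
      rw [← poch_succ_left, poch_succ, poch_succ]; push_cast; ring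
    have e3 : a * (poch (a + 1) (n + 1) / poch b (n + 1) * (z ^ (n + 1) / (n + 1).factorial)) =
        poch a n * (a + n) * (a + (n + 1)) / poch b (n + 1) * (z ^ (n + 1) / (n + 1).factorial) := by
      rw [← e2]; ring
    rw [e3, e1, Nat.add_sub_cancel, poch_succ, poch_succ]
    have h2 := factorial_ne_zero' (n + 1)
    push_cast
    field_simp
    ring

/-- The recurrence of `U` in its first parameter. -/
lemma kummerUGeneric_recurrence (a : ℂ) {b : ℂ} (hb : ∀ n : ℤ, b ≠ n) (z : ℂ) :
    kummerUGeneric (a - 1) b z + (b - 2 * a - z) * kummerUGeneric a b z +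
      a * (1 + a - b) * kummerUGeneric (a + 1) b z = 0 := by
  have h1 : ∀ n : ℕ, b ≠ -(n : ℂ) := fun n h => hb (-n) (by simpa using h)
  have h2 : ∀ n : ℕ, 2 - b ≠ -(n : ℂ) := fun n h => hb (n + 2) (by
    push_cast; linear_combination -h)
  have m1 := kummerM_contiguous a h1 z
  have m2 := kummerM_contiguous (a - b + 1) h2 z
  -- The functional equation for 1/Γ holds at the poles too, so no value of a has to be excluded.
  have g1 := Complex.one_div_Gamma_eq_self_mul_one_div_Gamma_add_one (a - b)
  have g2 := Complex.one_div_Gamma_eq_self_mul_one_div_Gamma_add_one (1 - b + a)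
  have g3 := Complex.one_div_Gamma_eq_self_mul_one_div_Gamma_add_one (a - 1)
  have g4 := Complex.one_div_Gamma_eq_self_mul_one_div_Gamma_add_one a
  rw [show a - b + 1 = 1 - b + a by ring] at g1
  rw [sub_add_cancel] at g3
  simp only [kummerUGeneric, div_eq_mul_inv]
  rw [show 1 - b + (a - 1) = a - b by ring, show 1 - b + (a + 1) = 1 - b + a + 1 by ring,
    show a - 1 - b + 1 = a - b + 1 - 1 by ring, show a + 1 - b + 1 = a - b + 1 + 1 by ring, g1, g3]
  linear_combination -(Complex.Gamma (1 - b) * (Complex.Gamma (1 - b + a))⁻¹) * m1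
    - (Complex.Gamma (b - 1) * (Complex.Gamma a)⁻¹ * z ^ (1 - b)) * m2
    - (Complex.Gamma (1 - b) * a * kummerM (a + 1) b z) * g2
    - (Complex.Gamma (b - 1) * z ^ (1 - b) * (1 + a - b) * kummerM (a - b + 1 + 1) (2 - b) z) * g4

/-- The right-hand side does not involve α, so α may be raised until Re(2+α-b) > 0, where termwise
integration applies. Each step adds 1/2 to the left of `hcond` and 1 to its right. -/
lemma laguerreL_series_eq_tricomiIntegral {a b α : ℂ} {z : ℝ} (hz : 0 < z) (ha : 0 < a.re)
    (hcond : α.re / 2 + 3 / 4 < (2 + α - b).re) (hc : ∀ n : ℕ, 2 + α - b ≠ -(n : ℂ))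
    (hca : ∀ n : ℕ, 2 + α - b + a ≠ -(n : ℂ)) :
    Complex.Gamma (2 + α - b) / Complex.Gamma (2 + α - b + a) *
      ∑' i : ℕ, laguerreL i α z * (poch a i / poch (2 + α - b + a) i) =
        (Complex.Gamma a)⁻¹ * tricomiIntegral a b z := by
  obtain ⟨k, hk⟩ := exists_nat_gt (-(2 + α - b).re)
  induction k generalizing α with
  | zero =>
    have hc0 : 0 < (2 + α - b).re := by simpa using hk
    rw [(hasSum_laguerreL_mul_poch hz ha hc0 hcond).tsum_eq]
    have n1 := Complex.Gamma_ne_zero_of_re_pos ha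
    have n2 := Complex.Gamma_ne_zero hc
    have n3 := Complex.Gamma_ne_zero hca
    field_simp
  | succ k ih =>
    have hre : (2 + (α + 1) - b).re = (2 + α - b).re + 1 := by simp; ring
    have e : 2 + (α + 1) - b = 2 + α - b + 1 := by ring
    push_cast at hk
    have := ih (α := α + 1) (by rw [hre]; simp only [Complex.add_re, Complex.one_re]; linarith)
      (fun n h => hc (n + 1) (by push_cast; linear_combination h))
      (fun n h => hca (n + 1) (by push_cast; linear_combination h)) (by rw [hre]; linarith)
    rw [← this, e]
    have hshift := tsum_laguerreL_shift hz hcond hca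
    have hx : 2 + α - b + a ≠ 0 := by simpa using hca 0
    have hc0 : 2 + α - b ≠ 0 := by simpa using hc 0
    have n3 := Complex.Gamma_ne_zero hca
    rw [add_right_comm _ 1 a] at hshift ⊢
    rw [Complex.Gamma_add_one _ hc0, Complex.Gamma_add_one _ hx]
    set S := ∑' i : ℕ, laguerreL i α z * (poch a i / poch (2 + α - b + a) i)
    set S' := ∑' i : ℕ, laguerreL i (α + 1) z * (poch a i / poch (2 + α - b + a + 1) i)
    field_simp
    linear_combination (Complex.Gamma (2 + α - b)) * hshift

/-- The filter is left general to cover both cases of the definition of `U`: the punctured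
neighbourhood of an integer b, and the point b itself otherwise. For Re a > 0 the integral is
continuous in b; smaller Re a is reached by the recurrence, which determines the value at a from
those at a + 1 and a + 2 on both sides. -/
lemma tendsto_kummerUGeneric {b α : ℂ} {z : ℝ} (hz : 0 < z)
    (hcond : α.re / 2 + 3 / 4 < (2 + α - b).re) (hc : ∀ n : ℕ, 2 + α - b ≠ -(n : ℂ))
    {F : Filter ℂ} (hF : F ≤ 𝓝 b) (hZ : ∀ᶠ b' : ℂ in F, ∀ n : ℤ, b' ≠ n) {a : ℂ}
    (hca : ∀ n : ℕ, 2 + α - b + a ≠ -(n : ℂ)) :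
    Tendsto (fun b' => kummerUGeneric a b' z) F
      (𝓝 (Complex.Gamma (2 + α - b) / Complex.Gamma (2 + α - b + a) *
        ∑' i : ℕ, laguerreL i α z * (poch a i / poch (2 + α - b + a) i))) := by
  obtain ⟨k, hk⟩ := exists_nat_gt (-a.re)
  suffices h : ∀ (k : ℕ) (a : ℂ), (∀ n : ℕ, 2 + α - b + a ≠ -(n : ℂ)) → -a.re < k →
      Tendsto (fun b' => kummerUGeneric a b' z) F
      (𝓝 (Complex.Gamma (2 + α - b) / Complex.Gamma (2 + α - b + a) *
        ∑' i : ℕ, laguerreL i α z * (poch a i / poch (2 + α - b + a) i))) from h k a hca hk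
  clear hk hca k a
  intro k
  induction k with
  | zero =>
    intro a hca hk
    have ha : 0 < a.re := by simpa using hk
    rw [laguerreL_series_eq_tricomiIntegral hz ha hcond hc hca]
    refine Tendsto.congr' (f₁ := fun b' => (Complex.Gamma a)⁻¹ * tricomiIntegral a b' z) ?_ ?_
    · filter_upwards [hZ] with b' hb'
      exact (kummerUGeneric_eq_tricomiIntegral ha hb' hz).symm
    · exact (((differentiable_tricomiIntegral ha hz).continuous.tendsto b).mono_left hF).const_mul _
  | succ k ih =>
    intro a hca hk
    push_cast at hk
    have hca1 : ∀ n : ℕ, 2 + α - b + (a + 1) ≠ -(n : ℂ) := fun n h =>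
      hca (n + 1) (by push_cast; linear_combination h)
    have hca2 : ∀ n : ℕ, 2 + α - b + (a + 1 + 1) ≠ -(n : ℂ) := fun n h =>
      hca (n + 2) (by push_cast; linear_combination h)
    have t1 := ih (a + 1) hca1 (by simp; linarith)
    have t2 := ih (a + 1 + 1) hca2 (by simp; linarith)
    have tb : Tendsto (fun b' : ℂ => b') F (𝓝 b) := hF
    have ht := ((((tb.sub_const (2 * (a + 1))).sub_const (z : ℂ)).mul t1).add
      (((tendsto_const_nhds (x := 1 + (a + 1))).sub tb).const_mul (a + 1) |>.mul t2)).neg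
    refine Tendsto.congr' ?_ (ht.trans (le_of_eq (congrArg 𝓝 ?_)))
    · filter_upwards [hZ] with b' hb'
      have := kummerUGeneric_recurrence (a + 1) hb' z
      rw [add_sub_cancel_right] at this
      linear_combination -this
    · have hrec := tsum_laguerreL_recurrence (a := a + 1) hz hcond
        (fun n h => hca n (by linear_combination h))
      rw [add_sub_cancel_right] at hrec
      set S₀ := ∑' i : ℕ, laguerreL i α z * (poch a i / poch (2 + α - b + a) i)
      set S₁ := ∑' i : ℕ, laguerreL i α z * (poch (a + 1) i / poch (2 + α - b + (a + 1)) i)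
      set S₂ := ∑' i : ℕ, laguerreL i α z * (poch (a + 1 + 1) i / poch (2 + α - b + (a + 1 + 1)) i)
      have hx : 2 + α - b + a ≠ 0 := by simpa using hca 0
      have hx1 : 2 + α - b + a + 1 ≠ 0 := by simpa [add_assoc] using hca1 0
      have n3 := Complex.Gamma_ne_zero hca
      rw [← add_assoc _ (a + 1) 1, ← add_assoc _ a 1, Complex.Gamma_add_one _ hx1,
        Complex.Gamma_add_one _ hx]
      field_simp
      linear_combination -(Complex.Gamma (2 + α - b)) * hrec

/-- The Laguerre expansion of `U`. -/
lemma kummerU_eq_laguerreL_series {a b α : ℂ} {z : ℝ} (hz : 0 < z)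
    (hcond : α.re / 2 + 3 / 4 < (2 + α - b).re) (hc : ∀ n : ℕ, 2 + α - b ≠ -(n : ℂ))
    (hca : ∀ n : ℕ, 2 + α - b + a ≠ -(n : ℂ)) :
    kummerU a b z = Complex.Gamma (2 + α - b) / Complex.Gamma (2 + α - b + a) *
      ∑' i : ℕ, laguerreL i α z * (poch a i / poch (2 + α - b + a) i) := by
  rw [kummerU]
  split_ifs with hb
  · refine Tendsto.limUnder_eq (tendsto_kummerUGeneric hz hcond hc nhdsWithin_le_nhds ?_ hca)
    obtain ⟨m, rfl⟩ := hb
    rw [eventually_nhdsWithin_iff]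
    -- The unit ball around an integer contains no other integer.
    filter_upwards [Metric.ball_mem_nhds (m : ℂ) one_pos] with b' hb' hne n hn
    rw [hn, Metric.mem_ball, Complex.dist_eq, ← Int.cast_sub, Complex.norm_intCast,
      ← Int.cast_abs] at hb'
    have h1 : |n - m| < 1 := by exact_mod_cast hb'
    have h2 : n = m := by rw [Int.abs_lt_one_iff] at h1; omega
    exact hne (by rw [hn, h2]; rfl)
  · push Not at hb
    have h := tendsto_kummerUGeneric hz hcond hc (F := pure b) (pure_le_nhds b)
      (by simpa using hb) hca
    exact tendsto_nhds_unique (tendsto_pure_nhds _ b) h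

/-! ### The incomplete Gamma function and conclusion -/

/-- The incomplete Gamma function as a value of Tricomi's integral. -/
lemma upperGamma_eq_tricomiIntegral (s : ℂ) {z : ℝ} (hz : 0 < z) :
    upperGamma s z = (z : ℂ) ^ s * Complex.exp (-(z : ℂ)) * tricomiIntegral 1 (1 + s) z := by
  have hz0 : (z : ℂ) ≠ 0 := by exact_mod_cast hz.ne'
  set f : ℝ → ℂ := fun t => (t : ℂ) ^ (s - 1) * Complex.exp (-(t : ℂ)) with hf
  -- Substitution t = zv, followed by v = 1 + u.
  have h1 := MeasureTheory.integral_comp_mul_left_Ioi f 1 hz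
  rw [mul_one, eq_inv_smul_iff₀ hz.ne'] at h1
  have h2 : ∫ v in Set.Ioi (1 : ℝ), f (z * v) = ∫ u in Set.Ioi (0 : ℝ), f (z * (1 + u)) := by
    rw [← (MeasureTheory.measurePreserving_add_left MeasureTheory.volume (1 : ℝ)).setIntegral_preimage_emb
      (measurableEmbedding_addLeft 1), Set.preimage_const_add_Ioi, sub_self]
  rw [upperGamma, ← hf, ← h1, h2, tricomiIntegral, Complex.real_smul,
    ← MeasureTheory.integral_const_mul, ← MeasureTheory.integral_const_mul]
  refine MeasureTheory.setIntegral_congr_fun measurableSet_Ioi fun u hu => ?_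
  have hu' : (0 : ℝ) < u := hu
  simp only [hf, tricomiKernel]
  rw [Complex.ofReal_mul, Complex.mul_cpow_ofReal_nonneg hz.le (by positivity),
    show (1 : ℂ) - 1 = 0 by ring, Complex.cpow_zero, show 1 + s - 1 - 1 = s - 1 by ring,
    Complex.cpow_sub s 1 hz0, Complex.cpow_one]
  have e : Complex.exp (-((z : ℂ) * ((1 + u : ℝ) : ℂ))) =
      Complex.exp (-(z : ℂ)) * Complex.exp (-(z : ℂ) * u) := by
    rw [← Complex.exp_add]; push_cast; ring_nf
  rw [e]
  push_cast
  field_simp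

theorem theorem1 :
    -- expansion of Kummer's function of the first kind
    (∀ a b β z : ℂ, 0 < (b - a).re →
      (∀ n : ℕ, b ≠ -(n : ℂ)) →
      (∀ n : ℕ, b - β ≠ -(n : ℂ)) →
      (∀ n : ℕ, b - β - a ≠ -(n : ℂ)) →
      Summable (fun i : ℕ => (-1 : ℂ) ^ i * laguerreL i (β - i) z *
        (Ring.choose (-a) i / Ring.choose (β - b) i)) ∧
      -- the quotient of the two binomial coefficients with the common factor `1 / a!` cancelled
      kummerM a b z =
        (complexFactorial (b - 1) / complexFactorial (b - 1 - a)) /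
          (complexFactorial (b - β - 1) / complexFactorial (b - β - 1 - a)) *
        ∑' i : ℕ, (-1 : ℂ) ^ i * laguerreL i (β - i) z *
          (Ring.choose (-a) i / Ring.choose (β - b) i) ∧
      -- the quotient of the binomial coefficients themselves, when `a!` is finite
      ((∀ n : ℕ, a ≠ -((n : ℂ) + 1)) →
        kummerM a b z =
          complexBinom (b - 1) a / complexBinom (b - β - 1) a *
          ∑' i : ℕ, (-1 : ℂ) ^ i * laguerreL i (β - i) z *
            (Ring.choose (-a) i / Ring.choose (β - b) i))) ∧
    -- expansion of Kummer's function of the second kind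
    (∀ (a b α : ℂ) (z : ℝ), 0 < z → -(5 / 2 : ℝ) < (α - 2 * b).re →
      (∀ n : ℕ, 2 + α - b ≠ -(n : ℂ)) →
      (∀ n : ℕ, 2 + α - b + a ≠ -(n : ℂ)) →
      Summable (fun i : ℕ => laguerreL i α z *
        (Ring.choose (-a) i / Ring.choose (b - a - α - 2) i)) ∧
      kummerU a b z =
        complexFactorial (1 + α - b) / complexFactorial (1 + α - b + a) *
        ∑' i : ℕ, laguerreL i α z *
          (Ring.choose (-a) i / Ring.choose (b - a - α - 2) i)) ∧
    -- expansion of the upper incomplete Gamma function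
    (∀ (s α : ℂ) (z : ℝ), 0 < z → (s - α / 2).re < 1 / 4 →
      (∀ n : ℕ, s - α ≠ (n : ℂ) + 1) →
      Summable (fun k : ℕ => laguerreL k α z /
        (((k : ℂ) + 1) * Ring.choose ((k : ℂ) + 1 + α - s) (k + 1))) ∧
      upperGamma s z =
        (z : ℂ) ^ s * Complex.exp (-(z : ℂ)) *
        ∑' k : ℕ, laguerreL k α z /
          (((k : ℂ) + 1) * Ring.choose ((k : ℂ) + 1 + α - s) (k + 1))) := by
  refine ⟨fun a b β z h hb hbβ hbβa => ?_, fun a b α z hz hre hc hca => ?_,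
    fun s α z hz hre hs => ?_⟩
  · obtain ⟨h1, h2⟩ := kummerM_laguerre_expansion z h hb hbβ hbβa
    refine ⟨h1, ?_, fun ha => ?_⟩
    · simp only [complexFactorial]
      rw [h2, sub_add_cancel, sub_add_cancel, show b - 1 - a + 1 = b - a by ring,
        show b - β - 1 - a + 1 = b - β - a by ring]
    · have hG : Complex.Gamma (a + 1) ≠ 0 := Complex.Gamma_ne_zero fun n hn =>
        ha n (by linear_combination hn)
      simp only [complexBinom, complexFactorial]
      rw [h2, sub_add_cancel, sub_add_cancel, show b - 1 - a + 1 = b - a by ring,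
        show b - β - 1 - a + 1 = b - β - a by ring]
      have g1 := Complex.Gamma_ne_zero_of_re_pos h
      have g2 := Complex.Gamma_ne_zero hbβ
      have g3 := Complex.Gamma_ne_zero hbβa
      congr 1
      field_simp
  -- The hypothesis on Re(α - 2b) is this convergence threshold, rearranged.
  · have hcond : α.re / 2 + 3 / 4 < (2 + α - b).re := by
      simp only [Complex.sub_re, Complex.add_re, Complex.mul_re, Complex.re_ofNat,
        Complex.im_ofNat, zero_mul, sub_zero] at hre ⊢
      linarith
    have hcf : ∀ n : ℕ, 2 + α - b ≠ -(n : ℂ) := hc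
    have hterm : ∀ i : ℕ, laguerreL i α z * (Ring.choose (-a) i / Ring.choose (b - a - α - 2) i) =
        laguerreL i α z * (poch a i / poch (2 + α - b + a) i) := fun i => by
      rw [show b - a - α - 2 = -(2 + α - b + a) by ring, choose_neg_div_choose_neg]
    simp only [hterm, complexFactorial]
    refine ⟨summable_laguerreL_mul_poch α a hz hcond hca, ?_⟩
    rw [kummerU_eq_laguerreL_series hz hcond hcf hca, show 1 + α - b + 1 = 2 + α - b by ring,
      show 1 + α - b + a + 1 = 2 + α - b + a by ring]
  -- The case a = 1, b = 1 + s, with c = 1 + α - s: the denominator (k+1) binom(k+c, k+1) equals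
  -- (c)_(k+1)/k!, so the term is L_k times (1)_k/(c+1)_k divided by c, and 1/c is the prefactor
  -- Γ(c)/Γ(c+1).
  · have ec : 2 + α - (1 + s) = 1 + α - s := by ring
    have hcond : α.re / 2 + 3 / 4 < (2 + α - (1 + s)).re := by
      have e : (s - α / 2).re = s.re - α.re / 2 := by
        rw [Complex.sub_re, show α / 2 = ((1 / 2 : ℝ) : ℂ) * α by push_cast; ring,
          Complex.re_ofReal_mul]
        ring
      rw [e] at hre
      rw [ec]
      simp only [Complex.sub_re, Complex.add_re, Complex.one_re]
      linarith
    have hc : ∀ n : ℕ, 2 + α - (1 + s) ≠ -(n : ℂ) := fun n h => hs n (by linear_combination -h)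
    have hca : ∀ n : ℕ, 2 + α - (1 + s) + 1 ≠ -(n : ℂ) := fun n h => hc (n + 1) (by
      push_cast; linear_combination h)
    have hseries := laguerreL_series_eq_tricomiIntegral (a := 1) (b := 1 + s) hz (by simp) hcond hc hca
    have hsum := summable_laguerreL_mul_poch α 1 hz hcond hca
    have hc0 : 2 + α - (1 + s) ≠ 0 := by simpa using hc 0
    have hterm : ∀ k : ℕ, laguerreL k α z /
        (((k : ℂ) + 1) * Ring.choose ((k : ℂ) + 1 + α - s) (k + 1)) =
        (2 + α - (1 + s))⁻¹ * (laguerreL k α z * (poch 1 k / poch (2 + α - (1 + s) + 1) k)) := by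
      intro k
      have hk : (k : ℂ) + 1 ≠ 0 := by exact_mod_cast k.succ_ne_zero
      have hf := factorial_ne_zero' k
      rw [show (k : ℂ) + 1 + α - s = 2 + α - (1 + s) + ((k + 1 : ℕ) : ℂ) - 1 by push_cast; ring,
        choose_add_sub_one, poch_succ_left, poch_one, Nat.factorial_succ]
      have := poch_ne_zero hca k
      push_cast
      field_simp
    simp only [hterm]
    refine ⟨hsum.mul_left _, ?_⟩
    have hG := Complex.Gamma_ne_zero hc
    rw [upperGamma_eq_tricomiIntegral s hz, tsum_mul_left]
    rw [Complex.Gamma_add_one _ hc0, Complex.Gamma_one, inv_one, one_mul] at hseries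
    rw [← hseries]
    field_simp
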